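/- Theorem 4.4. A planar doodle diagram is a connected 4-valent graph $M$ (loops and multiple edges allowed a priori) cellularly embedded in the sphere $S^2$; it gives a cell subdivision of $S^2$ whose vertices are the crossings, whose 1-cells are the edges, and whose 2-cells, the regions, are the components of the complement of the graph. The diagram is called super prime if its graph is 4-connected, that is, it has more than 4 vertices and is not disconnected by the removal of fewer than 4 vertices. For a region $R$, the inner complement $R^c$ is the union of all closed cells (vertices, edges and closures of regions) of the subdivision that are disjoint from the boundary of $R$. Let $M$ be a super prime doodle diagram and let $R$ be any of its regions. Then $R^c$ is a disk, i.e. it is homeomorphic to the closed unit disk in $\mathbb{R}^2$. -/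

import Mathlib

noncomputable section

/-- A connected planar doodle diagram: a connected 4-valent graph cellularly embedded in the
oriented sphere, given by its rotation system. `D` is the set of darts (edges with a direction),
`rot` sends a dart to the next one counterclockwise around its initial vertex, and `rev` reverses
a dart. The vertices (crossings), edges and regions are the cycles of `rot`, of `rev` and of
`rot * rev` (follow a dart to its end, then turn into the adjacent dart: this walks around a
region). The surface so described is the sphere exactly when the Euler characteristic is two. -/
structure DoodleDiagram (D : Type*) [Finite D] where
  /-- rotation about the initial vertex -/
  rot : Equiv.Perm D
  /-- reversal of darts -/
  rev : Equiv.Perm D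
  rev_rev : ∀ d, rev (rev d) = d
  rev_ne : ∀ d, rev d ≠ d
  four_valent : ∀ d, Function.minimalPeriod rot d = 4
  connected : MulAction.IsPretransitive (Subgroup.closure {rot, rev} : Subgroup (Equiv.Perm D)) D
  spherical :
    Nat.card (Quotient (Equiv.Perm.SameCycle.setoid rot)) +
        Nat.card (Quotient (Equiv.Perm.SameCycle.setoid (rot * rev))) =
      Nat.card (Quotient (Equiv.Perm.SameCycle.setoid rev)) + 2

/-- A simple graph is `k`-connected if it has more than `k` vertices and is not disconnected by
the removal of fewer than `k` vertices. -/
def SimpleGraph.IsKConnected {V : Type*} (G : SimpleGraph V) (k : ℕ) : Prop :=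
  k < Nat.card V ∧ ∀ S : Finset V, S.card < k → (G.induce {v | v ∉ S}).Connected

namespace DoodleDiagram

variable {D : Type*} [Finite D] (M : DoodleDiagram D)

/-- The crossings of the diagram. -/
def Vertex : Type _ := Quotient (Equiv.Perm.SameCycle.setoid M.rot)

/-- The edges of the diagram. -/
def Edge : Type _ := Quotient (Equiv.Perm.SameCycle.setoid M.rev)

/-- The regions of the diagram. -/
def Region : Type _ := Quotient (Equiv.Perm.SameCycle.setoid (M.rot * M.rev))

/-- The initial vertex of a dart. -/
def vertexOf (d : D) : M.Vertex := Quotient.mk _ d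

/-- The edge underlying a dart. -/
def edgeOf (d : D) : M.Edge := Quotient.mk _ d

/-- The region that lies on a fixed side (the same one for all darts) of a dart. -/
def regionOf (d : D) : M.Region := Quotient.mk _ d

/-- The graph of the diagram on its crossings (connectivity ignores loops and multiplicities). -/
def graph : SimpleGraph M.Vertex where
  Adj u v := u ≠ v ∧ ∃ d, M.vertexOf d = u ∧ M.vertexOf (M.rev d) = v
  symm := by
    constructor
    rintro u v ⟨h, d, hu, hv⟩
    exact ⟨h.symm, M.rev d, hv, by rw [M.rev_rev]; exact hu⟩
  loopless := ⟨fun _ h => h.1 rfl⟩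

/-- A diagram is super prime if its graph is 4-connected. -/
def IsSuperPrime : Prop := M.graph.IsKConnected 4

/-- The cells of the cell subdivision of the sphere defined by the diagram. -/
inductive Cell
  | vertex (v : M.Vertex)
  | edge (e : M.Edge)
  | region (R : M.Region)

namespace Cell

variable {M}

/-- The dimension of a cell. -/
def dim : M.Cell → ℕ
  | vertex _ => 0
  | edge _ => 1
  | region _ => 2

/-- The darts of a cell: those that start at a vertex, traverse an edge in one of its directions,
or run along the boundary of a region. -/
def darts : M.Cell → Set D
  | vertex v => {d | M.vertexOf d = v}
  | edge e => {d | M.edgeOf d = e}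
  | region R => {d | M.regionOf d = R}

/-- `c.IsFaceOf c'`: the cell `c` is contained in the closure of the cell `c'`. Each cell is
contained in its own closure; cells of equal dimension with a common dart are equal. -/
def IsFaceOf (c c' : M.Cell) : Prop :=
  c.dim ≤ c'.dim ∧ (c.darts ∩ c'.darts).Nonempty

end Cell

instance : Finite M.Vertex := Quotient.finite _
instance : Finite M.Edge := Quotient.finite _
instance : Finite M.Region := Quotient.finite _

instance : Finite M.Cell := by
  refine Finite.of_surjective
    (fun s : M.Vertex ⊕ M.Edge ⊕ M.Region =>
      Sum.elim Cell.vertex (Sum.elim Cell.edge Cell.region) s) ?_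
  rintro (v | e | R)
  · exact ⟨Sum.inl v, rfl⟩
  · exact ⟨Sum.inr (Sum.inl e), rfl⟩
  · exact ⟨Sum.inr (Sum.inr R), rfl⟩

instance : Fintype M.Cell := Fintype.ofFinite _

/-- The sphere as the underlying space of the cell subdivision defined by the diagram, through
barycentric coordinates in the barycentric subdivision: there is one barycentre for each cell, and
a point is a convex combination of the barycentres of a chain of cells, each in the closure of the
next. (This is the underlying space of every subdivision in which all closed cells are embedded
polygons, in particular of that given by a super prime diagram.) -/
def sphere : Set (M.Cell → ℝ) :=
  {x | x ∈ stdSimplex ℝ M.Cell ∧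
    ∀ c c', x c ≠ 0 → x c' ≠ 0 → c.IsFaceOf c' ∨ c'.IsFaceOf c}

/-- The closure of a cell, as a subset of the sphere. -/
def closedCell (c : M.Cell) : Set (M.Cell → ℝ) :=
  {x | x ∈ M.sphere ∧ ∀ c', x c' ≠ 0 → c'.IsFaceOf c}

/-- The boundary of a region, as a subset of the sphere: the union of the vertices and edges
in its closure. -/
def boundary (R : M.Region) : Set (M.Cell → ℝ) :=
  {x | x ∈ M.closedCell (Cell.region R) ∧ x (Cell.region R) = 0}

/-- The inner complement of a region `R`, as a subset of the sphere: the union of all closed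
cells (vertices, edges and regions) that have no contact with the boundary of `R`. -/
def innerComplement (R : M.Region) : Set (M.Cell → ℝ) :=
  ⋃ c ∈ {c : M.Cell | Disjoint (M.closedCell c) (M.boundary R)}, M.closedCell c

end DoodleDiagram

end

/-! Consider a closed curve on the sphere that runs inside regions and meets the diagram only at
crossings. Modulo two it separates the edges into two classes. If it passes through fewer than four
crossings, 4-connectedness forces one of the classes to consist of edges joining crossings of the
curve (`IsSuperPrime.exists_edges`). Short curves of this kind give all the local information. One
crossing: a region has a single corner at each of its crossings
(`IsSuperPrime.eq_of_vertexOf_regionOf`). Two crossings: regions that share two crossings share the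
edge between them (`IsSuperPrime.exists_common_edge`). Three crossings: every edge and every
crossing off the boundary of `R` lies on a region without contact to `R`
(`IsSuperPrime.not_touches_of_edge`, `IsSuperPrime.exists_not_touches`), and the regions of this
kind at such a crossing are consecutive (`IsSuperPrime.iff_of_vertexOf_eq`). In particular the inner
complement is a union of closed regions.

The boundary of `R` does not separate the other crossings (`IsSuperPrime.eq_off_boundary`), so the
regions without contact to `R` are connected across common edges
(`IsSuperPrime.iff_of_not_touches`). So are the regions with contact, since each of them can be
rotated into `R` around a common crossing (`iff_of_touches`).

It remains to see that a nonempty proper set `A` of triangles of the barycentric subdivision is a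
disk when `A` and its complement are strongly connected (`IsSphereTriangulation.isDisk`). The
boundary of `A` modulo two contains a simple cycle, which bounds a set `B` of triangles because the
first homology vanishes. Strong connectedness leaves for `B` only `A` or its complement, so the
boundary of `A` is that simple cycle. A set of triangles bounded by a simple cycle is a disk by a
combinatorial Schoenflies theorem (`IsSphereTriangulation.boundsDisk`): induction on the set,
cutting it along a path taken from a triangle at a boundary edge, and gluing two disks along an arc
(`IsDisk.union`), which rests on the radial extension of circle homeomorphisms.

Planarity enters through one dimension count, `map_cornerMap_eq`, which turns the Euler
characteristic into the vanishing of the first homology; it serves both the separation arguments and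
the barycentric subdivision. -/

open Set Metric Function

/-- `X` is homeomorphic to the closed unit disk (when compact) with `S` being the boundary circle. -/
def IsDisk {E : Type*} [TopologicalSpace E] (X S : Set E) : Prop :=
  S ⊆ X ∧ ∃ f : E → ℂ, ContinuousOn f X ∧ BijOn f X (closedBall 0 1) ∧ BijOn f S (sphere 0 1)

/-- `S` is homeomorphic to the unit interval (when compact) with ends `a` and `b`. -/
def IsArc {E : Type*} [TopologicalSpace E] (S : Set E) (a b : E) : Prop :=
  a ∈ S ∧ b ∈ S ∧ ∃ f : E → ℝ, ContinuousOn f S ∧ BijOn f S (Icc 0 1) ∧ f a = 0 ∧ f b = 1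

/-! ### Gluing of maps, concatenation of arcs, extension of boundary maps over disks -/

section Topology

variable {E F : Type*} [TopologicalSpace E] [TopologicalSpace F]

theorem IsCompact.continuousOn_invFunOn [Nonempty E] [T2Space F] {X : Set E} {Y : Set F}
    {f : E → F} (hX : IsCompact X) (hf : ContinuousOn f X) (hb : BijOn f X Y) :
    ContinuousOn (invFunOn f X) Y := by
  rw [continuousOn_iff_isClosed]
  intro t ht
  refine ⟨f '' (X ∩ t), ((hX.inter_right ht).image_of_continuousOn
    (hf.mono inter_subset_left)).isClosed, ?_⟩
  ext y
  constructor
  · rintro ⟨hy, hyY⟩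
    have hy' := hb.surjOn hyY
    exact ⟨⟨_, ⟨invFunOn_mem hy', hy⟩, invFunOn_eq hy'⟩, hyY⟩
  · rintro ⟨⟨x, ⟨hxX, hxt⟩, rfl⟩, hyY⟩
    refine ⟨?_, hyY⟩
    rw [mem_preimage, hb.injOn.leftInvOn_invFunOn hxX]
    exact hxt

/-- The hypothesis `hY` is what keeps the glued map injective: a value taken by both maps already
comes from a point of the overlap. -/
theorem exists_glue {X₁ X₂ : Set E} {Y₁ Y₂ : Set F} {f₁ f₂ : E → F}
    (h₁ : IsClosed X₁) (h₂ : IsClosed X₂) (c₁ : ContinuousOn f₁ X₁) (c₂ : ContinuousOn f₂ X₂)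
    (b₁ : BijOn f₁ X₁ Y₁) (b₂ : BijOn f₂ X₂ Y₂) (he : EqOn f₁ f₂ (X₁ ∩ X₂))
    (hY : Y₁ ∩ Y₂ ⊆ f₁ '' (X₁ ∩ X₂)) :
    ∃ f : E → F, ContinuousOn f (X₁ ∪ X₂) ∧ BijOn f (X₁ ∪ X₂) (Y₁ ∪ Y₂) ∧
      EqOn f f₁ X₁ ∧ EqOn f f₂ X₂ := by
  classical
  have e₁ : EqOn (X₁.piecewise f₁ f₂) f₁ X₁ := piecewise_eqOn _ _ _
  have e₂ : EqOn (X₁.piecewise f₁ f₂) f₂ X₂ := by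
    intro x hx
    by_cases h : x ∈ X₁
    · rw [e₁ h, he ⟨h, hx⟩]
    · exact piecewise_eq_of_notMem _ _ _ h
  refine ⟨X₁.piecewise f₁ f₂, ?_, ?_, e₁, e₂⟩
  · exact (c₁.congr e₁).union_of_isClosed (c₂.congr e₂) h₁ h₂
  · have b₁' := b₁.congr e₁.symm
    have b₂' := b₂.congr e₂.symm
    refine b₁'.union b₂' ?_
    have key : ∀ x ∈ X₁, ∀ y ∈ X₂, f₁ x = f₂ y → x = y := by
      intro x hx y hy hxy
      obtain ⟨z, ⟨hz1, hz2⟩, hz⟩ := hY ⟨b₁.mapsTo hx, hxy ▸ b₂.mapsTo hy⟩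
      have h1 := b₁.injOn hz1 hx hz
      have h2 := b₂.injOn hz2 hy (by rw [← he ⟨hz1, hz2⟩, hz, hxy])
      rw [← h1, h2]
    rintro x (hx | hx) y (hy | hy) hxy
    · exact b₁'.injOn hx hy hxy
    · rw [e₁ hx, e₂ hy] at hxy
      exact key x hx y hy hxy
    · rw [e₂ hx, e₁ hy] at hxy
      exact (key y hy x hx hxy.symm).symm
    · exact b₂'.injOn hx hy hxy

theorem bijOn_affine {p q : ℝ} (hq : 0 < q) :
    BijOn (fun t : ℝ => p + q * t) (Icc 0 1) (Icc p (p + q)) := by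
  refine ⟨?_, ?_, ?_⟩
  · rintro t ⟨h0, h1⟩
    constructor <;> simp only <;> nlinarith
  · intro x _ y _ hxy
    simp only [add_right_inj, mul_eq_mul_left_iff, hq.ne', or_false] at hxy
    exact hxy
  · rintro t ⟨h0, h1⟩
    refine ⟨(t - p) / q, ⟨div_nonneg (by linarith) hq.le, ?_⟩, ?_⟩
    · rw [div_le_one hq]; linarith
    · simp only; field_simp; ring

theorem IsArc.trans {S₁ S₂ : Set E} {a b c : E} (c₁ : IsClosed S₁) (c₂ : IsClosed S₂)
    (h₁ : IsArc S₁ a b) (h₂ : IsArc S₂ b c) (hi : S₁ ∩ S₂ = {b}) : IsArc (S₁ ∪ S₂) a c := by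
  obtain ⟨ha, hb, f, hf, hfb, f0, f1⟩ := h₁
  obtain ⟨hb', hc, g, hg, hgb, g0, g1⟩ := h₂
  obtain ⟨F, hF, hFb, e₁, e₂⟩ := exists_glue (f₁ := fun x => 0 + (1 / 2) * f x)
    (f₂ := fun x => 1 / 2 + (1 / 2) * g x) c₁ c₂
    (by fun_prop) (by fun_prop)
    ((bijOn_affine (p := 0) (q := 1 / 2) (by norm_num)).comp hfb)
    ((bijOn_affine (p := 1 / 2) (q := 1 / 2) (by norm_num)).comp hgb)
    (by rw [hi]; rintro x rfl; simp [f1, g0])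
    (by
      rintro t ⟨⟨_, h1⟩, ⟨h2, _⟩⟩
      rw [hi]
      refine ⟨b, rfl, ?_⟩
      simp only [f1]
      linarith)
  refine ⟨Or.inl ha, Or.inr hc, F, hF, ?_, ?_, ?_⟩
  · convert hFb using 1
    rw [zero_add, Icc_union_Icc_eq_Icc] <;> norm_num
  · rw [e₁ ha]; simp [f0]
  · rw [e₂ hc]; simp [g1]; norm_num

/-- Radial extension of a self-bijection of the circle. -/
theorem exists_cone {θ : ℂ → ℂ} (hc : ContinuousOn θ (sphere 0 1))
    (hb : BijOn θ (sphere 0 1) (sphere 0 1)) :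
    ∃ Θ : ℂ → ℂ, ContinuousOn Θ (closedBall 0 1) ∧ BijOn Θ (closedBall 0 1) (closedBall 0 1) ∧
      EqOn Θ θ (sphere 0 1) := by
  have hu : ∀ z : ℂ, z ≠ 0 → z / (‖z‖ : ℂ) ∈ sphere (0 : ℂ) 1 := by
    intro z hz
    have : ‖z‖ ≠ 0 := norm_ne_zero_iff.2 hz
    simp [this]
  have hn : ∀ z ∈ sphere (0 : ℂ) 1, ‖θ z‖ = 1 := fun z hz => by
    simpa using hb.mapsTo hz
  have hnorm : ∀ z : ℂ, ‖(‖z‖ : ℂ) * θ (z / (‖z‖ : ℂ))‖ = ‖z‖ := by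
    intro z
    rcases eq_or_ne z 0 with rfl | hz
    · simp
    · rw [norm_mul, hn _ (hu z hz)]; simp
  refine ⟨fun z => (‖z‖ : ℂ) * θ (z / (‖z‖ : ℂ)), ?_, ⟨?_, ?_, ?_⟩, ?_⟩
  · intro z _
    rcases eq_or_ne z 0 with rfl | hz
    · apply ContinuousAt.continuousWithinAt
      rw [ContinuousAt, norm_zero]
      simp only [Complex.ofReal_zero, zero_mul]
      rw [tendsto_zero_iff_norm_tendsto_zero]
      simp only [hnorm]
      simpa using (continuous_norm (E := ℂ)).tendsto 0
    · apply ContinuousAt.continuousWithinAt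
      have h1 : ContinuousOn (fun z : ℂ => (‖z‖ : ℂ) * θ (z / (‖z‖ : ℂ))) {z | z ≠ 0} := by
        refine ContinuousOn.mul (by fun_prop) (hc.comp (ContinuousOn.div (by fun_prop)
          (by fun_prop) ?_) ?_)
        · intro x hx; simpa using hx
        · intro x hx; exact hu x hx
      exact h1.continuousAt (isOpen_ne.mem_nhds hz)
  · intro z hz
    rw [mem_closedBall_zero_iff] at hz ⊢
    simp only [hnorm]; exact hz
  · intro z _ w _ hzw
    have h1 : ‖z‖ = ‖w‖ := by rw [← hnorm z, ← hnorm w]; exact congrArg _ hzw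
    rcases eq_or_ne z 0 with rfl | hz
    · symm; simpa using h1.symm
    have hw : w ≠ 0 := by rw [← norm_ne_zero_iff, ← h1]; simpa using hz
    simp only [h1] at hzw
    have hw' : ((‖w‖ : ℝ) : ℂ) ≠ 0 := by simpa using hw
    have h2 := hb.injOn (h1 ▸ hu z hz) (hu w hw) (mul_left_cancel₀ hw' hzw)
    field_simp at h2
    exact h2
  · intro w hw
    rcases eq_or_ne w 0 with rfl | hw0
    · exact ⟨0, by simp, by simp⟩
    obtain ⟨u, hus, huw⟩ := hb.surjOn (hu w hw0)
    have hu1 : ‖u‖ = 1 := by simpa using hus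
    have hw' : ((‖w‖ : ℝ) : ℂ) ≠ 0 := by simpa using hw0
    refine ⟨‖w‖ * u, ?_, ?_⟩
    · rw [mem_closedBall_zero_iff] at hw ⊢
      simpa [hu1] using hw
    · have : ‖((‖w‖ : ℝ) : ℂ) * u‖ = ‖w‖ := by simp [hu1]
      simp only [this]
      rw [mul_div_cancel_left₀ _ hw', huw]
      field_simp
  · intro z hz
    have : ‖z‖ = 1 := by simpa using hz
    simp [this]

/-- A convex body is homeomorphic to the round disk with frontier going to the circle. After this
identification the boundary map becomes a self-bijection of the circle, which extends radially. -/
theorem IsDisk.exists_extension {X S : Set E} (hX : IsCompact X) (h : IsDisk X S) {K : Set ℂ}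
    (hKc : Convex ℝ K) (hKcl : IsClosed K) (hKb : Bornology.IsBounded K)
    (hKi : (interior K).Nonempty) {g : E → ℂ} (hg : ContinuousOn g S)
    (hgb : BijOn g S (frontier K)) :
    ∃ G : E → ℂ, ContinuousOn G X ∧ BijOn G X K ∧ EqOn G g S := by
  obtain ⟨hSX, f, hf, hfb, hfS⟩ := h
  obtain ⟨k, -, hk, hkf⟩ := exists_homeomorph_image_interior_closure_frontier_eq_unitBall hKc hKi hKb
  rw [hKcl.closure_eq] at hk
  have hkb : BijOn k K (closedBall 0 1) := hk ▸ k.injective.injOn.bijOn_image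
  have hkfb : BijOn k (frontier K) (sphere 0 1) := hkf ▸ k.injective.injOn.bijOn_image
  have : Nonempty E := by
    obtain ⟨x, -, -⟩ := hfb.surjOn (mem_closedBall_self zero_le_one)
    exact ⟨x⟩
  set r := invFunOn f X with hr
  have hrc : ContinuousOn r (closedBall 0 1) := hX.continuousOn_invFunOn hf hfb
  have hinv : InvOn r f X (closedBall 0 1) := hfb.invOn_invFunOn
  have hrS : BijOn r (sphere 0 1) S := by
    have h1 : LeftInvOn r f S := hinv.1.mono hSX
    refine BijOn.symm ⟨?_, ?_⟩ hfS
    · exact hinv.2.mono sphere_subset_closedBall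
    · exact h1
  obtain ⟨Θ, hΘ, hΘb, hΘe⟩ := exists_cone (θ := k ∘ g ∘ r)
    (k.continuous.comp_continuousOn (hg.comp (hrc.mono sphere_subset_closedBall) hrS.mapsTo))
    (hkfb.comp (hgb.comp hrS))
  refine ⟨k.symm ∘ Θ ∘ f, k.symm.continuous.comp_continuousOn (hΘ.comp hf hfb.mapsTo), ?_, ?_⟩
  · refine BijOn.comp (t := closedBall 0 1) ?_ (hΘb.comp hfb)
    exact BijOn.symm ⟨fun x _ => k.apply_symm_apply x, fun x _ => k.symm_apply_apply x⟩ hkb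
  · intro x hx
    simp only [comp_apply]
    rw [hΘe (hfS.mapsTo hx)]
    simp only [comp_apply, Homeomorph.symm_apply_apply]
    rw [hinv.1 (hSX hx)]

end Topology

/-! ### Half disks and parametrizations of their boundary arcs -/

section HalfDisks

/-- A half disk, upper for `s = 1` and lower for `s = -1`. -/
def halfDisk (s : ℝ) : Set ℂ := closedBall 0 1 ∩ {z | 0 ≤ s * z.im}

/-- A half circle, upper for `s = 1` and lower for `s = -1`. -/
def halfCircle (s : ℝ) : Set ℂ := sphere 0 1 ∩ {z | 0 ≤ s * z.im}

/-- The horizontal diameter of the unit disk. -/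
def diameter : Set ℂ := closedBall 0 1 ∩ {z | z.im = 0}

theorem frontier_halfDisk {s : ℝ} (hs : s = 1 ∨ s = -1) :
    frontier (halfDisk s) = diameter ∪ halfCircle s := by
  have hcl : IsClosed (halfDisk s) :=
    isClosed_closedBall.inter (isClosed_le continuous_const (by fun_prop))
  have hi : interior {z : ℂ | 0 ≤ s * z.im} = {z | 0 < s * z.im} := by
    rcases hs with rfl | rfl
    · simp
    · simp
  rw [frontier, hcl.closure_eq, halfDisk, interior_inter, hi,
    interior_closedBall _ one_ne_zero]
  ext z
  simp only [mem_sdiff, mem_inter_iff, mem_closedBall_zero_iff, mem_ofPred_eq, mem_ball_zero_iff,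
    diameter, halfCircle, mem_union, mem_sphere_zero_iff_norm, not_and, not_lt]
  have h0 : z.im = 0 ↔ s * z.im = 0 := by rcases hs with rfl | rfl <;> simp
  rw [h0]
  constructor
  · rintro ⟨⟨h1, h2⟩, h3⟩
    rcases h1.lt_or_eq with h | h
    · exact Or.inl ⟨h1, le_antisymm (h3 h) h2⟩
    · exact Or.inr ⟨h, h2⟩
  · rintro (⟨h1, h2⟩ | ⟨h1, h2⟩)
    · exact ⟨⟨h1, h2.ge⟩, fun _ => h2.le⟩
    · exact ⟨⟨h1.le, h2⟩, fun h => absurd h1 h.ne⟩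

theorem convex_halfDisk (s : ℝ) : Convex ℝ (halfDisk s) := by
  refine (convex_closedBall _ _).inter ?_
  refine convex_halfSpace_ge ⟨fun x y => ?_, fun c x => ?_⟩ 0
  · simp [mul_add]
  · simp; ring

theorem isClosed_halfDisk (s : ℝ) : IsClosed (halfDisk s) :=
  isClosed_closedBall.inter (isClosed_le continuous_const (by fun_prop))

theorem isBounded_halfDisk (s : ℝ) : Bornology.IsBounded (halfDisk s) :=
  isBounded_closedBall.subset inter_subset_left

theorem nonempty_interior_halfDisk {s : ℝ} (hs : s = 1 ∨ s = -1) :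
    (interior (halfDisk s)).Nonempty := by
  have ho : IsOpen (ball (0 : ℂ) 1 ∩ {z | 0 < s * z.im}) :=
    isOpen_ball.inter (isOpen_lt continuous_const (by fun_prop))
  have hsub : ball (0 : ℂ) 1 ∩ {z | 0 < s * z.im} ⊆ halfDisk s :=
    inter_subset_inter ball_subset_closedBall fun z (hz : 0 < s * z.im) => hz.le
  refine ⟨(s / 2 : ℝ) * Complex.I, interior_maximal hsub ho ⟨?_, ?_⟩⟩
  · rcases hs with rfl | rfl <;> simp <;> norm_num
  · rcases hs with rfl | rfl <;> norm_num

theorem bijOn_halfCircle {s : ℝ} (hs : s = 1 ∨ s = -1) :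
    BijOn (fun t : ℝ => (⟨t, s * √(1 - t ^ 2)⟩ : ℂ)) (Icc (-1) 1) (halfCircle s) := by
  have hs2 : s * s = 1 := by rcases hs with rfl | rfl <;> norm_num
  refine ⟨?_, ?_, ?_⟩
  · rintro t ⟨h1, h2⟩
    have h3 : 0 ≤ 1 - t ^ 2 := by nlinarith
    refine ⟨?_, ?_⟩
    · rw [mem_sphere_zero_iff_norm, Complex.norm_def, Complex.normSq_mk, Real.sqrt_eq_one]
      have := Real.mul_self_sqrt h3
      linear_combination this * (s * s) + hs2 * (1 - t ^ 2)
    · simp only [mem_ofPred_eq, ← mul_assoc, hs2, one_mul]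
      exact Real.sqrt_nonneg _
  · intro x _ y _ hxy
    exact congrArg Complex.re hxy
  · rintro z ⟨hz, hz2⟩
    rw [mem_sphere_zero_iff_norm, Complex.norm_def, Real.sqrt_eq_one, Complex.normSq_apply] at hz
    refine ⟨z.re, ⟨by nlinarith [mul_self_nonneg z.im], by nlinarith [mul_self_nonneg z.im]⟩, ?_⟩
    apply Complex.ext
    · rfl
    · simp only
      have : 1 - z.re ^ 2 = (s * z.im) ^ 2 := by linear_combination -hz - z.im ^ 2 * hs2
      rw [this, Real.sqrt_sq hz2, ← mul_assoc, hs2, one_mul]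

theorem bijOn_diameter : BijOn (fun t : ℝ => (t : ℂ)) (Icc (-1) 1) diameter := by
  refine ⟨?_, ?_, ?_⟩
  · rintro t ⟨h1, h2⟩
    exact ⟨by simpa using abs_le.2 ⟨h1, h2⟩, by simp⟩
  · intro x _ y _ hxy
    exact Complex.ofReal_injective hxy
  · rintro z ⟨hz, hz2⟩
    have h : (z.re : ℂ) = z := Complex.ext rfl (by simpa using hz2.symm)
    refine ⟨z.re, ?_, h⟩
    rw [← h] at hz
    simpa [abs_le] using hz

end HalfDisks

/-! ### Gluing two disks along an arc -/

section Gluing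

variable {E : Type*} [TopologicalSpace E]

theorem diameter_inter_halfCircle {s : ℝ} : diameter ∩ halfCircle s ⊆ {-1, 1} := by
  rintro z ⟨⟨-, h1⟩, ⟨h2, -⟩⟩
  have h : (z.re : ℂ) = z := Complex.ext rfl (by simpa using h1.symm)
  rw [← h] at h2 ⊢
  rw [mem_sphere_zero_iff_norm, Complex.norm_real, Real.norm_eq_abs, abs_eq zero_le_one] at h2
  rcases h2 with h2 | h2 <;> simp [h2]

/-- A disk bounded by two arcs maps onto a half disk, with the first arc going to the diameter by
a given parametrization. -/
theorem IsDisk.exists_halfDisk {X S₀ S₁ : Set E} {a b : E} (hX : IsCompact X)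
    (c₀ : IsClosed S₀) (c₁ : IsClosed S₁)
    (h : IsDisk X (S₀ ∪ S₁)) {φ : E → ℝ} (hφ : ContinuousOn φ S₀)
    (hφb : BijOn φ S₀ (Icc (-1) 1)) (ha : a ∈ S₀) (hb : b ∈ S₀) (h0 : φ a = -1) (h1 : φ b = 1)
    (hS₁ : IsArc S₁ a b) (hi : S₀ ∩ S₁ = {a, b}) {s : ℝ} (hs : s = 1 ∨ s = -1) :
    ∃ G : E → ℂ, ContinuousOn G X ∧ BijOn G X (halfDisk s) ∧ EqOn G (fun x => (φ x : ℂ)) S₀ ∧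
      BijOn G S₁ (halfCircle s) := by
  obtain ⟨-, -, ψ, hψ, hψb, p0, p1⟩ := hS₁
  have hψb' : BijOn (fun x => -1 + 2 * ψ x) S₁ (Icc (-1) 1) := by
    have h := (bijOn_affine (p := -1) (q := 2) two_pos).comp hψb
    rwa [show (-1 : ℝ) + 2 = 1 by norm_num] at h
  have hc : Continuous fun t : ℝ => (⟨t, s * √(1 - t ^ 2)⟩ : ℂ) := by
    have : (fun t : ℝ => (⟨t, s * √(1 - t ^ 2)⟩ : ℂ)) =
        fun t : ℝ => (t : ℂ) + ((s * √(1 - t ^ 2) : ℝ) : ℂ) * Complex.I := by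
      ext t
      exact Complex.mk_eq_add_mul_I _ _
    rw [this]
    fun_prop
  -- The boundary map is prescribed by `φ` on `S₀` and by the vertical lift of the diameter to the
  -- half circle on `S₁`; at the two common ends both give `-1` and `1`.
  obtain ⟨g, hg, hgb, e₀, e₁⟩ := exists_glue (f₁ := fun x => (φ x : ℂ))
    (f₂ := (fun t : ℝ => (⟨t, s * √(1 - t ^ 2)⟩ : ℂ)) ∘ fun x => -1 + 2 * ψ x) c₀ c₁
    (by fun_prop) (hc.comp_continuousOn (by fun_prop)) (bijOn_diameter.comp hφb)
    ((bijOn_halfCircle hs).comp hψb')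
    (by
      rw [hi]
      rintro x (rfl | rfl)
      · apply Complex.ext <;> simp [p0, h0]
      · apply Complex.ext <;> simp [p1, h1] <;> norm_num)
    (by
      rw [hi, image_pair]
      simpa [h0, h1] using diameter_inter_halfCircle)
  rw [← frontier_halfDisk hs] at hgb
  obtain ⟨G, hG, hGb, hGe⟩ := h.exists_extension hX (convex_halfDisk s) (isClosed_halfDisk s)
    (isBounded_halfDisk s) (nonempty_interior_halfDisk hs) hg hgb
  refine ⟨G, hG, hGb, fun x hx => (hGe (Or.inl hx)).trans (e₀ hx), ?_⟩
  refine BijOn.congr ((bijOn_halfCircle hs).comp hψb') ?_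
  intro x hx
  rw [hGe (Or.inr hx), e₁ hx]

/-- Two disks glued along a boundary arc form a disk. -/
theorem IsDisk.union {X₁ X₂ S₀ S₁ S₂ : Set E} [T2Space E] {a b : E} (hX₁ : IsCompact X₁)
    (hX₂ : IsCompact X₂)
    (c₀ : IsClosed S₀) (c₁ : IsClosed S₁) (c₂ : IsClosed S₂)
    (h₁ : IsDisk X₁ (S₀ ∪ S₁)) (h₂ : IsDisk X₂ (S₀ ∪ S₂))
    (a₀ : IsArc S₀ a b) (a₁ : IsArc S₁ a b) (a₂ : IsArc S₂ a b)
    (i₁ : S₀ ∩ S₁ = {a, b}) (i₂ : S₀ ∩ S₂ = {a, b})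
    (hi : X₁ ∩ X₂ = S₀) : IsDisk (X₁ ∪ X₂) (S₁ ∪ S₂) := by
  obtain ⟨ha, hb, ψ, hψ, hψb, p0, p1⟩ := a₀
  have hφb : BijOn (fun x => -1 + 2 * ψ x) S₀ (Icc (-1) 1) := by
    have h := (bijOn_affine (p := -1) (q := 2) two_pos).comp hψb
    rwa [show (-1 : ℝ) + 2 = 1 by norm_num] at h
  have hφ : ContinuousOn (fun x => -1 + 2 * ψ x) S₀ := by fun_prop
  obtain ⟨G₁, hG₁, hb₁, e₁, s₁⟩ := h₁.exists_halfDisk hX₁ c₀ c₁ hφ hφb ha hb (by simp [p0])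
    (by simp [p1]; norm_num) a₁ i₁ (Or.inl rfl)
  obtain ⟨G₂, hG₂, hb₂, e₂, s₂⟩ := h₂.exists_halfDisk hX₂ c₀ c₂ hφ hφb ha hb (by simp [p0])
    (by simp [p1]; norm_num) a₂ i₂ (Or.inr rfl)
  -- Both maps restrict to the same parametrization of `S₀`, and the two half disks meet only in the
  -- diameter, which is the image of `S₀`.
  obtain ⟨F, hF, hFb, E₁, E₂⟩ := exists_glue hX₁.isClosed hX₂.isClosed hG₁ hG₂ hb₁ hb₂
    (by rw [hi]; exact e₁.trans e₂.symm)
    (by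
      rw [hi, e₁.image_eq]
      have h3 := (bijOn_diameter.comp hφb).image_eq
      simp only [comp_def] at h3
      rw [h3]
      rintro z ⟨⟨h1, h2⟩, ⟨-, h3⟩⟩
      refine ⟨h1, ?_⟩
      simp only [mem_ofPred_eq] at h2 h3 ⊢
      linarith)
  have hD : halfDisk 1 ∪ halfDisk (-1) = closedBall 0 1 := by
    rw [halfDisk, halfDisk, ← inter_union_distrib_left, inter_eq_left]
    intro z _
    rcases le_total 0 z.im with h | h
    · left; simpa using h
    · right; simpa using h
  have hC : halfCircle 1 ∪ halfCircle (-1) = sphere 0 1 := by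
    rw [halfCircle, halfCircle, ← inter_union_distrib_left, inter_eq_left]
    intro z _
    rcases le_total 0 z.im with h | h
    · left; simpa using h
    · right; simpa using h
  have u₁ : S₁ ⊆ X₁ := subset_union_right.trans h₁.1
  have u₂ : S₂ ⊆ X₂ := subset_union_right.trans h₂.1
  refine ⟨union_subset_union u₁ u₂, F, hF, hD ▸ hFb, hC ▸ ?_⟩
  refine (s₁.congr (E₁.mono u₁).symm).union (s₂.congr (E₂.mono u₂).symm) ?_
  exact hFb.injOn.mono (union_subset_union u₁ u₂)

theorem IsDisk.nonempty_homeomorph {X S : Set E} (hX : IsCompact X) (h : IsDisk X S) :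
    Nonempty (X ≃ₜ closedBall (0 : EuclideanSpace ℝ (Fin 2)) 1) := by
  obtain ⟨-, f, hf, hb, -⟩ := h
  have : CompactSpace X := isCompact_iff_compactSpace.1 hX
  have h1 : Continuous (hb.equiv f) := by
    exact (continuousOn_iff_continuous_domRestrict.1 hf).subtype_mk _
  have e : X ≃ₜ closedBall (0 : ℂ) 1 := Continuous.homeoOfEquivCompactToT2 h1
  refine ⟨e.trans (Complex.orthonormalBasisOneI.repr.toHomeomorph.subtype fun z => ?_)⟩
  simp

end Gluing

/-! ### Geometric realizations in barycentric coordinates -/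

section Realization

variable {V : Type*} [Fintype V]

/-- The geometric realization of a family of simplices, in barycentric coordinates. -/
def realization (𝓕 : Set (Finset V)) : Set (V → ℝ) :=
  {x | x ∈ stdSimplex ℝ V ∧ ∃ t ∈ 𝓕, ∀ c, x c ≠ 0 → c ∈ t}

theorem isCompact_realization (𝓕 : Set (Finset V)) : IsCompact (realization 𝓕) := by
  have : realization 𝓕 = ⋃ t ∈ 𝓕, stdSimplex ℝ V ∩ {x | ∀ c, c ∉ t → x c = 0} := by
    ext x
    simp only [realization, mem_ofPred_eq, mem_iUnion, mem_inter_iff, exists_prop]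
    constructor
    · rintro ⟨h, t, ht, h2⟩
      exact ⟨t, ht, h, fun c hc => by_contra fun h3 => hc (h2 c h3)⟩
    · rintro ⟨t, ht, h, h2⟩
      exact ⟨h, t, ht, fun c hc => by_contra fun h3 => hc (h2 c h3)⟩
  rw [this]
  refine 𝓕.toFinite.isCompact_biUnion fun t _ => (isCompact_stdSimplex ℝ V).inter_right ?_
  have h2 : {x : V → ℝ | ∀ c, c ∉ t → x c = 0} = ⋂ c, ⋂ (_ : c ∉ t), {x | x c = 0} := by
    ext x; simp
  rw [h2]
  exact isClosed_iInter fun c => isClosed_iInter fun _ =>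
    isClosed_eq (continuous_apply c) continuous_const

theorem realization_union (𝓕 𝓖 : Set (Finset V)) :
    realization (𝓕 ∪ 𝓖) = realization 𝓕 ∪ realization 𝓖 := by
  ext x
  simp only [realization, mem_ofPred_eq, mem_union]
  constructor
  · rintro ⟨h, t, ht | ht, h2⟩
    · exact Or.inl ⟨h, t, ht, h2⟩
    · exact Or.inr ⟨h, t, ht, h2⟩
  · rintro (⟨h, t, ht, h2⟩ | ⟨h, t, ht, h2⟩)
    · exact ⟨h, t, Or.inl ht, h2⟩
    · exact ⟨h, t, Or.inr ht, h2⟩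

theorem exists_ne_zero_of_mem_stdSimplex {x : V → ℝ} (hx : x ∈ stdSimplex ℝ V) :
    ∃ c, x c ≠ 0 := by
  by_contra! h
  have := hx.2
  simp [h] at this

variable [DecidableEq V]

theorem eq_single_of_mem_stdSimplex {x : V → ℝ} (hx : x ∈ stdSimplex ℝ V) {c : V}
    (h : ∀ d, x d ≠ 0 → d = c) : x = Pi.single c 1 := by
  have h0 : ∀ d, d ≠ c → x d = 0 := fun d hd => by_contra fun h3 => hd (h d h3)
  have h1 : x c = 1 := by
    rw [← hx.2]
    exact (Finset.sum_eq_single c (fun d _ hd => h0 d hd) (by simp)).symm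
  ext d
  rcases eq_or_ne d c with rfl | hd
  · simp [h1]
  · simp [hd, h0 d hd]

theorem single_mem_realization {𝓕 : Set (Finset V)} {c : V} {t : Finset V} (ht : t ∈ 𝓕)
    (hc : c ∈ t) : Pi.single c 1 ∈ realization 𝓕 := by
  refine ⟨single_mem_stdSimplex ℝ c, t, ht, fun d hd => ?_⟩
  rcases eq_or_ne d c with rfl | hdc
  · exact hc
  · simp [hdc] at hd

end Realization

/-! ### Paths as lists of vertices and as chains modulo two -/

section Paths

variable {V : Type*} [DecidableEq V]

/-- The edges of a path given by its list of vertices. -/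
def pathEdges : List V → Set (Finset V)
  | a :: b :: l => insert {a, b} (pathEdges (b :: l))
  | _ => ∅

/-- The edges of a path as a chain with coefficients modulo two. -/
def pathChain : List V → Finset V → ZMod 2
  | a :: b :: l => fun e => (if e = {a, b} then 1 else 0) + pathChain (b :: l) e
  | _ => 0

@[simp] theorem pathEdges_nil : pathEdges ([] : List V) = ∅ := rfl
@[simp] theorem pathEdges_singleton (a : V) : pathEdges [a] = ∅ := rfl
theorem pathEdges_cons (a b : V) (l : List V) :
    pathEdges (a :: b :: l) = insert {a, b} (pathEdges (b :: l)) := rfl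
@[simp] theorem pathChain_singleton (a : V) : pathChain [a] = 0 := rfl
theorem pathChain_cons (a b : V) (l : List V) (e : Finset V) :
    pathChain (a :: b :: l) e = (if e = {a, b} then 1 else 0) + pathChain (b :: l) e := rfl

theorem mem_of_mem_pathEdges {l : List V} {e : Finset V} (he : e ∈ pathEdges l) {c : V}
    (hc : c ∈ e) : c ∈ l := by
  induction l with
  | nil => simp at he
  | cons a l ih =>
    cases l with
    | nil => simp at he
    | cons b l =>
      rw [pathEdges_cons] at he
      rcases he with rfl | he
      · simp only [Finset.mem_insert, Finset.mem_singleton] at hc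
        rcases hc with rfl | rfl <;> simp
      · exact List.mem_cons_of_mem _ (ih he)

theorem card_of_mem_pathEdges {l : List V} (hl : l.Nodup) {e : Finset V}
    (he : e ∈ pathEdges l) : e.card = 2 := by
  induction l with
  | nil => simp at he
  | cons a l ih =>
    cases l with
    | nil => simp at he
    | cons b l =>
      rw [pathEdges_cons] at he
      rcases he with rfl | he
      · refine Finset.card_pair ?_
        rintro rfl
        simp at hl
      · exact ih (List.nodup_cons.1 hl).2 he

theorem mem_pathEdges_of_pathChain_ne_zero {l : List V} {e : Finset V}
    (he : pathChain l e ≠ 0) : e ∈ pathEdges l := by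
  induction l with
  | nil => exact absurd rfl he
  | cons a l ih =>
    cases l with
    | nil => exact absurd rfl he
    | cons b l =>
      rw [pathEdges_cons]
      rw [pathChain_cons] at he
      by_cases h : e = {a, b}
      · exact Or.inl h
      · rw [if_neg h, zero_add] at he
        exact Or.inr (ih he)

theorem pathChain_eq_zero {l : List V} {e : Finset V} (he : e ∉ pathEdges l) :
    pathChain l e = 0 :=
  by_contra fun h => he (mem_pathEdges_of_pathChain_ne_zero h)

theorem pathChain_eq_one {l : List V} (hl : l.Nodup) {e : Finset V}
    (he : e ∈ pathEdges l) : pathChain l e = 1 := by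
  induction l with
  | nil => simp at he
  | cons a l ih =>
    cases l with
    | nil => simp at he
    | cons b l =>
      rw [pathEdges_cons] at he
      rw [List.nodup_cons] at hl
      rw [pathChain_cons]
      by_cases h : e = {a, b}
      · rw [if_pos h, pathChain_eq_zero, add_zero]
        intro h2
        exact hl.1 (mem_of_mem_pathEdges h2 (by simp [h]))
      · rw [if_neg h, zero_add]
        exact ih hl.2 (he.resolve_left h)

theorem pathEdges_append (l₁ l₂ : List V) (a : V) :
    pathEdges (l₁ ++ a :: l₂) = pathEdges (l₁ ++ [a]) ∪ pathEdges (a :: l₂) := by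
  induction l₁ with
  | nil => simp
  | cons b l ih =>
    cases l with
    | nil => simp [pathEdges_cons]
    | cons c l =>
      simp only [List.cons_append, pathEdges_cons] at ih ⊢
      rw [ih, insert_union]

theorem pathChain_append (l₁ l₂ : List V) (a : V) :
    pathChain (l₁ ++ a :: l₂) = pathChain (l₁ ++ [a]) + pathChain (a :: l₂) := by
  ext e
  induction l₁ with
  | nil => simp
  | cons b l ih =>
    cases l with
    | nil => simp [pathChain_cons]
    | cons c l =>
      simp only [List.cons_append, pathChain_cons, Pi.add_apply] at ih ⊢
      rw [ih, add_assoc]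

theorem pathEdges_reverse (l : List V) : pathEdges l.reverse = pathEdges l := by
  induction l with
  | nil => rfl
  | cons a l ih =>
    cases l with
    | nil => rfl
    | cons b l =>
      simp only [List.reverse_cons, List.append_assoc, List.singleton_append] at ih ⊢
      rw [pathEdges_append, ih, pathEdges_cons, pathEdges_cons, pathEdges_singleton,
        union_comm, Finset.pair_comm b a]
      simp

theorem pathChain_reverse (l : List V) : pathChain l.reverse = pathChain l := by
  induction l with
  | nil => rfl
  | cons a l ih =>
    cases l with
    | nil => rfl
    | cons b l =>
      simp only [List.reverse_cons, List.append_assoc, List.singleton_append] at ih ⊢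
      rw [pathChain_append, ih]
      ext e
      rw [Pi.add_apply, pathChain_cons, pathChain_cons, Finset.pair_comm b a]
      simp [add_comm]

variable [Fintype V]

/-- The coefficient at `w` of the boundary of a 1-chain. -/
def vertexSum (k : Finset V → ZMod 2) (w : V) : ZMod 2 := ∑ u ∈ Finset.univ.erase w, k {w, u}

theorem vertexSum_add (k k' : Finset V → ZMod 2) (w : V) :
    vertexSum (k + k') w = vertexSum k w + vertexSum k' w := by
  simp [vertexSum, Finset.sum_add_distrib]

theorem vertexSum_edge {a b : V} (hab : a ≠ b) (w : V) :
    vertexSum (fun e => if e = {a, b} then 1 else 0) w =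
      (if w = a then 1 else 0) + if w = b then 1 else 0 := by
  have key : ∀ c d : V, c ≠ d → vertexSum (fun e => if e = {c, d} then 1 else 0) c = 1 := by
    intro c d hcd
    rw [vertexSum, Finset.sum_eq_single d]
    · simp
    · intro u hu hud
      rw [if_neg]
      intro h
      have : u ∈ ({c, d} : Finset V) := h ▸ (by simp)
      simp only [Finset.mem_insert, Finset.mem_singleton] at this
      rcases this with rfl | rfl
      · simp at hu
      · exact hud rfl
    · simp [hcd.symm]
  rcases eq_or_ne w a with rfl | ha
  · rw [key _ _ hab]; simp [hab]
  rcases eq_or_ne w b with rfl | hb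
  · rw [Finset.pair_comm, key _ _ hab.symm]; simp [ha]
  · rw [if_neg ha, if_neg hb, add_zero]
    refine Finset.sum_eq_zero fun u _ => if_neg fun h => ?_
    have : w ∈ ({a, b} : Finset V) := h ▸ (by simp)
    simp [ha, hb] at this

/-- The boundary of a path telescopes to its two ends. Paths are written with explicit ends `x`, `z`
and inner vertices `m`, so that a cycle can be given as two paths with the same ends. -/
theorem vertexSum_pathChain {x z : V} {m : List V} (h : (x :: (m ++ [z])).Nodup) (w : V) :
    vertexSum (pathChain (x :: (m ++ [z]))) w =
      (if w = x then 1 else 0) + if w = z then 1 else 0 := by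
  induction m generalizing x with
  | nil =>
    have hxz : x ≠ z := by rintro rfl; simp at h
    rw [← vertexSum_edge hxz]
    congr 1
    ext e
    simp [pathChain_cons]
  | cons y m ih =>
    have hxy : x ≠ y := by rintro rfl; simp at h
    have h1 : pathChain (x :: (y :: m ++ [z])) =
        (fun e => if e = {x, y} then 1 else 0) + pathChain (y :: (m ++ [z])) := by
      ext e
      rfl
    rw [h1, vertexSum_add, vertexSum_edge hxy, ih (List.nodup_cons.1 h).2]
    have h2 : ∀ a b c : ZMod 2, a + b + (b + c) = a + c := by decide
    exact h2 _ _ _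

/-- A cycle modulo two supported, near the inner vertices of a path, on the path is constant
along the path. -/
theorem exists_eq_of_vertexSum_eq_zero {k : Finset V → ZMod 2} (hk : ∀ w, vertexSum k w = 0)
    {x z : V} {m : List V} (h : (x :: (m ++ [z])).Nodup)
    (hm : ∀ w ∈ m, ∀ u, u ≠ w → k {w, u} ≠ 0 → {w, u} ∈ pathEdges (x :: (m ++ [z]))) :
    ∃ c, ∀ e ∈ pathEdges (x :: (m ++ [z])), k e = c := by
  induction m generalizing x with
  | nil =>
    refine ⟨k {x, z}, fun e he => ?_⟩
    simp only [List.nil_append, pathEdges_cons, pathEdges_singleton] at he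
    rcases he with rfl | he
    · rfl
    · exact absurd he (notMem_empty _)
  | cons y m ih =>
    have hn := List.nodup_cons.1 h
    have hx : x ∉ y :: (m ++ [z]) := hn.1
    obtain ⟨c, hc⟩ := ih hn.2 (by
      intro w hw u hu hku
      have h1 := hm w (List.mem_cons_of_mem _ hw) u hu hku
      rw [List.cons_append, pathEdges_cons] at h1
      rcases h1 with h1 | h1
      · exfalso
        have : w ∈ ({x, y} : Finset V) := h1 ▸ (by simp)
        simp only [Finset.mem_insert, Finset.mem_singleton] at this
        rcases this with rfl | rfl
        · exact hx (by simp [hw])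
        · have := (List.nodup_cons.1 hn.2).1
          exact this (by simp [hw])
      · exact h1)
    refine ⟨c, fun e he => ?_⟩
    rw [List.cons_append, pathEdges_cons] at he
    rcases he with rfl | he
    swap
    · exact hc e he
    obtain ⟨v, l, hvl⟩ : ∃ v l, m ++ [z] = v :: l := by
      cases m with
      | nil => exact ⟨z, [], rfl⟩
      | cons v m => exact ⟨v, m ++ [z], rfl⟩
    simp only [List.cons_append, hvl] at h hm hn hx hc
    have hn2 := List.nodup_cons.1 hn.2
    have hyv : v ≠ y := by rintro rfl; exact hn2.1 (by simp)
    have hyx : x ≠ y := by rintro rfl; exact hx (by simp)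
    have hxv : x ≠ v := by rintro rfl; exact hx (by simp)
    -- At the inner vertex `y` only the two path edges can carry `k`, so the cycle condition there
    -- makes their coefficients equal.
    have h0 : vertexSum k y = k {y, x} + k {y, v} := by
      rw [vertexSum, ← Finset.sum_pair (f := fun u => k {y, u}) hxv]
      symm
      apply Finset.sum_subset
      · intro u hu
        simp only [Finset.mem_insert, Finset.mem_singleton] at hu
        rcases hu with rfl | rfl <;> simp [hyv, hyx]
      · intro u hu huv
        by_contra h3
        have h4 := hm y (by simp) u (Finset.ne_of_mem_erase hu) h3
        simp only [Finset.mem_insert, Finset.mem_singleton, not_or] at huv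
        rw [pathEdges_cons, pathEdges_cons] at h4
        have hu' : u ∈ ({y, u} : Finset V) := by simp
        have hy' : y ∈ ({y, u} : Finset V) := by simp
        have huy := Finset.ne_of_mem_erase hu
        rcases h4 with h4 | h4 | h4
        · rw [h4] at hu'
          simp [huy, huv.1] at hu'
        · rw [h4] at hu'
          simp [huy, huv.2] at hu'
        · exact hn2.1 (mem_of_mem_pathEdges h4 hy')
    rw [hk y] at h0
    have h5 : k {y, v} = c := hc _ (Or.inl rfl)
    rw [Finset.pair_comm x y, ← h5]
    have h6 : ∀ a b : ZMod 2, 0 = a + b → a = b := by decide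
    exact h6 _ _ h0

end Paths

/-! ### Realizations of paths are arcs -/

section Arcs

variable {V : Type*} [Fintype V] [DecidableEq V]

theorem single_apply_nonneg {V : Type*} [DecidableEq V] {t : ℝ} (ht : 0 ≤ t) (c d : V) : 0 ≤ (Pi.single c t : V → ℝ) d := by
  rw [Pi.single_apply]
  split_ifs
  exacts [ht, le_rfl]

theorem isArc_edge {x z : V} (h : x ≠ z) :
    IsArc (realization {{x, z}}) (Pi.single x (1 : ℝ)) (Pi.single z 1) := by
  have hs : ∀ p ∈ realization {({x, z} : Finset V)}, p x + p z = 1 ∧ ∀ c, c ≠ x → c ≠ z → p c = 0 := by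
    rintro p ⟨hp, t, rfl, ht⟩
    have h0 : ∀ c, c ≠ x → c ≠ z → p c = 0 := by
      intro c h1 h2
      by_contra h3
      simpa [h1, h2] using ht c h3
    refine ⟨?_, h0⟩
    rw [← hp.2, ← Finset.sum_pair h]
    apply Finset.sum_subset (Finset.subset_univ _)
    intro c _ hc
    simp only [Finset.mem_insert, Finset.mem_singleton, not_or] at hc
    exact h0 c hc.1 hc.2
  refine ⟨single_mem_realization rfl (by simp), single_mem_realization rfl (by simp),
    fun p => p z, by fun_prop, ⟨?_, ?_, ?_⟩, by simp [h.symm], by simp⟩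
  · intro p hp
    have h1 := hs p hp
    have h2 := hp.1.1 x
    exact ⟨hp.1.1 z, by linarith⟩
  · intro p hp q hq hpq
    have h1 := hs p hp
    have h2 := hs q hq
    ext c
    by_cases hc : c = z
    · rw [hc]; exact hpq
    by_cases hc' : c = x
    · rw [hc']
      simp only at hpq
      linarith
    · rw [h1.2 c hc' hc, h2.2 c hc' hc]
  · rintro t ⟨h0, h1⟩
    refine ⟨Pi.single x (1 - t) + Pi.single z t, ⟨⟨fun c => ?_, ?_⟩, _, rfl, fun c hc => ?_⟩, ?_⟩
    · have h1' : 0 ≤ 1 - t := by linarith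
      exact add_nonneg (single_apply_nonneg h1' x c) (single_apply_nonneg h0 z c)
    · simp [Finset.sum_add_distrib]
    · by_contra h3
      simp only [Finset.mem_insert, Finset.mem_singleton, not_or] at h3
      simp [h3.1, h3.2] at hc
    · simp [h.symm]

theorem isArc_path {x z : V} {m : List V} (h : (x :: (m ++ [z])).Nodup) :
    IsArc (realization (pathEdges (x :: (m ++ [z])))) (Pi.single x (1 : ℝ)) (Pi.single z 1) := by
  induction m generalizing x with
  | nil =>
    rw [List.nil_append, pathEdges_cons, pathEdges_singleton]
    simpa using isArc_edge (x := x) (z := z) (by rintro rfl; simp at h)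
  | cons y m ih =>
    have hn := List.nodup_cons.1 h
    have hxy : x ≠ y := by rintro rfl; simp at h
    rw [List.cons_append, pathEdges_cons, insert_eq, realization_union]
    have a₁ := isArc_edge hxy
    have a₂ := ih hn.2
    refine a₁.trans (isCompact_realization _).isClosed (isCompact_realization _).isClosed a₂ ?_
    refine Subset.antisymm ?_ (singleton_subset_iff.2 ⟨a₁.2.1, a₂.1⟩)
    rintro p ⟨⟨hp, t, rfl, ht⟩, ⟨-, e, he, hpe⟩⟩
    refine eq_single_of_mem_stdSimplex hp fun d hd => ?_
    have h1 := ht d hd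
    have h2 := mem_of_mem_pathEdges he (hpe d hd)
    simp only [Finset.mem_insert, Finset.mem_singleton] at h1
    rcases h1 with rfl | rfl
    · exact absurd h2 hn.1
    · rfl

/-- The paths share only their ends, so a common edge would be `{x, z}`; a path with an inner vertex
does not contain that edge. This is why two paths forming a cycle are never both required to have
inner vertices, but at least one of them is. -/
theorem disjoint_pathEdges {V : Type*} [DecidableEq V] {x z : V} {m m' : List V} (h : (x :: z :: (m ++ m')).Nodup)
    (hm : m ≠ [] ∨ m' ≠ []) {e : Finset V} (he : e ∈ pathEdges (x :: (m ++ [z])))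
    (he' : e ∈ pathEdges (x :: (m' ++ [z]))) : False := by
  have key : ∀ l : List V, l ≠ [] → (x :: (l ++ [z])).Nodup →
      ({x, z} : Finset V) ∉ pathEdges (x :: (l ++ [z])) := by
    intro l hl hn h1
    obtain ⟨y, l, rfl⟩ := List.exists_cons_of_ne_nil hl
    rw [List.cons_append, pathEdges_cons] at h1
    have hn' := List.nodup_cons.1 hn
    rcases h1 with h1 | h1
    · have h2 : z ∈ ({x, y} : Finset V) := h1 ▸ (by simp)
      simp only [Finset.mem_insert, Finset.mem_singleton] at h2
      rcases h2 with rfl | rfl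
      · exact hn'.1 (by simp)
      · exact (List.nodup_cons.1 hn'.2).1 (by simp)
    · exact hn'.1 (mem_of_mem_pathEdges h1 (by simp))
  have n₁ : (x :: (m ++ [z])).Nodup := by
    simp only [List.nodup_cons, List.mem_cons, List.mem_append, List.nodup_append] at h ⊢
    grind
  have n₂ : (x :: (m' ++ [z])).Nodup := by
    simp only [List.nodup_cons, List.mem_cons, List.mem_append, List.nodup_append] at h ⊢
    grind
  have hsub : e ⊆ {x, z} := by
    intro c hc
    have h1 := mem_of_mem_pathEdges he hc
    have h2 := mem_of_mem_pathEdges he' hc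
    simp only [List.nodup_cons, List.mem_cons, List.mem_append, List.nodup_append] at h h1 h2
    simp only [Finset.mem_insert, Finset.mem_singleton]
    grind
  have hxz : x ≠ z := by rintro rfl; simp at h
  have h3 : e = {x, z} := Finset.eq_of_subset_of_card_le hsub (by
    rw [Finset.card_pair hxz, card_of_mem_pathEdges n₁ he])
  subst h3
  rcases hm with hm | hm
  · exact key m hm n₁ he
  · exact key m' hm n₂ he'

theorem realization_path_inter {x z : V} {m m' : List V} (h : (x :: z :: (m ++ m')).Nodup)
    (hm : m ≠ [] ∨ m' ≠ []) :
    realization (pathEdges (x :: (m ++ [z]))) ∩ realization (pathEdges (x :: (m' ++ [z]))) =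
      {Pi.single x (1 : ℝ), Pi.single z 1} := by
  have n₁ : (x :: (m ++ [z])).Nodup := by
    simp only [List.nodup_cons, List.mem_cons, List.mem_append, List.nodup_append] at h ⊢
    grind
  have n₂ : (x :: (m' ++ [z])).Nodup := by
    simp only [List.nodup_cons, List.mem_cons, List.mem_append, List.nodup_append] at h ⊢
    grind
  apply Subset.antisymm
  · rintro p ⟨⟨hp, e, he, hpe⟩, ⟨-, e', he', hpe'⟩⟩
    have hsub : ∀ d, p d ≠ 0 → d = x ∨ d = z := by
      intro c hc
      have h1 := mem_of_mem_pathEdges he (hpe c hc)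
      have h2 := mem_of_mem_pathEdges he' (hpe' c hc)
      simp only [List.nodup_cons, List.mem_cons, List.mem_append, List.nodup_append] at h h1 h2
      grind
    by_cases hx : p x = 0
    · right
      refine eq_single_of_mem_stdSimplex hp fun d hd => (hsub d hd).resolve_left ?_
      rintro rfl
      exact hd hx
    by_cases hz : p z = 0
    · left
      refine eq_single_of_mem_stdSimplex hp fun d hd => (hsub d hd).resolve_right ?_
      rintro rfl
      exact hd hz
    exfalso
    have hxz : x ≠ z := by rintro rfl; simp at h
    have key : ∀ f : Finset V, f.card = 2 → (∀ d, p d ≠ 0 → d ∈ f) → {x, z} = f := by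
      intro f hf hpf
      refine Finset.eq_of_subset_of_card_le ?_ ?_
      · intro c hc
        simp only [Finset.mem_insert, Finset.mem_singleton] at hc
        rcases hc with rfl | rfl
        · exact hpf _ hx
        · exact hpf _ hz
      · rw [Finset.card_pair hxz, hf]
    rw [← key e (card_of_mem_pathEdges n₁ he) hpe] at he
    rw [← key e' (card_of_mem_pathEdges n₂ he') hpe'] at he'
    exact disjoint_pathEdges h hm he he'
  · have a₁ := isArc_path n₁
    have a₂ := isArc_path n₂
    rintro p (rfl | rfl)
    · exact ⟨a₁.1, a₂.1⟩
    · exact ⟨a₁.2.1, a₂.2.1⟩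

end Arcs

/-! ### A single triangle is a disk -/

section Triangle

/-- The standard right triangle. -/
def rightTriangle : Set ℂ := {z | 0 ≤ z.re} ∩ {z | 0 ≤ z.im} ∩ {z | z.re + z.im ≤ 1}

theorem interior_rightTriangle :
    interior rightTriangle = {z | 0 < z.re} ∩ {z | 0 < z.im} ∩ {z | z.re + z.im < 1} := by
  rw [rightTriangle, interior_inter, interior_inter, Complex.interior_setOfPred_le_re,
    Complex.interior_setOfPred_le_im]
  congr 1
  have ho : IsOpenMap (Complex.reLm + Complex.imLm) := by
    refine LinearMap.isOpenMap_of_finiteDimensional _ fun t => ⟨t, by simp⟩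
  have hc : Continuous (Complex.reLm + Complex.imLm) := by
    exact LinearMap.continuous_of_finiteDimensional _
  have := ho.preimage_interior_eq_interior_preimage hc (Iic 1)
  rw [interior_Iic] at this
  exact this.symm

theorem isClosed_rightTriangle : IsClosed rightTriangle :=
  ((isClosed_le continuous_const (by fun_prop)).inter
    (isClosed_le continuous_const (by fun_prop))).inter (isClosed_le (by fun_prop) continuous_const)

theorem convex_rightTriangle : Convex ℝ rightTriangle := by
  refine ((convex_halfSpace_ge ⟨fun x y => ?_, fun c x => ?_⟩ 0).inter
    (convex_halfSpace_ge ⟨fun x y => ?_, fun c x => ?_⟩ 0)).inter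
    (convex_halfSpace_le ⟨fun x y => ?_, fun c x => ?_⟩ 1) <;> simp <;> ring

theorem isBounded_rightTriangle : Bornology.IsBounded rightTriangle := by
  refine (isBounded_closedBall (x := (0 : ℂ)) (r := 2)).subset ?_
  rintro z ⟨⟨h1, h2⟩, h3⟩
  simp only [mem_ofPred_eq] at h1 h2 h3
  rw [mem_closedBall_zero_iff]
  refine (Complex.norm_le_abs_re_add_abs_im z).trans ?_
  rw [abs_of_nonneg h1, abs_of_nonneg h2]
  linarith

theorem nonempty_interior_rightTriangle : (interior rightTriangle).Nonempty := by
  rw [interior_rightTriangle]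
  refine ⟨⟨1 / 4, 1 / 4⟩, ?_⟩
  simp only [mem_inter_iff, mem_ofPred_eq]
  norm_num

theorem frontier_rightTriangle :
    frontier rightTriangle = {z ∈ rightTriangle | z.re = 0 ∨ z.im = 0 ∨ z.re + z.im = 1} := by
  rw [frontier, isClosed_rightTriangle.closure_eq, interior_rightTriangle]
  ext z
  simp only [rightTriangle, mem_sdiff, mem_inter_iff, mem_ofPred_eq]
  grind

variable {V : Type*} [Fintype V] [DecidableEq V]

/-- The coordinates at `x` and `y` map the simplex onto the planar right triangle, whose frontier
consists of the points where one of the three barycentric coordinates vanishes. -/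
theorem isDisk_triangle {x y w : V} (hxy : x ≠ y) (hxw : x ≠ w) (hyw : y ≠ w) :
    IsDisk (realization {{x, y, w}}) (realization {{x, y}, {x, w}, {w, y}}) := by
  have hs : ∀ p ∈ realization {({x, y, w} : Finset V)},
      p x + p y + p w = 1 ∧ ∀ c, c ≠ x → c ≠ y → c ≠ w → p c = 0 := by
    rintro p ⟨hp, t, rfl, ht⟩
    have h0 : ∀ c, c ≠ x → c ≠ y → c ≠ w → p c = 0 := by
      intro c h1 h2 h3
      by_contra h4
      simpa [h1, h2, h3] using ht c h4
    refine ⟨?_, h0⟩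
    have : p x + p y + p w = ∑ c ∈ ({x, y, w} : Finset V), p c := by
      rw [Finset.sum_insert (by simp [hxy, hxw]), Finset.sum_pair hyw, add_assoc]
    rw [← hp.2, this]
    apply Finset.sum_subset (Finset.subset_univ _)
    intro c _ hc
    simp only [Finset.mem_insert, Finset.mem_singleton, not_or] at hc
    exact h0 c hc.1 hc.2.1 hc.2.2
  set g : (V → ℝ) → ℂ := fun p => p x + p y * Complex.I with hg
  have hre : ∀ p, (g p).re = p x := by simp [hg]
  have him : ∀ p, (g p).im = p y := by simp [hg]
  have hgc : Continuous g := by fun_prop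
  have hgb : BijOn g (realization {{x, y, w}}) rightTriangle := by
    refine ⟨?_, ?_, ?_⟩
    · intro p hp
      have h1 := hs p hp
      have h2 := hp.1.1
      simp only [rightTriangle, mem_inter_iff, mem_ofPred_eq, hre, him]
      have := h2 w
      exact ⟨⟨h2 x, h2 y⟩, by linarith⟩
    · intro p hp q hq hpq
      have h1 := hs p hp
      have h2 := hs q hq
      have hx : p x = q x := by rw [← hre p, hpq, hre]
      have hy : p y = q y := by rw [← him p, hpq, him]
      ext c
      by_cases hcx : c = x
      · rw [hcx, hx]
      by_cases hcy : c = y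
      · rw [hcy, hy]
      by_cases hcw : c = w
      · rw [hcw]; linarith
      · rw [h1.2 c hcx hcy hcw, h2.2 c hcx hcy hcw]
    · rintro z ⟨⟨h1, h2⟩, h3⟩
      simp only [mem_ofPred_eq] at h1 h2 h3
      have h4 : 0 ≤ 1 - z.re - z.im := by linarith
      refine ⟨Pi.single x z.re + Pi.single y z.im + Pi.single w (1 - z.re - z.im),
        ⟨⟨fun c => ?_, ?_⟩, _, rfl, fun c hc => ?_⟩, ?_⟩
      · exact add_nonneg (add_nonneg (single_apply_nonneg h1 x c) (single_apply_nonneg h2 y c))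
          (single_apply_nonneg h4 w c)
      · simp [Finset.sum_add_distrib]
      · by_contra h5
        simp only [Finset.mem_insert, Finset.mem_singleton, not_or] at h5
        simp [h5.1, h5.2.1, h5.2.2] at hc
      · apply Complex.ext
        · simp [hre, hxy, hxw]
        · simp [him, hxy.symm, hyw]
  have hS : realization {{x, y}, {x, w}, {w, y}} =
      {p ∈ realization {{x, y, w}} | p x = 0 ∨ p y = 0 ∨ p w = 0} := by
    ext p
    constructor
    · rintro ⟨hp, t, ht, hpt⟩
      have hz : ∀ c, c ∉ t → p c = 0 := fun c hc => by_contra fun h => hc (hpt c h)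
      refine ⟨⟨hp, _, rfl, fun c hc => ?_⟩, ?_⟩
      · have := hpt c hc
        rcases ht with rfl | rfl | rfl <;> simp only [Finset.mem_insert, Finset.mem_singleton] at this ⊢ <;>
          tauto
      · rcases ht with rfl | rfl | rfl
        · right; right; apply hz; simp [hxw.symm, hyw.symm]
        · right; left; apply hz; simp [hxy.symm, hyw]
        · left; apply hz; simp [hxy, hxw]
    · rintro ⟨hp, h⟩
      have h1 := (hs p hp).2
      refine ⟨hp.1, ?_⟩
      rcases h with h | h | h
      · refine ⟨{w, y}, by simp, fun c hc => ?_⟩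
        by_contra h3
        simp only [Finset.mem_insert, Finset.mem_singleton, not_or] at h3
        rcases eq_or_ne c x with rfl | h4
        · exact hc h
        · exact hc (h1 c h4 h3.2 h3.1)
      · refine ⟨{x, w}, by simp, fun c hc => ?_⟩
        by_contra h3
        simp only [Finset.mem_insert, Finset.mem_singleton, not_or] at h3
        rcases eq_or_ne c y with rfl | h4
        · exact hc h
        · exact hc (h1 c h3.1 h4 h3.2)
      · refine ⟨{x, y}, by simp, fun c hc => ?_⟩
        by_contra h3
        simp only [Finset.mem_insert, Finset.mem_singleton, not_or] at h3
        rcases eq_or_ne c w with rfl | h4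
        · exact hc h
        · exact hc (h1 c h3.1 h3.2 h4)
  obtain ⟨k, -, hk, hkf⟩ := exists_homeomorph_image_interior_closure_frontier_eq_unitBall
    convex_rightTriangle nonempty_interior_rightTriangle isBounded_rightTriangle
  rw [isClosed_rightTriangle.closure_eq] at hk
  have hkb : BijOn k rightTriangle (closedBall 0 1) := hk ▸ k.injective.injOn.bijOn_image
  have hkfb : BijOn k (frontier rightTriangle) (sphere 0 1) :=
    hkf ▸ k.injective.injOn.bijOn_image
  have hsub : realization {{x, y}, {x, w}, {w, y}} ⊆ realization {({x, y, w} : Finset V)} := by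
    rw [hS]; exact fun p hp => hp.1
  refine ⟨hsub, k ∘ g, (k.continuous.comp hgc).continuousOn, hkb.comp hgb, hkfb.comp ?_⟩
  have : frontier rightTriangle = g '' realization {{x, y}, {x, w}, {w, y}} := by
    rw [frontier_rightTriangle, hS]
    ext z
    constructor
    · rintro ⟨hz, h⟩
      obtain ⟨p, hp, rfl⟩ := hgb.surjOn hz
      rw [hre, him] at h
      refine ⟨p, ⟨hp, ?_⟩, rfl⟩
      have := (hs p hp).1
      rcases h with h | h | h
      · exact Or.inl h
      · exact Or.inr (Or.inl h)
      · right; right; linarith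
    · rintro ⟨p, ⟨hp, h⟩, rfl⟩
      refine ⟨hgb.mapsTo hp, ?_⟩
      rw [hre, him]
      have := (hs p hp).1
      rcases h with h | h | h
      · exact Or.inl h
      · exact Or.inr (Or.inl h)
      · right; right; linarith
  rw [this]
  exact (hgb.injOn.mono hsub).bijOn_image

end Triangle

/-! ### Combinatorial triangulated spheres and splitting along a path -/

section Triangulation

variable {V : Type*} [DecidableEq V]

/-- The coefficient at an edge of the boundary of a set of triangles, modulo two. -/
def bdry (A : Finset (Finset V)) (e : Finset V) : ZMod 2 := ∑ t ∈ A, if e ⊆ t then 1 else 0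

variable [Fintype V]

/-- The combinatorial properties of a triangulated sphere which are used below: its edges are in
two triangles, the stars of its vertices are connected, and its homology modulo two is that of
a sphere. -/
structure IsSphereTriangulation (T : Finset (Finset V)) : Prop where
  card_eq : ∀ t ∈ T, t.card = 3
  edge : ∀ e : Finset V, e.card = 2 → ∀ t ∈ T, e ⊆ t →
    ∃ t' ∈ T, t' ≠ t ∧ e ⊆ t' ∧ ∀ s ∈ T, e ⊆ s → s = t ∨ s = t'
  homology : ∀ k : Finset V → ZMod 2, (∀ e, k e ≠ 0 → e.card = 2 ∧ ∃ t ∈ T, e ⊆ t) →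
    (∀ w, vertexSum k w = 0) → ∃ B ⊆ T, ∀ e, e.card = 2 → bdry B e = k e
  star : ∀ A ⊆ T, ∀ w, (∀ e, e.card = 2 → w ∈ e → bdry A e = 0) →
    ∀ t ∈ A, w ∈ t → ∀ t' ∈ T, w ∈ t' → t' ∈ A
  connected : ∀ A ⊆ T, (∀ e, e.card = 2 → bdry A e = 0) → A = ∅ ∨ A = T

theorem bdry_union {V : Type*} [DecidableEq V] {A B : Finset (Finset V)} (h : Disjoint A B)
    (e : Finset V) : bdry (A ∪ B) e = bdry A e + bdry B e :=
  Finset.sum_union h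

theorem bdry_ne_zero {V : Type*} [DecidableEq V] {A : Finset (Finset V)} {e : Finset V}
    (h : bdry A e ≠ 0) : ∃ t ∈ A, e ⊆ t := by
  by_contra! h2
  exact h (Finset.sum_eq_zero fun t ht => if_neg (h2 t ht))

variable {T : Finset (Finset V)}

/-- Since an edge has two triangles or none, a vanishing boundary coefficient means that both
triangles or neither belong to the set. All membership arguments below rest on this. -/
theorem IsSphereTriangulation.bdry_cases (hT : IsSphereTriangulation T) {e : Finset V}
    (he : e.card = 2) :
    (∀ t ∈ T, ¬ e ⊆ t) ∨ ∃ t ∈ T, ∃ t' ∈ T, t ≠ t' ∧ e ⊆ t ∧ e ⊆ t' ∧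
      (∀ s ∈ T, e ⊆ s → s = t ∨ s = t') ∧
      ∀ A ⊆ T, bdry A e = (if t ∈ A then 1 else 0) + if t' ∈ A then 1 else 0 := by
  by_cases h : ∀ t ∈ T, ¬ e ⊆ t
  · exact Or.inl h
  right
  push Not at h
  obtain ⟨t, ht, het⟩ := h
  obtain ⟨t', ht', hne, het', hall⟩ := hT.edge e he t ht het
  refine ⟨t, ht, t', ht', hne.symm, het, het', hall, fun A hA => ?_⟩
  rw [← Finset.sum_ite_eq' A t (fun _ => (1 : ZMod 2)), ← Finset.sum_ite_eq' A t' (fun _ => (1 : ZMod 2)),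
    ← Finset.sum_add_distrib, bdry]
  refine Finset.sum_congr rfl fun s hs => ?_
  by_cases hst : s = t
  · subst hst; simp [het, hne.symm]
  by_cases hst' : s = t'
  · subst hst'; simp [het', hne]
  · rw [if_neg hst, if_neg hst', if_neg, add_zero]
    exact fun h => (hall s (hA hs) h).elim hst hst'

theorem IsSphereTriangulation.mem_of_bdry_eq_zero (hT : IsSphereTriangulation T)
    {A : Finset (Finset V)} (hA : A ⊆ T) {e t t' : Finset V} (he : e.card = 2)
    (h : bdry A e = 0) (ht : t ∈ A) (het : e ⊆ t) (ht' : t' ∈ T) (het' : e ⊆ t') : t' ∈ A := by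
  rcases hT.bdry_cases he with h1 | ⟨t₁, -, t₂, -, -, -, -, hall, hb⟩
  · exact absurd het (h1 t (hA ht))
  rw [hb A hA] at h
  rcases hall t (hA ht) het with rfl | rfl <;> rcases hall t' ht' het' with rfl | rfl
  · exact ht
  · by_contra h2; simp [ht, h2] at h
  · by_contra h2; simp [ht, h2] at h
  · exact ht

/-- Both triangles at `e` lie in `A`, so intersecting with `A` loses nothing there. -/
theorem IsSphereTriangulation.bdry_inter (hT : IsSphereTriangulation T)
    {A B : Finset (Finset V)} (hA : A ⊆ T) (hB : B ⊆ T) {e t : Finset V} (he : e.card = 2)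
    (h : bdry A e = 0) (ht : t ∈ A) (het : e ⊆ t) : bdry (A ∩ B) e = bdry B e :=
  Finset.sum_subset Finset.inter_subset_right fun _ hs hs' => if_neg fun hes =>
    hs' (Finset.mem_inter.2 ⟨hT.mem_of_bdry_eq_zero hA he h ht het (hB hs) hes, hs⟩)

/-- The boundary of a boundary is zero: a triangle has two edges at each of its vertices. -/
theorem IsSphereTriangulation.vertexSum_bdry (hT : IsSphereTriangulation T)
    {A : Finset (Finset V)} (hA : A ⊆ T) (w : V) : vertexSum (bdry A) w = 0 := by
  unfold vertexSum bdry
  rw [Finset.sum_comm]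
  refine Finset.sum_eq_zero fun t ht => ?_
  by_cases hw : w ∈ t
  · have : ∑ u ∈ Finset.univ.erase w, (if ({w, u} : Finset V) ⊆ t then (1 : ZMod 2) else 0) =
        ∑ u ∈ t.erase w, 1 := by
      rw [← Finset.sum_filter]
      congr 1
      ext u
      simp [Finset.insert_subset_iff, hw]
    rw [this, Finset.sum_const, Finset.card_erase_of_mem hw, hT.card_eq t (hA ht)]
    decide
  · refine Finset.sum_eq_zero fun u _ => if_neg fun h => hw (h (by simp))

theorem vertexSum_congr {V : Type*} [DecidableEq V] [Fintype V] {k k' : Finset V → ZMod 2}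
    (h : ∀ e, e.card = 2 → k e = k' e) (w : V) : vertexSum k w = vertexSum k' w :=
  Finset.sum_congr rfl fun _ hu => h _ (Finset.card_pair (Finset.ne_of_mem_erase hu).symm)

theorem vertexSum_smul {V : Type*} [DecidableEq V] [Fintype V] (c : ZMod 2)
    (k : Finset V → ZMod 2) (w : V) : vertexSum (c • k) w = c * vertexSum k w := by
  simp only [vertexSum, Pi.smul_apply, smul_eq_mul, Finset.mul_sum]

theorem exists_mem_pathEdges {V : Type*} [DecidableEq V] (x z : V) (m : List V) :
    ∃ e, e ∈ pathEdges (x :: (m ++ [z])) := by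
  cases m with
  | nil => exact ⟨{x, z}, Or.inl rfl⟩
  | cons y m => exact ⟨{x, y}, Or.inl rfl⟩

theorem List.Nodup.path_of_sublist {V : Type*} {x z : V} {m l : List V} (h : (x :: z :: l).Nodup)
    (hm : m.Sublist l) : (x :: (m ++ [z])).Nodup := by
  have h1 : (x :: z :: m).Nodup := h.sublist ((hm.cons_cons z).cons_cons x)
  exact (((List.perm_append_singleton z m).cons x).nodup_iff).2 h1

/-- A set of triangles bounded by a cycle is split in two by a path joining two points of
the cycle. -/
theorem IsSphereTriangulation.exists_split (hT : IsSphereTriangulation T)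
    {A : Finset (Finset V)} (hA : A ⊆ T) {x z : V} {m₀ m₁ m₂ : List V}
    (hn : (x :: z :: (m₀ ++ (m₁ ++ m₂))).Nodup) (h₀₁ : m₀ ≠ [] ∨ m₁ ≠ []) (h₀₂ : m₀ ≠ [] ∨ m₂ ≠ [])
    (h₁₂ : m₁ ≠ [] ∨ m₂ ≠ [])
    (hb : ∀ e : Finset V, e.card = 2 →
      bdry A e = pathChain (x :: (m₁ ++ [z])) e + pathChain (x :: (m₂ ++ [z])) e)
    (hP : ∀ e ∈ pathEdges (x :: (m₀ ++ [z])), ∃ t ∈ A, e ⊆ t) :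
    ∃ A₁ A₂, A₁ ∪ A₂ = A ∧ Disjoint A₁ A₂ ∧
      (∀ e : Finset V, e.card = 2 →
        bdry A₁ e = pathChain (x :: (m₀ ++ [z])) e + pathChain (x :: (m₁ ++ [z])) e) ∧
      (∀ e : Finset V, e.card = 2 →
        bdry A₂ e = pathChain (x :: (m₀ ++ [z])) e + pathChain (x :: (m₂ ++ [z])) e) := by
  have s₁ : m₁.Sublist (m₀ ++ (m₁ ++ m₂)) :=
    (List.sublist_append_left _ _).trans (List.sublist_append_right _ _)
  have s₂ : m₂.Sublist (m₀ ++ (m₁ ++ m₂)) :=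
    (List.sublist_append_right _ _).trans (List.sublist_append_right _ _)
  have n₀ : (x :: (m₀ ++ [z])).Nodup := hn.path_of_sublist (List.sublist_append_left _ _)
  have n₁ : (x :: (m₁ ++ [z])).Nodup := hn.path_of_sublist s₁
  have n₂ : (x :: (m₂ ++ [z])).Nodup := hn.path_of_sublist s₂
  have n₀₁ : (x :: z :: (m₀ ++ m₁)).Nodup := hn.sublist
    ((((List.sublist_append_left _ _).append_left m₀).cons_cons z).cons_cons x)
  have n₀₂ : (x :: z :: (m₀ ++ m₂)).Nodup := hn.sublist
    ((((List.sublist_append_right _ _).append_left m₀).cons_cons z).cons_cons x)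
  have n₁₂ : (x :: z :: (m₁ ++ m₂)).Nodup := hn.sublist
    (((List.sublist_append_right _ _).cons_cons z).cons_cons x)
  have hxz : x ≠ z := by rintro rfl; simp at hn
  have d₀₁ : ∀ e, e ∈ pathEdges (x :: (m₀ ++ [z])) → e ∉ pathEdges (x :: (m₁ ++ [z])) :=
    fun e h h' => disjoint_pathEdges n₀₁ h₀₁ h h'
  have d₀₂ : ∀ e, e ∈ pathEdges (x :: (m₀ ++ [z])) → e ∉ pathEdges (x :: (m₂ ++ [z])) :=
    fun e h h' => disjoint_pathEdges n₀₂ h₀₂ h h'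
  have d₁₂ : ∀ e, e ∈ pathEdges (x :: (m₁ ++ [z])) → e ∉ pathEdges (x :: (m₂ ++ [z])) :=
    fun e h h' => disjoint_pathEdges n₁₂ h₁₂ h h'
  have hmem : ∀ {w : V} {m : List V}, w ∈ x :: (m ++ [z]) → w = x ∨ w ∈ m ∨ w = z := by
    intro w m h; simpa using h
  have hdis : (∀ w ∈ m₀, w ∉ m₁ ∧ w ∉ m₂ ∧ w ≠ x ∧ w ≠ z) ∧
      (∀ w ∈ m₁, w ∉ m₀ ∧ w ∉ m₂ ∧ w ≠ x ∧ w ≠ z) ∧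
      (∀ w ∈ m₂, w ∉ m₀ ∧ w ∉ m₁ ∧ w ≠ x ∧ w ≠ z) := by
    simp only [List.nodup_cons, List.mem_cons, List.mem_append, List.nodup_append] at hn
    refine ⟨?_, ?_, ?_⟩ <;> grind
  set C₀ := pathChain (x :: (m₀ ++ [z])) with hC₀
  set C₁ := pathChain (x :: (m₁ ++ [z])) with hC₁
  set C₂ := pathChain (x :: (m₂ ++ [z])) with hC₂
  have hadd : ∀ a b : ZMod 2, a + b = 0 ↔ a = b := by decide
  -- The cycle formed by the dividing path and the first boundary path bounds some `B`, which need
  -- not lie in `A`; the two pieces will be `A ∩ B` and `A \ B`.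
  obtain ⟨B, hBT, hB⟩ := hT.homology (C₀ + C₁) (by
    intro e he
    by_cases h0 : C₀ e = 0
    · have h1 : C₁ e ≠ 0 := by
        intro h1; simp [h0, h1] at he
      have hm := mem_pathEdges_of_pathChain_ne_zero h1
      have hc := card_of_mem_pathEdges n₁ hm
      refine ⟨hc, ?_⟩
      have : bdry A e ≠ 0 := by
        rw [hb e hc, hC₂, pathChain_eq_zero (d₁₂ e hm), add_zero]; exact h1
      obtain ⟨t, ht, h⟩ := bdry_ne_zero this
      exact ⟨t, hA ht, h⟩
    · have hm := mem_pathEdges_of_pathChain_ne_zero h0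
      obtain ⟨t, ht, h⟩ := hP e hm
      exact ⟨card_of_mem_pathEdges n₀ hm, t, hA ht, h⟩) (by
    intro w
    rw [vertexSum_add, vertexSum_pathChain n₀, vertexSum_pathChain n₁, hadd])
  simp only [Pi.add_apply] at hB
  set k := bdry (A ∩ B) with hk
  have hABT : A ∩ B ⊆ T := Finset.inter_subset_left.trans hA
  have hk0 : ∀ w, vertexSum k w = 0 := hT.vertexSum_bdry hABT
  -- Off the three paths neither `A` nor `B` has boundary, hence neither does `A ∩ B`. Being a
  -- cycle, the boundary of `A ∩ B` is then constant along each of the paths.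
  have hsupp : ∀ e : Finset V, e.card = 2 → k e ≠ 0 → e ∈ pathEdges (x :: (m₀ ++ [z])) ∨
      e ∈ pathEdges (x :: (m₁ ++ [z])) ∨ e ∈ pathEdges (x :: (m₂ ++ [z])) := by
    intro e he hke
    by_contra! h
    have hA0 : bdry A e = 0 := by
      rw [hb e he, hC₁, hC₂, pathChain_eq_zero h.2.1, pathChain_eq_zero h.2.2, add_zero]
    have hB0 : bdry B e = 0 := by
      rw [hB e he, hC₀, hC₁, pathChain_eq_zero h.1, pathChain_eq_zero h.2.1, add_zero]
    obtain ⟨t, ht, het⟩ := bdry_ne_zero hke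
    exact hke (by rw [hk, hT.bdry_inter hA hBT he hA0 (Finset.mem_inter.1 ht).1 het, hB0])
  obtain ⟨c₀, hc₀⟩ := exists_eq_of_vertexSum_eq_zero hk0 n₀ (by
    intro w hw u hu hku
    have hw' : w ∈ ({w, u} : Finset V) := by simp
    obtain ⟨o₁, o₂, ox, oz⟩ := hdis.1 w hw
    rcases hsupp _ (Finset.card_pair hu.symm) hku with h | h | h
    · exact h
    · exact ((hmem (mem_of_mem_pathEdges h hw')).elim ox (Or.rec o₁ oz)).elim
    · exact ((hmem (mem_of_mem_pathEdges h hw')).elim ox (Or.rec o₂ oz)).elim)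
  obtain ⟨c₁, hc₁⟩ := exists_eq_of_vertexSum_eq_zero hk0 n₁ (by
    intro w hw u hu hku
    have hw' : w ∈ ({w, u} : Finset V) := by simp
    obtain ⟨o₁, o₂, ox, oz⟩ := hdis.2.1 w hw
    rcases hsupp _ (Finset.card_pair hu.symm) hku with h | h | h
    · exact ((hmem (mem_of_mem_pathEdges h hw')).elim ox (Or.rec o₁ oz)).elim
    · exact h
    · exact ((hmem (mem_of_mem_pathEdges h hw')).elim ox (Or.rec o₂ oz)).elim)
  obtain ⟨c₂, hc₂⟩ := exists_eq_of_vertexSum_eq_zero hk0 n₂ (by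
    intro w hw u hu hku
    have hw' : w ∈ ({w, u} : Finset V) := by simp
    obtain ⟨o₁, o₂, ox, oz⟩ := hdis.2.2 w hw
    rcases hsupp _ (Finset.card_pair hu.symm) hku with h | h | h
    · exact ((hmem (mem_of_mem_pathEdges h hw')).elim ox (Or.rec o₁ oz)).elim
    · exact ((hmem (mem_of_mem_pathEdges h hw')).elim ox (Or.rec o₂ oz)).elim
    · exact h)
  have hkC : ∀ e : Finset V, e.card = 2 → k e = (c₀ • C₀ + c₁ • C₁ + c₂ • C₂) e := by
    intro e he
    simp only [Pi.add_apply, Pi.smul_apply, smul_eq_mul]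
    by_cases h0 : e ∈ pathEdges (x :: (m₀ ++ [z]))
    · rw [hc₀ e h0, hC₀, hC₁, hC₂, pathChain_eq_one n₀ h0, pathChain_eq_zero (d₀₁ e h0),
        pathChain_eq_zero (d₀₂ e h0)]
      ring
    by_cases h1 : e ∈ pathEdges (x :: (m₁ ++ [z]))
    · rw [hc₁ e h1, hC₀, hC₁, hC₂, pathChain_eq_one n₁ h1, pathChain_eq_zero h0,
        pathChain_eq_zero (d₁₂ e h1)]
      ring
    by_cases h2 : e ∈ pathEdges (x :: (m₂ ++ [z]))
    · rw [hc₂ e h2, hC₀, hC₁, hC₂, pathChain_eq_one n₂ h2, pathChain_eq_zero h0,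
        pathChain_eq_zero h1]
      ring
    · rw [hC₀, hC₁, hC₂, pathChain_eq_zero h0, pathChain_eq_zero h1, pathChain_eq_zero h2]
      by_contra h3
      exact (hsupp e he (by simpa using h3)).elim h0 (Or.rec h1 h2)
  -- The cycle condition at `x`, where all three paths start.
  have hsum : c₀ + c₁ + c₂ = 0 := by
    have h := hk0 x
    rw [vertexSum_congr hkC, vertexSum_add, vertexSum_add, vertexSum_smul, vertexSum_smul,
      vertexSum_smul, vertexSum_pathChain n₀, vertexSum_pathChain n₁, vertexSum_pathChain n₂] at h
    simpa [hxz] using h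
  -- An edge of the dividing path has both its triangles in `A` and exactly one of them in `B`.
  have hc₀1 : c₀ = 1 := by
    obtain ⟨e, he⟩ := exists_mem_pathEdges x z m₀
    have hec := card_of_mem_pathEdges n₀ he
    rw [← hc₀ e he]
    have hA0 : bdry A e = 0 := by
      rw [hb e hec, hC₁, hC₂, pathChain_eq_zero (d₀₁ e he), pathChain_eq_zero (d₀₂ e he), add_zero]
    have hB1 : bdry B e = 1 := by
      rw [hB e hec, hC₀, hC₁, pathChain_eq_one n₀ he, pathChain_eq_zero (d₀₁ e he), add_zero]
    obtain ⟨t, ht, het⟩ := hP e he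
    rw [← hB1]
    exact hT.bdry_inter hA hBT hec hA0 ht het
  have hcomp : ∀ e, bdry (A \ B) e = bdry A e + k e := by
    intro e
    have h1 := bdry_union (Finset.disjoint_sdiff_inter A B) e
    rw [Finset.sdiff_union_inter] at h1
    rw [h1]
    have h2 : ∀ a b : ZMod 2, a = a + b + b := by decide
    exact h2 _ _
  -- The intersection `A ∩ B` lies on the side of the first or of the second boundary path; this
  -- decides which piece is called `A₁`.
  have hcases : (c₁ = 1 ∧ c₂ = 0) ∨ (c₁ = 0 ∧ c₂ = 1) := by
    subst hc₀1
    revert hsum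
    generalize c₁ = a
    generalize c₂ = b
    revert a b
    decide
  subst hc₀1
  have hid : ∀ a b c : ZMod 2, b + c + (a + b) = a + c ∧ b + c + (a + c) = a + b := by decide
  rcases hcases with ⟨rfl, rfl⟩ | ⟨rfl, rfl⟩
  · simp only [one_smul, zero_smul, add_zero, Pi.add_apply, Pi.zero_apply] at hkC
    refine ⟨A ∩ B, A \ B, by rw [Finset.union_comm]; exact Finset.sdiff_union_inter A B,
      (Finset.disjoint_sdiff_inter A B).symm, hkC, fun e he => ?_⟩
    rw [hcomp e, hb e he, hkC e he]
    exact (hid _ _ _).1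
  · simp only [one_smul, zero_smul, add_zero, Pi.add_apply] at hkC
    refine ⟨A \ B, A ∩ B, Finset.sdiff_union_inter A B,
      Finset.disjoint_sdiff_inter A B, fun e he => ?_, hkC⟩
    rw [hcomp e, hb e he, hkC e he]
    exact (hid _ _ _).2

end Triangulation

/-! ### The Schoenflies theorem by induction on the set of triangles -/

section Schoenflies

variable {V : Type*} [DecidableEq V] [Fintype V] {T : Finset (Finset V)}

theorem pathEdges_bdry_ne_zero {V : Type*} [DecidableEq V] {A : Finset (Finset V)} {x z : V}
    {m m' : List V} (h : (x :: z :: (m ++ m')).Nodup) (hm : m ≠ [] ∨ m' ≠ [])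
    (hb : ∀ e : Finset V, e.card = 2 →
      bdry A e = pathChain (x :: (m ++ [z])) e + pathChain (x :: (m' ++ [z])) e)
    {e : Finset V} (he : e ∈ pathEdges (x :: (m ++ [z]))) : bdry A e = 1 := by
  have n₁ : (x :: (m ++ [z])).Nodup := h.path_of_sublist (List.sublist_append_left _ _)
  rw [hb e (card_of_mem_pathEdges n₁ he), pathChain_eq_one n₁ he, pathChain_eq_zero, add_zero]
  exact fun he' => disjoint_pathEdges h hm he he'

/-- Two triangles on different sides meet in an edge or less. A common edge is in the boundary of
both sides, hence on the dividing path. A common vertex off that path would be interior to one of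
the sides, and its whole star would then belong to that side. -/
theorem realization_inter_of_bdry (hT : IsSphereTriangulation T)
    {A₁ A₂ : Finset (Finset V)} (h₁ : A₁ ⊆ T) (h₂ : A₂ ⊆ T) (hd : Disjoint A₁ A₂) {x z : V}
    {m₀ m₁ m₂ : List V} (hn : (x :: z :: (m₀ ++ (m₁ ++ m₂))).Nodup)
    (h₀₁ : m₀ ≠ [] ∨ m₁ ≠ []) (h₀₂ : m₀ ≠ [] ∨ m₂ ≠ []) (h₁₂ : m₁ ≠ [] ∨ m₂ ≠ [])
    (hb₁ : ∀ e : Finset V, e.card = 2 →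
        bdry A₁ e = pathChain (x :: (m₀ ++ [z])) e + pathChain (x :: (m₁ ++ [z])) e)
    (hb₂ : ∀ e : Finset V, e.card = 2 →
        bdry A₂ e = pathChain (x :: (m₀ ++ [z])) e + pathChain (x :: (m₂ ++ [z])) e) :
    realization (A₁ : Set (Finset V)) ∩ realization (A₂ : Set (Finset V)) =
      realization (pathEdges (x :: (m₀ ++ [z]))) := by
  have n₀₁ : (x :: z :: (m₀ ++ m₁)).Nodup := hn.sublist
    ((((List.sublist_append_left _ _).append_left m₀).cons_cons z).cons_cons x)
  have n₀₂ : (x :: z :: (m₀ ++ m₂)).Nodup := hn.sublist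
    ((((List.sublist_append_right _ _).append_left m₀).cons_cons z).cons_cons x)
  have n₁₂ : (x :: z :: (m₁ ++ m₂)).Nodup := hn.sublist
    (((List.sublist_append_right _ _).cons_cons z).cons_cons x)
  apply Subset.antisymm
  · rintro p ⟨⟨hp, t₁, ht₁, hp₁⟩, ⟨-, t₂, ht₂, hp₂⟩⟩
    refine ⟨hp, ?_⟩
    have hne : t₁ ≠ t₂ := fun h => Finset.disjoint_left.1 hd ht₁ (h ▸ ht₂)
    have hle : (t₁ ∩ t₂).card ≤ 2 := by
      by_contra! h
      have e₁ := Finset.eq_of_subset_of_card_le (Finset.inter_subset_left (s₁ := t₁) (s₂ := t₂))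
        (by rw [hT.card_eq _ (h₁ ht₁)]; exact h)
      have e₂ := Finset.eq_of_subset_of_card_le (Finset.inter_subset_right (s₁ := t₁) (s₂ := t₂))
        (by rw [hT.card_eq _ (h₂ ht₂)]; exact h)
      exact hne (e₁.symm.trans e₂)
    rcases hle.eq_or_lt with h2 | h1
    · refine ⟨t₁ ∩ t₂, ?_, fun c hc => Finset.mem_inter.2 ⟨hp₁ c hc, hp₂ c hc⟩⟩
      have hne₁ : bdry A₁ (t₁ ∩ t₂) ≠ 0 := fun h0 => Finset.disjoint_left.1 hd
        (hT.mem_of_bdry_eq_zero h₁ h2 h0 ht₁ Finset.inter_subset_left (h₂ ht₂)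
          Finset.inter_subset_right) ht₂
      have hne₂ : bdry A₂ (t₁ ∩ t₂) ≠ 0 := fun h0 => Finset.disjoint_left.1 hd ht₁
        (hT.mem_of_bdry_eq_zero h₂ h2 h0 ht₂ Finset.inter_subset_right (h₁ ht₁)
          Finset.inter_subset_left)
      by_contra h0
      rw [hb₁ _ h2, pathChain_eq_zero h0, zero_add] at hne₁
      rw [hb₂ _ h2, pathChain_eq_zero h0, zero_add] at hne₂
      exact disjoint_pathEdges n₁₂ h₁₂ (mem_pathEdges_of_pathChain_ne_zero hne₁)
        (mem_pathEdges_of_pathChain_ne_zero hne₂)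
    · obtain ⟨c, hc⟩ := exists_ne_zero_of_mem_stdSimplex hp
      have hc' := Finset.mem_inter.2 ⟨hp₁ c hc, hp₂ c hc⟩
      have hall : ∀ d, p d ≠ 0 → d = c := fun d hd =>
        Finset.card_le_one.1 (by omega) d (Finset.mem_inter.2 ⟨hp₁ d hd, hp₂ d hd⟩) c hc'
      by_cases hcP : ∃ e ∈ pathEdges (x :: (m₀ ++ [z])), c ∈ e
      · obtain ⟨e, he, hce⟩ := hcP
        exact ⟨e, he, fun d hd => hall d hd ▸ hce⟩
      exfalso
      push Not at hcP
      rw [Finset.mem_inter] at hc'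
      have hmem : ∀ {w : V} {m : List V}, w ∈ x :: (m ++ [z]) → w = x ∨ w ∈ m ∨ w = z := by
        intro w m h; simpa using h
      have hx : c ≠ x ∧ c ≠ z := by
        have a₀ := isArc_path (n₀₁.path_of_sublist (List.sublist_append_left _ _))
        constructor
        · rintro rfl
          obtain ⟨-, e, he, h⟩ := a₀.1
          exact hcP e he (h c (by simp))
        · rintro rfl
          obtain ⟨-, e, he, h⟩ := a₀.2.1
          exact hcP e he (h c (by simp))
      -- If `c` avoids `m₁`, no edge at `c` is in the boundary of `A₁`, so the star of `c` lies in
      -- `A₁` and contains `t₂`; symmetrically for `m₂` and `A₂`.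
      have hcm : c ∉ m₁ ∨ c ∉ m₂ := by
        by_contra! h
        have := (List.nodup_cons.1 (List.nodup_cons.1 n₁₂).2).2
        exact (List.nodup_append.1 this).2.2 c h.1 c h.2 rfl
      rcases hcm with h | h
      · refine Finset.disjoint_left.1 hd (hT.star A₁ h₁ c ?_ t₁ ht₁ hc'.1 t₂ (h₂ ht₂) hc'.2) ht₂
        intro e he hce
        rw [hb₁ e he, pathChain_eq_zero fun h' => hcP e h' hce, pathChain_eq_zero, add_zero]
        intro h'
        exact (hmem (mem_of_mem_pathEdges h' hce)).elim hx.1 (Or.rec h hx.2)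
      · refine Finset.disjoint_left.1 hd ht₁ (hT.star A₂ h₂ c ?_ t₂ ht₂ hc'.2 t₁ (h₁ ht₁) hc'.1)
        intro e he hce
        rw [hb₂ e he, pathChain_eq_zero fun h' => hcP e h' hce, pathChain_eq_zero, add_zero]
        intro h'
        exact (hmem (mem_of_mem_pathEdges h' hce)).elim hx.1 (Or.rec h hx.2)
  · rintro p ⟨hp, e, he, hpe⟩
    obtain ⟨t₁, ht₁, h1⟩ := bdry_ne_zero
      (ne_of_eq_of_ne (pathEdges_bdry_ne_zero n₀₁ h₀₁ hb₁ he) one_ne_zero)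
    obtain ⟨t₂, ht₂, h2⟩ := bdry_ne_zero
      (ne_of_eq_of_ne (pathEdges_bdry_ne_zero n₀₂ h₀₂ hb₂ he) one_ne_zero)
    exact ⟨⟨hp, t₁, ht₁, fun c hc => h1 (hpe c hc)⟩, ⟨hp, t₂, ht₂, fun c hc => h2 (hpe c hc)⟩⟩

/-- The triangles of `A` form a disk, provided they are bounded by a cycle, which is given as a
pair of paths. -/
def BoundsDisk (A : Finset (Finset V)) : Prop :=
  ∀ (x z : V) (m m' : List V), (x :: z :: (m ++ m')).Nodup → (m ≠ [] ∨ m' ≠ []) →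
    (∀ e : Finset V, e.card = 2 →
      bdry A e = pathChain (x :: (m ++ [z])) e + pathChain (x :: (m' ++ [z])) e) →
    IsDisk (realization (A : Set (Finset V)))
      (realization (pathEdges (x :: (m ++ [z])) ∪ pathEdges (x :: (m' ++ [z]))))

/-- The induction step: a path across `A` with ends on its boundary cycle cuts it into two proper
subsets, disks by induction, which are glued along the path. Each subset is nonempty, having the
dividing path in its boundary. -/
theorem isDisk_of_split (hT : IsSphereTriangulation T)
    {A : Finset (Finset V)} (hA : A ⊆ T) (ih : ∀ A' ⊂ A, BoundsDisk A') {x z : V}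
    {m₀ m₁ m₂ : List V}
    (hn : (x :: z :: (m₀ ++ (m₁ ++ m₂))).Nodup) (h₀₁ : m₀ ≠ [] ∨ m₁ ≠ []) (h₀₂ : m₀ ≠ [] ∨ m₂ ≠ [])
    (h₁₂ : m₁ ≠ [] ∨ m₂ ≠ [])
    (hb : ∀ e : Finset V, e.card = 2 →
      bdry A e = pathChain (x :: (m₁ ++ [z])) e + pathChain (x :: (m₂ ++ [z])) e)
    (hP : ∀ e ∈ pathEdges (x :: (m₀ ++ [z])), ∃ t ∈ A, e ⊆ t) :
    IsDisk (realization (A : Set (Finset V)))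
      (realization (pathEdges (x :: (m₁ ++ [z])) ∪ pathEdges (x :: (m₂ ++ [z])))) := by
  obtain ⟨A₁, A₂, rfl, hd, hb₁, hb₂⟩ := hT.exists_split hA hn h₀₁ h₀₂ h₁₂ hb hP
  have n₀₁ : (x :: z :: (m₀ ++ m₁)).Nodup := hn.sublist
    ((((List.sublist_append_left _ _).append_left m₀).cons_cons z).cons_cons x)
  have n₀₂ : (x :: z :: (m₀ ++ m₂)).Nodup := hn.sublist
    ((((List.sublist_append_right _ _).append_left m₀).cons_cons z).cons_cons x)
  have n₁₂ : (x :: z :: (m₁ ++ m₂)).Nodup := hn.sublist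
    (((List.sublist_append_right _ _).cons_cons z).cons_cons x)
  obtain ⟨e, he⟩ := exists_mem_pathEdges x z m₀
  obtain ⟨t₁, ht₁, -⟩ := bdry_ne_zero
    (ne_of_eq_of_ne (pathEdges_bdry_ne_zero n₀₁ h₀₁ hb₁ he) one_ne_zero)
  obtain ⟨t₂, ht₂, -⟩ := bdry_ne_zero
    (ne_of_eq_of_ne (pathEdges_bdry_ne_zero n₀₂ h₀₂ hb₂ he) one_ne_zero)
  have l₁ : A₁ ⊂ A₁ ∪ A₂ := Finset.ssubset_iff_subset_ne.2 ⟨Finset.subset_union_left, fun h =>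
    Finset.disjoint_left.1 hd (h ▸ Finset.mem_union_right _ ht₂) ht₂⟩
  have l₂ : A₂ ⊂ A₁ ∪ A₂ := Finset.ssubset_iff_subset_ne.2 ⟨Finset.subset_union_right, fun h =>
    Finset.disjoint_left.1 hd ht₁ (h ▸ Finset.mem_union_left _ ht₁)⟩
  have D₁ := ih A₁ l₁ x z m₀ m₁ n₀₁ h₀₁ hb₁
  have D₂ := ih A₂ l₂ x z m₀ m₂ n₀₂ h₀₂ hb₂
  have cl := fun 𝓕 : Set (Finset V) => (isCompact_realization 𝓕).isClosed
  rw [realization_union] at D₁ D₂ ⊢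
  rw [Finset.coe_union, realization_union]
  exact D₁.union (isCompact_realization _) (isCompact_realization _) (cl _) (cl _) (cl _) D₂
    (isArc_path (n₀₁.path_of_sublist (List.sublist_append_left _ _)))
    (isArc_path (n₁₂.path_of_sublist (List.sublist_append_left _ _)))
    (isArc_path (n₁₂.path_of_sublist (List.sublist_append_right _ _)))
    (realization_path_inter n₀₁ h₀₁) (realization_path_inter n₀₂ h₀₂)
    (realization_inter_of_bdry hT (Finset.subset_union_left.trans hA)
      (Finset.subset_union_right.trans hA) hd hn h₀₁ h₀₂ h₁₂ hb₁ hb₂)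

/-- A cycle in normal form, starting with an edge. -/
theorem isDisk_of_edge (hT : IsSphereTriangulation T)
    {A : Finset (Finset V)} (hA : A ⊆ T) (ih : ∀ A' ⊂ A, BoundsDisk A') {x y : V} {m : List V}
    (hn : (x :: y :: m).Nodup) (hm : m ≠ [])
    (hb : ∀ e : Finset V, e.card = 2 →
      bdry A e = pathChain [x, y] e + pathChain (x :: (m ++ [y])) e) :
    IsDisk (realization (A : Set (Finset V)))
      (realization (pathEdges [x, y] ∪ pathEdges (x :: (m ++ [y])))) := by
  have hxy : x ≠ y := by rintro rfl; simp at hn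
  have hxy1 : bdry A {x, y} = 1 :=
    pathEdges_bdry_ne_zero (m := []) hn (Or.inr hm) hb (Or.inl rfl)
  obtain ⟨t, ht, het⟩ := bdry_ne_zero (ne_of_eq_of_ne hxy1 one_ne_zero)
  have hxt : x ∈ t := het (by simp)
  have hyt : y ∈ t := het (by simp)
  -- The third vertex `w` of the triangle at the boundary edge `{x, y}` decides how to cut.
  obtain ⟨w, hw, hwe⟩ : ∃ w ∈ t, w ∉ ({x, y} : Finset V) := by
    by_contra! h
    have := Finset.card_le_card h
    rw [hT.card_eq t (hA ht), Finset.card_pair hxy] at this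
    omega
  simp only [Finset.mem_insert, Finset.mem_singleton, not_or] at hwe
  have hsub : ∀ a b : V, a ∈ t → b ∈ t → ({a, b} : Finset V) ⊆ t := by
    intro a b ha hb c hc
    simp only [Finset.mem_insert, Finset.mem_singleton] at hc
    rcases hc with rfl | rfl <;> assumption
  by_cases hwm : w ∈ m
  swap
  -- If `w` is off the boundary cycle, the two-edge path `x`, `w`, `y` cuts off the triangle `t`.
  · refine isDisk_of_split hT hA ih (m₀ := [w]) (m₁ := []) (m₂ := m) (x := x) (z := y) ?_
      (by simp) (by simp) (by simp [hm]) hb ?_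
    · simp only [List.nodup_cons, List.mem_cons, List.cons_append, List.nil_append] at hn ⊢
      simp only [not_or] at hn ⊢
      exact ⟨⟨hn.1.1, fun h => hwe.1 h.symm, hn.1.2⟩, ⟨fun h => hwe.2 h.symm, hn.2.1⟩, hwm, hn.2.2⟩
    · rintro e (rfl | rfl | he)
      · exact ⟨t, ht, hsub _ _ hxt hw⟩
      · exact ⟨t, ht, hsub _ _ hw hyt⟩
      · exact absurd he (notMem_empty e)
  obtain ⟨m', m'', rfl⟩ := List.append_of_mem hwm
  rcases eq_or_ne m' [] with rfl | hm'
  swap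
  -- If `w` is on the cycle but is not the neighbour of `x` along the path through `m`, the side
  -- `{x, w}` is a chord.
  · have hp : List.Perm (x :: w :: (m' ++ y :: m''.reverse)) (x :: y :: (m' ++ w :: m'')) := by
      refine List.Perm.cons x ?_
      have h1 : (w :: (m' ++ y :: m''.reverse)).Perm (w :: y :: (m' ++ m'')) :=
        ((List.perm_middle).trans
          (((List.reverse_perm m'').append_left m').cons y)).cons w
      exact (h1.trans (List.Perm.swap y w _)).trans (List.perm_middle.symm.cons y)
    have hrev : pathEdges (w :: (m'' ++ [y])) = pathEdges (y :: (m''.reverse ++ [w])) := by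
      rw [← pathEdges_reverse]; simp
    have hrevC : pathChain (w :: (m'' ++ [y])) = pathChain (y :: (m''.reverse ++ [w])) := by
      rw [← pathChain_reverse]; simp
    have := isDisk_of_split hT hA ih (m₀ := []) (m₁ := m') (m₂ := y :: m''.reverse) (x := x)
      (z := w) (by simpa using hp.nodup_iff.2 hn) (Or.inr hm') (by simp) (Or.inl hm')
      (by
        intro e he
        rw [hb e he, List.append_assoc, List.cons_append, ← List.cons_append,
          pathChain_append, hrevC]
        simp only [List.cons_append, Pi.add_apply, pathChain_cons, pathChain_singleton,
          Pi.zero_apply, add_zero]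
        ring)
      (by
        rintro e (rfl | he)
        · exact ⟨t, ht, hsub _ _ hxt hw⟩
        · exact absurd he (notMem_empty e))
    convert this using 2
    rw [List.append_assoc, List.cons_append, ← List.cons_append, pathEdges_append, hrev]
    simp only [List.cons_append, pathEdges_cons, pathEdges_singleton]
    ext e
    simp only [mem_union, mem_insert_iff, mem_empty_iff_false, or_false]
    tauto
  rcases eq_or_ne m'' [] with rfl | hm''
  swap
  -- If `w` follows `x` on that path but is not adjacent to `y` along it, the side `{w, y}` is a
  -- chord.
  · have hp : List.Perm (w :: y :: (m'' ++ [x])) (x :: y :: ([] ++ w :: m'')) := by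
      have h1 : (w :: y :: (m'' ++ [x])).Perm (w :: y :: x :: m'') :=
        ((List.perm_append_singleton x m'').cons y).cons w
      refine h1.trans ((List.Perm.swap y w _).trans ?_)
      refine ((List.Perm.swap x w _).cons y).trans (List.Perm.swap x y _)
    have := isDisk_of_split hT hA ih (m₀ := []) (m₁ := m'') (m₂ := [x]) (x := w)
      (z := y) (by simpa using hp.nodup_iff.2 hn) (Or.inr hm'') (by simp) (Or.inl hm'')
      (by
        intro e he
        rw [hb e he]
        simp only [List.nil_append, List.cons_append, pathChain_cons, pathChain_singleton,
          Pi.zero_apply, add_zero, Finset.pair_comm w x]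
        ring)
      (by
        rintro e (rfl | he)
        · exact ⟨t, ht, hsub _ _ hw hyt⟩
        · exact absurd he (notMem_empty e))
    convert this using 2
    simp only [List.nil_append, List.cons_append, pathEdges_cons, pathEdges_singleton,
      Finset.pair_comm w x]
    ext e
    simp only [mem_union, mem_insert_iff, mem_empty_iff_false, or_false]
    tauto
  have htxyw : t = {x, y, w} := by
    symm
    refine Finset.eq_of_subset_of_card_le ?_ ?_
    · intro c hc
      simp only [Finset.mem_insert, Finset.mem_singleton] at hc
      rcases hc with rfl | rfl | rfl <;> assumption
    · rw [hT.card_eq t (hA ht), Finset.card_eq_three.2]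
      exact ⟨x, y, w, hxy, fun h => hwe.1 h.symm, fun h => hwe.2 h.symm, rfl⟩
  have hwx : w ≠ x := hwe.1
  have hwy : w ≠ y := hwe.2
  -- In the remaining case the cycle is the boundary of `t`. Then the rest of `A` has no boundary,
  -- so it is empty or everything; it cannot be everything, since `t` is missing.
  have hbt : ∀ e : Finset V, e.card = 2 → bdry (A.erase t) e = 0 := by
    intro e he
    have h1 := bdry_union (A := A.erase t) (B := {t}) (by simp) e
    have h2 : A.erase t ∪ {t} = A := by
      rw [Finset.union_comm, ← Finset.insert_eq, Finset.insert_erase ht]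
    rw [h2, hb e he] at h1
    have h3 : bdry {t} e = pathChain [x, y] e + pathChain [x, w, y] e := by
      have h4 : e ⊆ t ↔ e = {x, y} ∨ e = {x, w} ∨ e = {w, y} := by
        rw [htxyw]
        constructor
        · intro h
          obtain ⟨c, hc, hce⟩ : ∃ c ∈ ({x, y, w} : Finset V), c ∉ e := by
            by_contra! h5
            have := Finset.card_le_card h5
            rw [he, Finset.card_eq_three.2 ⟨x, y, w, hxy, hwx.symm, hwy.symm, rfl⟩] at this
            omega
          have key : ∀ a b : V, a ≠ b → ({x, y, w} : Finset V).erase c = {a, b} → e = {a, b} := by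
            intro a b hab h6
            refine Finset.eq_of_subset_of_card_le ?_ (by rw [Finset.card_pair hab, he])
            rw [← h6]
            exact Finset.subset_erase.2 ⟨h, hce⟩
          simp only [Finset.mem_insert, Finset.mem_singleton] at hc
          rcases hc with rfl | rfl | rfl
          · right; right
            exact key _ _ hwy (by
              ext d; simp only [Finset.mem_erase, Finset.mem_insert, Finset.mem_singleton]; grind)
          · right; left
            exact key _ _ hwx.symm (by
              ext d; simp only [Finset.mem_erase, Finset.mem_insert, Finset.mem_singleton]; grind)
          · left
            exact key _ _ hxy (by
              ext d; simp only [Finset.mem_erase, Finset.mem_insert, Finset.mem_singleton]; grind)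
        · rintro (rfl | rfl | rfl) d hd <;>
            simp only [Finset.mem_insert, Finset.mem_singleton] at hd ⊢ <;> tauto
      have n1 : ({x, y} : Finset V) ≠ {x, w} := fun h => by
        have : y ∈ ({x, w} : Finset V) := h ▸ (by simp)
        simp only [Finset.mem_insert, Finset.mem_singleton] at this
        exact this.elim hxy.symm hwy.symm
      have n2 : ({x, y} : Finset V) ≠ {w, y} := fun h => by
        have : x ∈ ({w, y} : Finset V) := h ▸ (by simp)
        simp only [Finset.mem_insert, Finset.mem_singleton] at this
        exact this.elim hwx.symm hxy
      have n3 : ({x, w} : Finset V) ≠ {w, y} := fun h => by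
        have : x ∈ ({w, y} : Finset V) := h ▸ (by simp)
        simp only [Finset.mem_insert, Finset.mem_singleton] at this
        exact this.elim hwx.symm hxy
      simp only [bdry, Finset.sum_singleton, h4, pathChain_cons, pathChain_singleton,
        Pi.zero_apply, add_zero]
      by_cases e1 : e = {x, y}
      · subst e1; simp [n1, n2]
      by_cases e2 : e = {x, w}
      · subst e2; simp [n1.symm, n3]
      · simp [e1, e2]
    rw [h3] at h1
    simpa using h1
  have hAt : A = {t} := by
    rcases hT.connected _ ((Finset.erase_subset _ _).trans hA) hbt with h | h
    · exact (Finset.erase_eq_empty_iff A t).1 h |>.resolve_left (Finset.ne_empty_of_mem ht)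
    · exact absurd (h ▸ hA ht) (Finset.notMem_erase t A)
  rw [hAt, htxyw, Finset.coe_singleton]
  have := isDisk_triangle hxy hwx.symm hwy.symm
  convert this using 2
  simp only [List.nil_append, List.cons_append, pathEdges_cons, pathEdges_singleton]
  ext e
  simp only [mem_union, mem_insert_iff, mem_empty_iff_false, or_false, mem_singleton_iff]

/-- The Schoenflies theorem for a triangulated sphere. -/
theorem IsSphereTriangulation.boundsDisk (hT : IsSphereTriangulation T)
    (A : Finset (Finset V)) : A ⊆ T → BoundsDisk A := by
  induction A using Finset.strongInduction with
  | H A ih =>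
    intro hA
    have ih' : ∀ A' ⊂ A, BoundsDisk A' := fun A' h => ih A' h (h.subset.trans hA)
    -- The cycle is reread from its edge `{x, y}`: the other path goes from `x` through `m'` to `z`
    -- and back through `m` reversed to `y`.
    have main : ∀ (x z y : V) (m m' : List V), (x :: z :: (y :: m ++ m')).Nodup →
        (∀ e : Finset V, e.card = 2 → bdry A e =
          pathChain (x :: (y :: m ++ [z])) e + pathChain (x :: (m' ++ [z])) e) →
        IsDisk (realization (A : Set (Finset V)))
          (realization (pathEdges (x :: (y :: m ++ [z])) ∪ pathEdges (x :: (m' ++ [z])))) := by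
      intro x z y m m' hn hb
      have hrev : pathEdges (y :: (m ++ [z])) = pathEdges (z :: (m.reverse ++ [y])) := by
        rw [← pathEdges_reverse]; simp
      have hrevC : pathChain (y :: (m ++ [z])) = pathChain (z :: (m.reverse ++ [y])) := by
        rw [← pathChain_reverse]; simp
      have hp : List.Perm (x :: y :: (m' ++ z :: m.reverse)) (x :: z :: (y :: m ++ m')) := by
        refine List.Perm.cons x ?_
        have h1 : (y :: (m' ++ z :: m.reverse)).Perm (y :: z :: (m' ++ m)) :=
          ((List.perm_middle).trans
            (((List.reverse_perm m).append_left m').cons z)).cons y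
        refine h1.trans ((List.Perm.swap z y _).trans ?_)
        exact (List.perm_append_comm.cons y).cons z
      have := isDisk_of_edge hT hA ih' (x := x) (y := y) (m := m' ++ z :: m.reverse)
        (hp.nodup_iff.2 hn) (by simp) (by
          intro e he
          have h1 := congrFun (pathChain_append (x :: m') (m.reverse ++ [y]) z) e
          rw [← hrevC] at h1
          rw [hb e he]
          simp only [List.append_assoc, List.cons_append, Pi.add_apply, pathChain_cons,
            pathChain_singleton, Pi.zero_apply, add_zero] at h1 ⊢
          rw [h1]
          ring)
      convert this using 2
      have h1 := pathEdges_append (x :: m') (m.reverse ++ [y]) z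
      rw [← hrev] at h1
      simp only [List.append_assoc, List.cons_append, pathEdges_cons, pathEdges_singleton] at h1 ⊢
      rw [h1]
      ext e
      simp only [mem_union, mem_insert_iff, mem_empty_iff_false, or_false]
      tauto
    intro x z m m' hn hm hb
    cases m with
    | cons y m => exact main x z y m m' hn hb
    | nil =>
      cases m' with
      | nil => simp at hm
      | cons y m =>
        rw [union_comm]
        exact main x z y m [] (by simpa using hn) fun e he => by rw [hb e he, add_comm]

end Schoenflies

/-! ### Strongly connected sets with strongly connected complement are disks -/

section StronglyConnected

variable {V : Type*} [DecidableEq V] [Fintype V] {T : Finset (Finset V)}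

/-- A set of triangles is strongly connected if any two are joined by a chain of triangles
with consecutive ones sharing an edge. -/
def StronglyConnected (A : Finset (Finset V)) : Prop :=
  ∀ B : Finset (Finset V), (∀ t ∈ A, ∀ t' ∈ A, ∀ e : Finset V, e.card = 2 → e ⊆ t → e ⊆ t' →
    t ∈ B → t' ∈ B) → A ⊆ B ∨ Disjoint A B

/-- Lists of distinct vertices such that consecutive ones are joined by an edge of `k`. -/
def IsChainOf {V : Type*} [DecidableEq V] (k : Finset V → ZMod 2) (l : List V) : Prop :=
  l.Nodup ∧ ∀ e ∈ pathEdges l, k e ≠ 0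

/-- A chain that can always be prolonged at its head would become longer than the number of
vertices. -/
theorem exists_maximal_chain {k : Finset V → ZMod 2} {a b : V} (hab : a ≠ b) (h : k {a, b} ≠ 0) :
    ∃ x y l, IsChainOf k (x :: y :: l) ∧ ∀ u, k {u, x} ≠ 0 → u ≠ x → u ∈ x :: y :: l := by
  by_contra! hcon
  have key : ∀ n : ℕ, ∃ x y l, IsChainOf k (x :: y :: l) ∧ n ≤ (x :: y :: l).length := by
    intro n
    induction n with
    | zero =>
      refine ⟨a, b, [], ⟨by simp [hab], ?_⟩, by simp⟩
      rintro e (rfl | he)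
      · exact h
      · exact absurd he (notMem_empty e)
    | succ n ih =>
      obtain ⟨x, y, l, hl, hn⟩ := ih
      obtain ⟨u, hu, -, hul⟩ := hcon x y l hl
      refine ⟨u, x, y :: l, ⟨List.nodup_cons.2 ⟨hul, hl.1⟩, ?_⟩, by simpa using hn⟩
      rintro e (rfl | he)
      · exact hu
      · exact hl.2 e he
  obtain ⟨x, y, l, hl, hn⟩ := key (Fintype.card V + 1)
  have := hl.1.length_le_card
  omega

/-- Every nonzero cycle modulo two contains a simple cycle. -/
theorem exists_cycle {k : Finset V → ZMod 2} (hk : ∀ w, vertexSum k w = 0) {a b : V} (hab : a ≠ b)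
    (h : k {a, b} ≠ 0) : ∃ x z m, (x :: z :: (m ++ [])).Nodup ∧ m ≠ [] ∧ k {x, z} ≠ 0 ∧
      ∀ e ∈ pathEdges (x :: (m ++ [z])), k e ≠ 0 := by
  obtain ⟨x, y, l, ⟨hn, hl⟩, hmax⟩ := exists_maximal_chain hab h
  have hxy : x ≠ y := by rintro rfl; simp at hn
  -- A cycle modulo two cannot have a single edge at `x`. By maximality the second edge leads back
  -- to the chain and closes a simple cycle.
  obtain ⟨u, hux, huy, hku⟩ : ∃ u, u ≠ x ∧ u ≠ y ∧ k {x, u} ≠ 0 := by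
    by_contra! hcon
    have h0 := hk x
    rw [vertexSum, Finset.sum_eq_single y (fun u hu huy => hcon u (Finset.ne_of_mem_erase hu) huy)
      (by simp [hxy.symm])] at h0
    exact hl {x, y} (Or.inl rfl) h0
  have hul := hmax u (by rwa [Finset.pair_comm]) hux
  simp only [List.mem_cons, hux, huy, false_or] at hul
  obtain ⟨l₁, l₂, rfl⟩ := List.append_of_mem hul
  have hn' : (x :: y :: (l₁ ++ [u])).Nodup := by
    refine hn.sublist (List.Sublist.cons_cons x (List.Sublist.cons_cons y ?_))
    exact List.Sublist.append_left (by simp) l₁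
  refine ⟨x, u, y :: l₁, ?_, by simp, hku, fun e he => hl e ?_⟩
  · rw [List.append_nil]
    have : (x :: u :: (y :: l₁)).Perm (x :: y :: (l₁ ++ [u])) :=
      List.Perm.cons x ((List.perm_append_singleton u (y :: l₁)).symm)
    exact this.nodup_iff.2 hn'
  · have h1 := pathEdges_append (x :: y :: l₁) l₂ u
    simp only [List.cons_append] at h1
    rw [h1]
    exact Or.inl he

/-- A simple cycle inside the boundary of `A` bounds a set `B`. Membership in `B` can change only
across the boundary of `A`, so `B` contains or misses `A` as a whole, and likewise the complement.
As `B` has nonzero boundary it is `A` or the complement, and in both cases the boundary of `A` is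
just the simple cycle. -/
theorem IsSphereTriangulation.isDisk (hT : IsSphereTriangulation T) {A : Finset (Finset V)}
    (hA : A ⊆ T) (hne : A.Nonempty) (hne' : A ≠ T) (hs : StronglyConnected A)
    (hs' : StronglyConnected (T \ A)) :
    ∃ S, IsDisk (realization (A : Set (Finset V))) S := by
  obtain ⟨e, he, hbe⟩ : ∃ e : Finset V, e.card = 2 ∧ bdry A e ≠ 0 := by
    by_contra! h
    exact (hT.connected A hA h).elim hne.ne_empty hne'
  obtain ⟨a, b, hab, rfl⟩ := Finset.card_eq_two.1 he
  obtain ⟨x, z, m, hn, hm, hxz, hkm⟩ := exists_cycle (hT.vertexSum_bdry hA) hab hbe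
  have n₁ : (x :: (m ++ [z])).Nodup := hn.path_of_sublist (List.sublist_append_left _ _)
  have n₂ : (x :: ([] ++ [z])).Nodup := hn.path_of_sublist (List.nil_sublist _)
  have hk2 : ∀ e ∈ pathEdges (x :: ([] ++ [z])), bdry A e ≠ 0 := by
    rintro e (rfl | he)
    · exact hxz
    · exact absurd he (notMem_empty e)
  have hcyc : ∀ e, (pathChain (x :: (m ++ [z])) + pathChain (x :: ([] ++ [z]))) e ≠ 0 →
      e.card = 2 ∧ bdry A e ≠ 0 := by
    intro e he
    by_cases h : e ∈ pathEdges (x :: (m ++ [z]))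
    · exact ⟨card_of_mem_pathEdges n₁ h, hkm e h⟩
    · rw [Pi.add_apply, pathChain_eq_zero h, zero_add] at he
      have h' := mem_pathEdges_of_pathChain_ne_zero he
      exact ⟨card_of_mem_pathEdges n₂ h', hk2 e h'⟩
  obtain ⟨B, hBT, hB⟩ := hT.homology (pathChain (x :: (m ++ [z])) + pathChain (x :: ([] ++ [z])))
    (fun e he => by
      obtain ⟨h1, h2⟩ := hcyc e he
      obtain ⟨t, ht, het⟩ := bdry_ne_zero h2
      exact ⟨h1, t, hA ht, het⟩)
    (fun w => by
      rw [vertexSum_add, vertexSum_pathChain n₁, vertexSum_pathChain n₂]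
      have : ∀ a : ZMod 2, a + a = 0 := by decide
      exact this _)
  have hB0 : ∀ e : Finset V, e.card = 2 → bdry A e = 0 → bdry B e = 0 := by
    intro e he h0
    rw [hB e he]
    by_contra h
    exact (hcyc e h).2 h0
  have hcompl : ∀ e : Finset V, e.card = 2 → bdry T e = 0 := by
    intro e he
    rcases hT.bdry_cases he with h | ⟨t, ht, t', ht', -, -, -, -, h⟩
    · by_contra h0
      obtain ⟨t, ht, het⟩ := bdry_ne_zero h0
      exact h t ht het
    · rw [h T Finset.Subset.rfl, if_pos ht, if_pos ht']
      decide
  have hAc : ∀ e : Finset V, e.card = 2 → bdry (T \ A) e = bdry A e := by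
    intro e he
    have h := bdry_union (Finset.sdiff_disjoint (s := A) (t := T)) e
    rw [Finset.sdiff_union_of_subset hA, hcompl e he] at h
    have h2 : ∀ a b : ZMod 2, 0 = a + b → a = b := by decide
    exact h2 _ _ h
  have c₁ : A ⊆ B ∨ Disjoint A B := hs B fun t ht t' ht' e he het het' htB => by
    by_cases h0 : bdry A e = 0
    · exact hT.mem_of_bdry_eq_zero hBT he (hB0 e he h0) htB het (hA ht') het'
    -- Across an edge of the boundary of `A` there is only one triangle of `A`, so two different
    -- triangles of `A` cannot share it.
    · by_contra htB'
      refine h0 ?_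
      rcases hT.bdry_cases he with h | ⟨t₁, -, t₂, -, -, -, -, hall, hb⟩
      · exact absurd het (h t (hA ht))
      · have hne : t ≠ t' := fun h => htB' (h ▸ htB)
        rw [hb A hA]
        rcases hall t (hA ht) het with rfl | rfl <;> rcases hall t' (hA ht') het' with rfl | rfl
        · exact absurd rfl hne
        · rw [if_pos ht, if_pos ht']; decide
        · rw [if_pos ht, if_pos ht']; decide
        · exact absurd rfl hne
  have c₂ : T \ A ⊆ B ∨ Disjoint (T \ A) B := hs' B fun t ht t' ht' e he het het' htB => by
    by_cases h0 : bdry A e = 0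
    · exact hT.mem_of_bdry_eq_zero hBT he (hB0 e he h0) htB het (Finset.sdiff_subset ht') het'
    · by_contra htB'
      rw [← hAc e he] at h0
      refine h0 ?_
      rcases hT.bdry_cases he with h | ⟨t₁, -, t₂, -, -, -, -, hall, hb⟩
      · exact absurd het (h t (Finset.sdiff_subset ht))
      · have hne : t ≠ t' := fun h => htB' (h ▸ htB)
        rw [hb _ Finset.sdiff_subset]
        rcases hall t (Finset.sdiff_subset ht) het with rfl | rfl <;>
          rcases hall t' (Finset.sdiff_subset ht') het' with rfl | rfl
        · exact absurd rfl hne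
        · rw [if_pos ht, if_pos ht']; decide
        · rw [if_pos ht, if_pos ht']; decide
        · exact absurd rfl hne
  have hBne : bdry B {x, z} ≠ 0 := by
    have hxz' : ({x, z} : Finset V) ∈ pathEdges (x :: ([] ++ [z])) := Or.inl rfl
    rw [hB _ (card_of_mem_pathEdges n₂ hxz'), Pi.add_apply, pathChain_eq_one n₂ hxz',
      pathChain_eq_zero, zero_add]
    · exact one_ne_zero
    · exact fun h' => disjoint_pathEdges hn (Or.inl hm) h' hxz'
  have hxz2 : ({x, z} : Finset V).card = 2 :=
    card_of_mem_pathEdges n₂ (Or.inl rfl : ({x, z} : Finset V) ∈ pathEdges (x :: ([] ++ [z])))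
  have hfin : ∀ e : Finset V, e.card = 2 → bdry B e = bdry A e := by
    rcases c₁ with h1 | h1 <;> rcases c₂ with h2 | h2
    · exfalso
      have : B = T := by
        refine Finset.Subset.antisymm hBT ?_
        rw [← Finset.sdiff_union_of_subset hA]
        exact Finset.union_subset h2 h1
      exact hBne (this ▸ hcompl _ hxz2)
    · intro e _
      have : B = A := by
        refine Finset.Subset.antisymm (fun t ht => ?_) h1
        by_contra htA
        exact Finset.disjoint_left.1 h2 (Finset.mem_sdiff.2 ⟨hBT ht, htA⟩) ht
      rw [this]
    · intro e he
      have : B = T \ A := by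
        refine Finset.Subset.antisymm (fun t ht => ?_) h2
        exact Finset.mem_sdiff.2 ⟨hBT ht, fun htA => Finset.disjoint_left.1 h1 htA ht⟩
      rw [this, hAc e he]
    · exfalso
      obtain ⟨t, ht, -⟩ := bdry_ne_zero hBne
      by_cases htA : t ∈ A
      · exact Finset.disjoint_left.1 h1 htA ht
      · exact Finset.disjoint_left.1 h2 (Finset.mem_sdiff.2 ⟨hBT ht, htA⟩) ht
  exact ⟨_, hT.boundsDisk A hA x z m [] hn (Or.inl hm) fun e he => by
    rw [← hfin e he, hB e he, Pi.add_apply]⟩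

end StronglyConnected

/-! ### Invariant functions of a permutation -/

section Invariants

variable {D : Type*}

/-- The functions modulo two which are invariant under a permutation. -/
def invariants (σ : Equiv.Perm D) : Submodule (ZMod 2) (D → ZMod 2) where
  carrier := {b | ∀ d, b (σ d) = b d}
  add_mem' := fun ha hb d => by simp [ha d, hb d]
  zero_mem' := fun _ => rfl
  smul_mem' := fun c b hb d => by simp [hb d]

/-- Often applied with `X` the type of propositions, where it transports a property along a vertex,
an edge or a region. -/
theorem eq_of_sameCycle {σ : Equiv.Perm D} {X : Type*} {b : D → X} (hb : ∀ d, b (σ d) = b d)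
    {x y : D} (h : σ.SameCycle x y) : b x = b y := by
  obtain ⟨i, rfl⟩ := h
  induction i with
  | zero => simp
  | succ n ih => rw [add_comm, zpow_add, Equiv.Perm.mul_apply, zpow_one, hb]; exact ih
  | pred n ih =>
    rw [ih, ← hb ((σ ^ (-(n : ℤ) - 1)) x), ← Equiv.Perm.mul_apply, ← zpow_one_add]
    congr 3
    ring

theorem finrank_invariants [Finite D] (σ : Equiv.Perm D) :
    Module.finrank (ZMod 2) (invariants σ) =
      Nat.card (Quotient (Equiv.Perm.SameCycle.setoid σ)) := by
  classical
  have := Fintype.ofFinite (Quotient (Equiv.Perm.SameCycle.setoid σ))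
  have h : invariants σ = LinearMap.range (LinearMap.funLeft (ZMod 2) (ZMod 2)
      (Quotient.mk (Equiv.Perm.SameCycle.setoid σ))) := by
    ext b
    constructor
    · intro hb
      exact ⟨fun q => Quotient.lift b (fun x y hxy => eq_of_sameCycle hb hxy) q, rfl⟩
    · rintro ⟨g, rfl⟩ d
      have : (Quotient.mk (Equiv.Perm.SameCycle.setoid σ) (σ d)) = Quotient.mk _ d :=
        Quotient.sound ((Equiv.Perm.sameCycle_apply_left).2 (Equiv.Perm.SameCycle.refl σ d))
      simp only [LinearMap.funLeft_apply, this]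
  rw [h, LinearMap.finrank_range_of_inj (LinearMap.funLeft_injective_of_surjective _ _ _
    Quotient.mk_surjective), Module.finrank_fintype_fun_eq_card, Nat.card_eq_fintype_card]

end Invariants

namespace DoodleDiagram

/-! ### Incidence of darts, vertices, edges and regions -/

section Basic

variable {D : Type*} [Finite D] (M : DoodleDiagram D)

theorem vertexOf_eq {d d' : D} : M.vertexOf d = M.vertexOf d' ↔ M.rot.SameCycle d d' :=
  Quotient.eq (r := Equiv.Perm.SameCycle.setoid M.rot)

theorem edgeOf_eq {d d' : D} : M.edgeOf d = M.edgeOf d' ↔ M.rev.SameCycle d d' :=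
  Quotient.eq (r := Equiv.Perm.SameCycle.setoid M.rev)

theorem regionOf_eq {d d' : D} : M.regionOf d = M.regionOf d' ↔ (M.rot * M.rev).SameCycle d d' :=
  Quotient.eq (r := Equiv.Perm.SameCycle.setoid (M.rot * M.rev))

theorem vertexOf_rot (d : D) : M.vertexOf (M.rot d) = M.vertexOf d :=
  M.vertexOf_eq.2 ((Equiv.Perm.sameCycle_apply_left).2 (Equiv.Perm.SameCycle.refl _ d))

theorem edgeOf_rev (d : D) : M.edgeOf (M.rev d) = M.edgeOf d :=
  M.edgeOf_eq.2 ((Equiv.Perm.sameCycle_apply_left).2 (Equiv.Perm.SameCycle.refl _ d))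

theorem regionOf_rot_rev (d : D) : M.regionOf (M.rot (M.rev d)) = M.regionOf d :=
  M.regionOf_eq.2 ((Equiv.Perm.sameCycle_apply_left (f := M.rot * M.rev)).2
    (Equiv.Perm.SameCycle.refl _ d))

/-- The corner between two successive darts at a vertex is named by the second of them. Thus `d` and
`rot d` name the corners on the two sides of the dart `d` at its start. -/
theorem regionOf_rot (d : D) : M.regionOf (M.rot d) = M.regionOf (M.rev d) := by
  rw [← M.regionOf_rot_rev (M.rev d), M.rev_rev]

theorem edgeOf_eq_iff {d d' : D} : M.edgeOf d = M.edgeOf d' ↔ d' = d ∨ d' = M.rev d := by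
  constructor
  · intro h
    have h2 := eq_of_sameCycle (b := fun x : D => x = d ∨ x = M.rev d) (fun x => by
      apply propext
      constructor
      · rintro (h | h)
        · right; rw [← h, M.rev_rev]
        · left; exact M.rev.injective h
      · rintro (rfl | rfl)
        · right; rfl
        · left; exact M.rev_rev d) (M.edgeOf_eq.1 h)
    exact h2 ▸ Or.inl rfl
  · rintro (rfl | rfl)
    · rfl
    · exact (M.edgeOf_rev d).symm

theorem vertexOf_surjective : Surjective M.vertexOf := Quotient.mk_surjective
theorem edgeOf_surjective : Surjective M.edgeOf := Quotient.mk_surjective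
theorem regionOf_surjective : Surjective M.regionOf := Quotient.mk_surjective

theorem eq_of_invariant {X : Type*} {b : D → X} (h₁ : ∀ d, b (M.rot d) = b d)
    (h₂ : ∀ d, b (M.rev d) = b d) (d d' : D) : b d = b d' := by
  obtain ⟨⟨g, hg⟩, rfl⟩ := M.connected.exists_smul_eq d d'
  have key : ∀ x, b (g x) = b x := by
    induction hg using Subgroup.closure_induction with
    | mem σ hσ => rcases hσ with rfl | rfl <;> assumption
    | one => simp
    | mul σ τ _ _ hσ hτ => intro x; rw [Equiv.Perm.mul_apply, hσ, hτ]
    | inv σ _ hσ => intro x; rw [← hσ (σ⁻¹ x)]; simp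
  exact (key d).symm

theorem nonempty_darts {D : Type*} [Finite D] (M : DoodleDiagram D) : Nonempty D := by
  by_contra h
  rw [not_nonempty_iff] at h
  have h1 := M.spherical
  have : ∀ s : Setoid D, Nat.card (Quotient s) = 0 := fun s => by
    have : IsEmpty (Quotient s) := ⟨fun q => q.exists_rep.elim fun d _ => h.elim d⟩
    exact Nat.card_of_isEmpty
  simp only [this] at h1
  omega

theorem card_darts : Nat.card D = 2 * Nat.card (Quotient (Equiv.Perm.SameCycle.setoid M.rev)) := by
  classical
  have := Fintype.ofFinite D
  have := Fintype.ofFinite M.Edge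
  change _ = 2 * Nat.card M.Edge
  rw [Nat.card_eq_fintype_card, Nat.card_eq_fintype_card, ← Finset.card_univ,
    Finset.card_eq_sum_card_fiberwise (f := M.edgeOf) (t := Finset.univ) (by simp),
    Finset.sum_const_nat (m := 2), Finset.card_univ, mul_comm]
  intro e _
  obtain ⟨d, rfl⟩ := M.edgeOf_surjective e
  have : Finset.univ.filter (fun x => M.edgeOf x = M.edgeOf d) = {d, M.rev d} := by
    ext x
    rw [Finset.mem_filter, eq_comm, edgeOf_eq_iff]
    simp
  rw [this, Finset.card_pair (M.rev_ne d).symm]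

end Basic

/-! ### Vanishing of the first homology from the Euler characteristic -/

section Homology

variable {D : Type*} [Fintype D] (M : DoodleDiagram D)

/-- The dot product as a bilinear form. -/
def dotForm (D : Type*) [Fintype D] : LinearMap.BilinForm (ZMod 2) (D → ZMod 2) :=
  LinearMap.mk₂ (ZMod 2) (fun a b => a ⬝ᵥ b) add_dotProduct
    (fun c a b => smul_dotProduct c a b) dotProduct_add (fun c a b => dotProduct_smul c a b)

theorem dotForm_nondegenerate : (dotForm D).Nondegenerate :=
  ⟨fun a h => dotProduct_eq_zero a h, fun a h => dotProduct_eq_zero a fun w => by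
    rw [dotProduct_comm]; exact h w⟩

/-- The map that sends a set of edges to the corners between an edge of this set and another one,
a corner being denoted by the second one of its darts. -/
def cornerMap : (D → ZMod 2) →ₗ[ZMod 2] (D → ZMod 2) :=
  LinearMap.id + LinearMap.funLeft (ZMod 2) (ZMod 2) M.rot.symm

theorem cornerMap_apply (a : D → ZMod 2) (d : D) : M.cornerMap a d = a d + a (M.rot.symm d) := rfl

theorem dotProduct_cornerMap_vertex {a b : D → ZMod 2} (hb : b ∈ invariants M.rot) :
    b ⬝ᵥ M.cornerMap a = 0 := by
  have h1 : ∑ d, b d * a (M.rot.symm d) = ∑ d, b d * a d := by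
    rw [← Equiv.sum_comp M.rot]
    refine Finset.sum_congr rfl fun d _ => ?_
    rw [hb d, Equiv.symm_apply_apply]
  simp only [dotProduct, cornerMap_apply, mul_add, Finset.sum_add_distrib, h1]
  exact CharTwo.add_self_eq_zero _

theorem dotProduct_cornerMap_region {a b : D → ZMod 2} (ha : a ∈ invariants M.rev)
    (hb : b ∈ invariants (M.rot * M.rev)) : b ⬝ᵥ M.cornerMap a = 0 := by
  have h1 : ∑ d, b d * a (M.rot.symm d) = ∑ d, b d * a d := by
    rw [← Equiv.sum_comp (M.rot * M.rev)]
    refine Finset.sum_congr rfl fun d _ => ?_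
    rw [hb d, Equiv.Perm.mul_apply, Equiv.symm_apply_apply, ha d]
  simp only [dotProduct, cornerMap_apply, mul_add, Finset.sum_add_distrib, h1]
  exact CharTwo.add_self_eq_zero _

theorem finrank_eq_one_of_constant {D : Type*} [Fintype D] (M : DoodleDiagram D)
    {W : Submodule (ZMod 2) (D → ZMod 2)}
    (h1 : (fun _ => 1) ∈ W) (h : ∀ a ∈ W, ∀ d d', a d = a d') :
    Module.finrank (ZMod 2) W = 1 := by
  obtain ⟨d₀⟩ := M.nonempty_darts
  refine finrank_eq_one (⟨fun _ => 1, h1⟩ : W) (fun h0 => ?_) fun a => ⟨a.1 d₀, ?_⟩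
  · have := congrFun (congrArg Subtype.val h0) d₀
    simp at this
  · ext d
    simpa using h a.1 a.2 d₀ d

/-- Corners are the edges of the graph joining each region to its vertices; the faces of that graph
correspond to the edges of the diagram. The equality says that every cycle of this graph is the
boundary of a set of faces. One inclusion is the vanishing of the pairings. For the other, with `V`,
`E`, `F` cells in each dimension, the left side has dimension `E - 1` and the right side `2E - (V +
F - 1)`; these agree because `V + F = E + 2`. -/
theorem map_cornerMap_eq :
    (invariants M.rev).map M.cornerMap =
      (dotForm D).orthogonal (invariants M.rot ⊔ invariants (M.rot * M.rev)) := by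
  refine Submodule.eq_of_le_of_finrank_eq ?_ ?_
  · rintro _ ⟨a, ha, rfl⟩ b hb
    obtain ⟨b₁, h₁, b₂, h₂, rfl⟩ := Submodule.mem_sup.1 hb
    change (b₁ + b₂) ⬝ᵥ _ = 0
    rw [add_dotProduct, M.dotProduct_cornerMap_vertex h₁, M.dotProduct_cornerMap_region ha h₂,
      add_zero]
  · have hE := finrank_invariants M.rev
    have hV := finrank_invariants M.rot
    have hF := finrank_invariants (M.rot * M.rev)
    have hD := M.card_darts
    have hS := M.spherical
    have e1 := LinearMap.finrank_range_add_finrank_ker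
      (M.cornerMap.domRestrict (invariants M.rev))
    have e2 := Submodule.finrank_sup_add_finrank_inf_eq (invariants M.rot)
      (invariants (M.rot * M.rev))
    have e3 := LinearMap.BilinForm.finrank_orthogonal (dotForm_nondegenerate (D := D))
      (invariants M.rot ⊔ invariants (M.rot * M.rev))
    -- A function invariant under `rot` and `rot * rev` is invariant under `rev` as well, so it is
    -- constant by connectedness.
    have k2 : Module.finrank (ZMod 2)
        (invariants M.rot ⊓ invariants (M.rot * M.rev) : Submodule _ _) = 1 := by
      refine M.finrank_eq_one_of_constant ⟨fun _ => rfl, fun _ => rfl⟩ ?_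
      rintro a ⟨h₁, h₂⟩
      refine M.eq_of_invariant h₁ fun d => ?_
      have := h₂ d
      rwa [Equiv.Perm.mul_apply, h₁] at this
    -- A function on edges without jumps at corners is invariant under `rot` and `rev`, so again
    -- constant.
    have k1 : Module.finrank (ZMod 2)
        (LinearMap.ker (M.cornerMap.domRestrict (invariants M.rev))) = 1 := by
      rw [← Submodule.finrank_map_subtype_eq (invariants M.rev)]
      refine M.finrank_eq_one_of_constant ?_ ?_
      · refine ⟨⟨fun _ => 1, fun _ => rfl⟩, ?_, rfl⟩
        change M.cornerMap (fun _ => 1) = 0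
        ext d
        exact CharTwo.add_self_eq_zero (1 : ZMod 2)
      · rintro _ ⟨⟨a, ha⟩, h, rfl⟩
        refine M.eq_of_invariant (fun d => ?_) ha
        have h2 : M.cornerMap a = 0 := h
        have := congrFun h2 (M.rot d)
        rw [cornerMap_apply, Equiv.symm_apply_apply] at this
        exact CharTwo.add_eq_zero.1 this
    rw [LinearMap.range_domRestrict] at e1
    rw [Module.finrank_fintype_fun_eq_card, ← Nat.card_eq_fintype_card] at e3
    omega

/-- A set of corners with an even number at every vertex and in every region is the set of corners
between the edges of some set and the other edges. -/
theorem exists_edges_of_corners [DecidableEq M.Vertex] [DecidableEq M.Region] {K : D → ZMod 2}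
    (hV : ∀ v, ∑ d with M.vertexOf d = v, K d = 0)
    (hF : ∀ R, ∑ d with M.regionOf d = R, K d = 0) :
    ∃ a : D → ZMod 2, (∀ d, a (M.rev d) = a d) ∧ ∀ d, a (M.rot d) + a d = K (M.rot d) := by
  have key : ∀ (Q : Type _) [Fintype Q] [DecidableEq Q] (f : D → Q) (g : Q → ZMod 2),
      (∀ q, ∑ d with f d = q, K d = 0) → (fun d => g (f d)) ⬝ᵥ K = 0 := by
    intro Q _ _ f g h
    rw [dotProduct, ← Finset.sum_fiberwise (s := Finset.univ) (g := f)]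
    refine Finset.sum_eq_zero fun q _ => ?_
    rw [← mul_zero (g q), ← h q, Finset.mul_sum]
    refine Finset.sum_congr rfl fun d hd => ?_
    rw [(Finset.mem_filter.1 hd).2]
  have hK : K ∈ (dotForm D).orthogonal (invariants M.rot ⊔ invariants (M.rot * M.rev)) := by
    intro b hb
    obtain ⟨b₁, h₁, b₂, h₂, rfl⟩ := Submodule.mem_sup.1 hb
    have := Fintype.ofFinite M.Vertex
    have := Fintype.ofFinite M.Region
    have e₁ := key M.Vertex M.vertexOf (fun q => Quotient.lift b₁ (fun x y hxy => eq_of_sameCycle h₁ hxy) q) hV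
    have e₂ := key M.Region M.regionOf (fun q => Quotient.lift b₂ (fun x y hxy => eq_of_sameCycle h₂ hxy) q) hF
    change (b₁ + b₂) ⬝ᵥ K = 0
    rw [add_dotProduct]
    exact (congrArg₂ (· + ·) e₁ e₂).trans (add_zero 0)
  rw [← map_cornerMap_eq] at hK
  obtain ⟨a, ha, rfl⟩ := hK
  refine ⟨a, ha, fun d => ?_⟩
  rw [cornerMap_apply, Equiv.symm_apply_apply]

/-- The set of corners between the edges of some set and the other edges has an even number of
elements in every region. -/
theorem sum_corners_region [DecidableEq M.Region] {a : D → ZMod 2} (ha : ∀ d, a (M.rev d) = a d)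
    (R : M.Region) : ∑ d with M.regionOf d = R, (a d + a (M.rot.symm d)) = 0 := by
  have h := M.dotProduct_cornerMap_region (a := a) (b := fun d => if M.regionOf d = R then 1 else 0)
    ha (fun d => by simp only [Equiv.Perm.mul_apply, regionOf_rot_rev])
  refine Eq.trans ?_ h
  rw [Finset.sum_filter, dotProduct]
  refine Finset.sum_congr rfl fun d _ => ?_
  rw [ite_mul, one_mul, zero_mul, cornerMap_apply]

end Homology

/-! ### Neighbours of a crossing in a super prime diagram -/

section FourValent

variable {D : Type*} [Finite D] (M : DoodleDiagram D)

theorem rot_four (d : D) : M.rot (M.rot (M.rot (M.rot d))) = d := by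
  have h := Function.isPeriodicPt_minimalPeriod M.rot d
  rw [M.four_valent d] at h
  exact h

theorem rot_ne (d : D) : M.rot d ≠ d := fun h => by
  have h2 : Function.IsPeriodicPt M.rot 1 d := h
  have := h2.minimalPeriod_le one_pos
  rw [M.four_valent d] at this
  omega

theorem rot_two_ne (d : D) : M.rot (M.rot d) ≠ d := fun h => by
  have h2 : Function.IsPeriodicPt M.rot 2 d := h
  have := h2.minimalPeriod_le two_pos
  rw [M.four_valent d] at this
  omega

theorem rot_three_ne (d : D) : M.rot (M.rot (M.rot d)) ≠ d := fun h => by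
  have h2 : Function.IsPeriodicPt M.rot 3 d := h
  have := h2.minimalPeriod_le three_pos
  rw [M.four_valent d] at this
  omega

theorem eq_rot_of_vertexOf_eq {d d' : D} (h : M.vertexOf d = M.vertexOf d') :
    d' = d ∨ d' = M.rot d ∨ d' = M.rot (M.rot d) ∨ d' = M.rot (M.rot (M.rot d)) := by
  have h2 := eq_of_sameCycle (b := fun x : D => x = d ∨ x = M.rot d ∨ x = M.rot (M.rot d) ∨
      x = M.rot (M.rot (M.rot d))) (fun x => by
    apply propext
    constructor
    · rintro (h | h | h | h)
      · right; right; right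
        rw [← h, M.rot_four]
      · left; exact M.rot.injective h
      · right; left; exact M.rot.injective h
      · right; right; left; exact M.rot.injective h
    · rintro (rfl | rfl | rfl | rfl)
      · right; left; rfl
      · right; right; left; rfl
      · right; right; right; rfl
      · left; exact M.rot_four d) (M.vertexOf_eq.1 h)
  exact h2 ▸ Or.inl rfl

/-- The end of a dart. -/
def target (d : D) : M.Vertex := M.vertexOf (M.rev d)

theorem target_rev (d : D) : M.target (M.rev d) = M.vertexOf d := by
  rw [target, M.rev_rev]

variable {M}

theorem IsSuperPrime.exists_notMem (hM : M.IsSuperPrime) {S : Finset M.Vertex} (hS : S.card ≤ 4) :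
    ∃ v, v ∉ S := by
  by_contra! h
  have : Fintype M.Vertex := Fintype.ofFinite _
  have h1 := hM.1
  rw [Nat.card_eq_fintype_card, ← Finset.card_univ, ← Finset.eq_univ_iff_forall.2 h] at h1
  omega

/-- The form in which 4-connectedness is used: a function that agrees along the edges outside a set
of fewer than four vertices is constant outside that set. -/
theorem IsSuperPrime.eq_of_invariant (hM : M.IsSuperPrime) {S : Finset M.Vertex} (hS : S.card < 4)
    {X : Type*} {f : M.Vertex → X}
    (hf : ∀ d, M.vertexOf d ∉ S → M.target d ∉ S → f (M.vertexOf d) = f (M.target d))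
    {v w : M.Vertex} (hv : v ∉ S) (hw : w ∉ S) : f v = f w := by
  obtain ⟨p⟩ := (hM.2 S hS).preconnected ⟨v, hv⟩ ⟨w, hw⟩
  have key : ∀ (x y : {v // v ∉ S}), (M.graph.induce {v | v ∉ S}).Walk x y → f x = f y := by
    intro x y p
    induction p with
    | nil => rfl
    | cons h p ih =>
      rw [← ih]
      rename_i x y _
      obtain ⟨-, d, h1, h2⟩ := h
      have h1' : M.vertexOf d = x := h1
      have h2' : M.target d = y := h2
      have := hf d (h1' ▸ x.2) (h2' ▸ y.2)
      rwa [h1', h2'] at this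
  exact key _ _ p

/-- There are neither loops nor multiple edges: otherwise a crossing would have fewer than four
neighbours, and their removal would isolate it. -/
theorem IsSuperPrime.target_facts (hM : M.IsSuperPrime) (d : D) :
    (∀ i : Fin 4, M.target ((M.rot ^ (i : ℕ)) d) ≠ M.vertexOf d) ∧
      Injective fun i : Fin 4 => M.target ((M.rot ^ (i : ℕ)) d) := by
  classical
  set I := Finset.univ.image fun i : Fin 4 => M.target ((M.rot ^ (i : ℕ)) d) with hI
  have hIc : I.card ≤ 4 := Finset.card_image_le.trans (by simp)
  have hmem : ∀ x, M.vertexOf x = M.vertexOf d → M.target x ∈ I := by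
    intro x hx
    rw [hI, Finset.mem_image]
    rcases M.eq_rot_of_vertexOf_eq hx.symm with rfl | rfl | rfl | rfl
    · exact ⟨0, Finset.mem_univ _, rfl⟩
    · exact ⟨1, Finset.mem_univ _, rfl⟩
    · exact ⟨2, Finset.mem_univ _, rfl⟩
    · exact ⟨3, Finset.mem_univ _, rfl⟩
  have hN : 4 ≤ (I.erase (M.vertexOf d)).card := by
    by_contra! hlt
    -- The crossing and its fewer than four neighbours make up at most four of the more than four
    -- crossings, so some `w` is left to be separated from it.
    obtain ⟨w, hw⟩ := hM.exists_notMem (S := insert (M.vertexOf d) (I.erase (M.vertexOf d)))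
      ((Finset.card_insert_le _ _).trans hlt)
    rw [Finset.mem_insert, not_or] at hw
    have h1 := hM.eq_of_invariant hlt (f := fun v => v = M.vertexOf d) (by
      intro x hx hx'
      apply propext
      constructor
      · intro h
        by_contra h2
        exact hx' (Finset.mem_erase.2 ⟨h2, hmem x h⟩)
      · intro h
        by_contra h2
        have := hmem (M.rev x) h
        rw [target_rev] at this
        exact hx (Finset.mem_erase.2 ⟨h2, this⟩)) (Finset.notMem_erase _ _) hw.2
    exact hw.1 (h1 ▸ rfl)
  have hI4 : I.card = 4 := le_antisymm hIc (hN.trans (Finset.card_erase_le))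
  constructor
  · intro i hi
    have : M.vertexOf d ∈ I := hi ▸ Finset.mem_image_of_mem _ (Finset.mem_univ i)
    rw [Finset.card_erase_of_mem this, hI4] at hN
    omega
  · have : I.card = (Finset.univ : Finset (Fin 4)).card := by rw [hI4]; rfl
    exact fun i j hij => Finset.card_image_iff.1 this (by simp) (by simp) hij

theorem IsSuperPrime.target_ne (hM : M.IsSuperPrime) (d : D) : M.target d ≠ M.vertexOf d :=
  (hM.target_facts d).1 0

theorem IsSuperPrime.eq_of_target_eq (hM : M.IsSuperPrime) {d d' : D}
    (h : M.vertexOf d = M.vertexOf d') (h' : M.target d = M.target d') : d = d' := by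
  have hi := (hM.target_facts d).2
  rcases M.eq_rot_of_vertexOf_eq h with rfl | rfl | rfl | rfl
  · rfl
  · exact absurd (hi (a₁ := 0) (a₂ := 1) h') (by decide)
  · exact absurd (hi (a₁ := 0) (a₂ := 2) h') (by decide)
  · exact absurd (hi (a₁ := 0) (a₂ := 3) h') (by decide)

end FourValent

/-! ### Closed curves through at most three crossings -/

section Separation

variable {D : Type*} [Fintype D] {M : DoodleDiagram D}

/-- A set of corners at fewer than four vertices, even at every vertex and in every region, is
given by a set of edges joining those vertices. -/
theorem IsSuperPrime.exists_edges (hM : M.IsSuperPrime) [DecidableEq M.Vertex]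
    [DecidableEq M.Region] {K : D → ZMod 2}
    (hV : ∀ v, ∑ d with M.vertexOf d = v, K d = 0)
    (hF : ∀ R, ∑ d with M.regionOf d = R, K d = 0) {S : Finset M.Vertex} (hS : S.card < 4)
    (hK : ∀ d, K d ≠ 0 → M.vertexOf d ∈ S) :
    ∃ a : D → ZMod 2, (∀ d, a (M.rot d) + a d = K (M.rot d)) ∧
      ∀ d, a d ≠ 0 → M.vertexOf d ∈ S ∧ M.target d ∈ S := by
  obtain ⟨a, ha, haK⟩ := M.exists_edges_of_corners hV hF
  obtain ⟨w, hw⟩ := hM.exists_notMem hS.le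
  obtain ⟨d₀, rfl⟩ := M.vertexOf_surjective w
  have hconst : ∀ x y, M.vertexOf x = M.vertexOf y → M.vertexOf x ∉ S → a x = a y := by
    intro x y hxy hx
    have hstep : ∀ z, M.vertexOf z ∉ S → a (M.rot z) = a z := by
      intro z hz
      have h1 := haK z
      have h2 : K (M.rot z) = 0 := by
        by_contra h
        exact hz (M.vertexOf_rot z ▸ hK _ h)
      rw [h2] at h1
      exact CharTwo.add_eq_zero.1 h1
    have h1 := hstep x hx
    have h2 := hstep (M.rot x) (by rwa [vertexOf_rot])
    have h3 := hstep (M.rot (M.rot x)) (by rwa [vertexOf_rot, vertexOf_rot])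
    rcases M.eq_rot_of_vertexOf_eq hxy with rfl | rfl | rfl | rfl
    · rfl
    · rw [h1]
    · rw [h2, h1]
    · rw [h3, h2, h1]
  -- Away from `S` the set of edges has no jumps, so `a` is constant at each vertex; a chosen dart
  -- at every vertex turns it into a function of vertices.
  choose s hs using M.vertexOf_surjective
  have hval : ∀ d, M.vertexOf d ∉ S → a d = a d₀ := by
    intro d hd
    rw [← hconst _ d (hs _) (by rwa [hs]), ← hconst _ d₀ (hs _) (by rwa [hs])]
    refine hM.eq_of_invariant hS (f := fun v => a (s v)) ?_ hd hw
    intro x hx hx'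
    change a (s (M.vertexOf x)) = a (s (M.vertexOf (M.rev x)))
    rw [hconst _ x (hs _) (by rwa [hs]), hconst _ (M.rev x) (hs _) (by rwa [hs]), ha]
  -- Adding the constant value taken outside `S` keeps all jumps and removes every edge with an end
  -- outside `S`.
  refine ⟨fun d => a d + a d₀, fun d => ?_, fun d hd => ?_⟩
  · rw [← haK d]
    have : ∀ p q r : ZMod 2, p + r + (q + r) = p + q := by decide
    exact this _ _ _
  · by_contra h
    rw [not_and_or] at h
    change a d + a d₀ ≠ 0 at hd
    rcases h with h | h
    · rw [hval d h] at hd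
      exact hd (CharTwo.add_self_eq_zero _)
    · rw [← ha d, hval _ h] at hd
      exact hd (CharTwo.add_self_eq_zero _)

variable [DecidableEq D]

theorem sum_single {X : Type*} [DecidableEq X] (f : D → X) (d₀ : D) (q : X) :
    ∑ d with f d = q, (Pi.single d₀ 1 : D → ZMod 2) d = if f d₀ = q then 1 else 0 := by
  rw [Finset.sum_filter, Finset.sum_eq_single d₀]
  · simp
  · intro d _ hd
    simp [hd]
  · simp

/-- Two corners of one region at one vertex form a closed curve through that vertex only. The edges
on one side would be loops there, so that side is empty and has no jumps, while the two corners are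
jumps. -/
theorem IsSuperPrime.eq_of_vertexOf_regionOf (hM : M.IsSuperPrime) {d d' : D}
    (h : M.vertexOf d = M.vertexOf d') (h' : M.regionOf d = M.regionOf d') : d = d' := by
  have iV : DecidableEq M.Vertex := Classical.decEq _
  have iR : DecidableEq M.Region := Classical.decEq _
  by_contra hne
  obtain ⟨a, ha, haS⟩ := hM.exists_edges (K := Pi.single d 1 + Pi.single d' 1)
    (S := {M.vertexOf d})
    (fun v => by
      simp only [Pi.add_apply, Finset.sum_add_distrib, sum_single, h]
      exact CharTwo.add_self_eq_zero _)
    (fun v => by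
      simp only [Pi.add_apply, Finset.sum_add_distrib, sum_single, h']
      exact CharTwo.add_self_eq_zero _)
    (by simp)
    (fun x hx => by
      rw [Finset.mem_singleton]
      by_contra h2
      have h3 : x ≠ d := fun h3 => h2 (h3 ▸ rfl)
      have h4 : x ≠ d' := fun h3 => h2 (h3 ▸ h.symm)
      simp [h3, h4] at hx)
  have h0 : ∀ x, a x = 0 := by
    intro x
    by_contra h1
    obtain ⟨h2, h3⟩ := haS x h1
    rw [Finset.mem_singleton] at h2 h3
    exact hM.target_ne x (h3.trans h2.symm)
  have := ha (M.rot.symm d)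
  rw [h0, h0, Equiv.apply_symm_apply] at this
  simp [hne] at this

/-- Otherwise the corners on the two sides of `d` at its start would belong to one region. -/
theorem IsSuperPrime.regionOf_rev_ne (hM : M.IsSuperPrime) (d : D) :
    M.regionOf (M.rev d) ≠ M.regionOf d := fun h => by
  rw [← regionOf_rot] at h
  exact M.rot_ne d (hM.eq_of_vertexOf_regionOf (M.vertexOf_rot d) h)

/-- Two regions that meet in two vertices share the edge between them. -/
theorem IsSuperPrime.exists_common_edge (hM : M.IsSuperPrime) {r r' f f' : D}
    (hr : M.regionOf r = M.regionOf r') (hf : M.regionOf f = M.regionOf f')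
    (hu : M.vertexOf r = M.vertexOf f) (hv : M.vertexOf r' = M.vertexOf f')
    (hne : M.vertexOf r ≠ M.vertexOf r') (hrf : r ≠ f) :
    ∃ d, M.target d = M.vertexOf r' ∧ ((d = r ∧ M.rot d = f) ∨ (d = f ∧ M.rot d = r)) := by
  have iV : DecidableEq M.Vertex := Classical.decEq _
  have iR : DecidableEq M.Region := Classical.decEq _
  obtain ⟨a, ha, haS⟩ := hM.exists_edges
    (K := Pi.single r 1 + Pi.single r' 1 + (Pi.single f 1 + Pi.single f' 1))
    (S := {M.vertexOf r, M.vertexOf r'})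
    (fun v => by
      simp only [Pi.add_apply, Finset.sum_add_distrib, sum_single, hu, hv]
      exact CharTwo.add_self_eq_zero _)
    (fun v => by
      simp only [Pi.add_apply, Finset.sum_add_distrib, sum_single, hr, hf]
      rw [CharTwo.add_self_eq_zero, CharTwo.add_self_eq_zero, add_zero])
    ((Finset.card_le_two).trans_lt (by norm_num))
    (fun x hx => by
      rw [Finset.mem_insert, Finset.mem_singleton]
      by_contra! h2
      have h3 : x ≠ r := fun h3 => h2.1 (h3 ▸ rfl)
      have h4 : x ≠ r' := fun h3 => h2.2 (h3 ▸ rfl)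
      have h5 : x ≠ f := fun h3 => h2.1 (h3 ▸ hu.symm)
      have h6 : x ≠ f' := fun h3 => h2.2 (h3 ▸ hv.symm)
      simp [h3, h4, h5, h6] at hx)
  have hrr' : r ≠ r' := fun h => hne (h ▸ rfl)
  have hrf' : r ≠ f' := fun h => hne (hv ▸ h ▸ rfl)
  have hfr' : f ≠ r' := fun h => hne (hu ▸ h ▸ rfl)
  have hff' : f ≠ f' := fun h => hne (by rw [hu, hv, h])
  have htgt : ∀ x, M.vertexOf x = M.vertexOf r → a x ≠ 0 → M.target x = M.vertexOf r' := by
    intro x hx hax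
    have := (haS x hax).2
    rw [Finset.mem_insert, Finset.mem_singleton] at this
    exact this.resolve_left fun h => hM.target_ne x (h.trans hx.symm)
  have key : ∀ x, M.vertexOf x = M.vertexOf r → a x + a (M.rot.symm x) = 1 →
      ∃ d, M.vertexOf d = M.vertexOf r ∧ M.target d = M.vertexOf r' ∧ (x = d ∨ x = M.rot d) := by
    intro x hx hax
    by_cases h0 : a x = 0
    · rw [h0, zero_add] at hax
      have hv' : M.vertexOf (M.rot.symm x) = M.vertexOf r := by
        rw [← hx, ← M.vertexOf_rot (M.rot.symm x), Equiv.apply_symm_apply]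
      refine ⟨M.rot.symm x, hv', htgt _ hv' ?_, Or.inr (M.rot.apply_symm_apply x).symm⟩
      rw [hax]; exact one_ne_zero
    · exact ⟨x, hx, htgt x hx h0, Or.inl rfl⟩
  have h1 := ha (M.rot.symm r)
  have h2 := ha (M.rot.symm f)
  rw [Equiv.apply_symm_apply] at h1 h2
  obtain ⟨d, hd, hdt, hdr⟩ := key r rfl (by rw [h1]; simp [hrr', hrf', hrf])
  obtain ⟨d', hd', hdt', hdr'⟩ := key f hu.symm (by rw [h2]; simp [hfr', hff', hrf.symm])
  -- Only one dart joins the two vertices, so the jumps at `r` and at `f` are the two corners beside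
  -- it.
  obtain rfl := hM.eq_of_target_eq (hd.trans hd'.symm) (hdt.trans hdt'.symm)
  refine ⟨d, hdt, ?_⟩
  rcases hdr with h3 | h3 <;> rcases hdr' with h4 | h4
  · exact absurd (h3.trans h4.symm) hrf
  · exact Or.inl ⟨h3.symm, h4.symm⟩
  · exact Or.inr ⟨h4.symm, h3.symm⟩
  · exact absurd (h3.trans h4.symm) hrf

/-- If two regions at a vertex `w` meet a third region in vertices other than `w`, there are
edges joining `w` to these vertices, either on one side or on the other. -/
theorem IsSuperPrime.exists_arc (hM : M.IsSuperPrime) {g h f f' r r' : D}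
    (hw : M.vertexOf g = M.vertexOf h) (hg : M.regionOf g = M.regionOf f)
    (hh : M.regionOf h = M.regionOf f') (hu : M.vertexOf f = M.vertexOf r)
    (hv : M.vertexOf f' = M.vertexOf r') (hr : M.regionOf r = M.regionOf r')
    (hu' : M.vertexOf f ≠ M.vertexOf g) (hv' : M.vertexOf f' ≠ M.vertexOf g) :
    ∃ a : D → ZMod 2, ∀ x, M.vertexOf x = M.vertexOf g →
      (a x ≠ 0 → M.target x = M.vertexOf f ∨ M.target x = M.vertexOf f') ∧
      a (M.rot x) + a x = (if M.rot x = g then 1 else 0) + if M.rot x = h then 1 else 0 := by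
  have iV : DecidableEq M.Vertex := Classical.decEq _
  have iR : DecidableEq M.Region := Classical.decEq _
  -- The curve passes from `w` through the region of `g` to the vertex of `f`, through the region of
  -- `r` to the vertex of `f'`, and back through the region of `h`.
  obtain ⟨a, ha, haS⟩ := hM.exists_edges
    (K := Pi.single g 1 + Pi.single h 1 + (Pi.single f 1 + Pi.single r 1) +
      (Pi.single f' 1 + Pi.single r' 1))
    (S := {M.vertexOf g, M.vertexOf f, M.vertexOf f'})
    (fun v => by
      simp only [Pi.add_apply, Finset.sum_add_distrib, sum_single, hu, hv, hw]
      rw [CharTwo.add_self_eq_zero, CharTwo.add_self_eq_zero, zero_add, CharTwo.add_self_eq_zero,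
        add_zero])
    (fun v => by
      simp only [Pi.add_apply, Finset.sum_add_distrib, sum_single, hr, hg, hh]
      have : ∀ a b c : ZMod 2, a + b + (a + c) + (b + c) = 0 := by decide
      exact this _ _ _)
    ((Finset.card_le_three).trans_lt (by norm_num))
    (fun x hx => by
      rw [Finset.mem_insert, Finset.mem_insert, Finset.mem_singleton]
      by_contra! h2
      have h3 : x ≠ g := fun h3 => h2.1 (h3 ▸ rfl)
      have h4 : x ≠ h := fun h3 => h2.1 (h3 ▸ hw.symm)
      have h5 : x ≠ f := fun h3 => h2.2.1 (h3 ▸ rfl)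
      have h6 : x ≠ r := fun h3 => h2.2.1 (h3 ▸ hu.symm)
      have h7 : x ≠ f' := fun h3 => h2.2.2 (h3 ▸ rfl)
      have h8 : x ≠ r' := fun h3 => h2.2.2 (h3 ▸ hv.symm)
      simp [h3, h4, h5, h6, h7, h8] at hx)
  refine ⟨a, fun x hx => ⟨fun hax => ?_, ?_⟩⟩
  · have := (haS x hax).2
    rw [Finset.mem_insert, Finset.mem_insert, Finset.mem_singleton] at this
    exact this.resolve_left fun h => hM.target_ne x (h.trans hx.symm)
  · have hx' : M.vertexOf (M.rot x) = M.vertexOf g := by rw [vertexOf_rot, hx]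
    have h5 : M.rot x ≠ f := fun h3 => hu' (h3 ▸ hx')
    have h6 : M.rot x ≠ r := fun h3 => hu' (by rw [hu, ← h3, hx'])
    have h7 : M.rot x ≠ f' := fun h3 => hv' (h3 ▸ hx')
    have h8 : M.rot x ≠ r' := fun h3 => hv' (by rw [hv, ← h3, hx'])
    rw [ha x]
    simp [h5, h6, h7, h8, Pi.single_apply]

end Separation

/-! ### Contact between regions -/

section Contact

variable {D : Type*} [Finite D] (M : DoodleDiagram D)

/-- The vertex lies on the boundary of the region. -/
def IsOn (R : M.Region) (v : M.Vertex) : Prop := ∃ r, M.regionOf r = R ∧ M.vertexOf r = v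

/-- The regions have a common boundary vertex. -/
def Touches (R F : M.Region) : Prop := ∃ f, M.regionOf f = F ∧ M.IsOn R (M.vertexOf f)

variable {M}

theorem Touches.of_isOn {R : M.Region} {d : D} (h : M.IsOn R (M.vertexOf d)) :
    M.Touches R (M.regionOf d) := ⟨d, rfl, h⟩

theorem touches_of_target {R : M.Region} {d : D} (h : M.IsOn R (M.target d)) :
    M.Touches R (M.regionOf d) :=
  ⟨M.rot (M.rev d), M.regionOf_rot_rev d, by rwa [vertexOf_rot]⟩

theorem touches_self (R : M.Region) : M.Touches R R := by
  obtain ⟨d, rfl⟩ := M.regionOf_surjective R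
  exact ⟨d, rfl, d, rfl, rfl⟩

end Contact

/-! ### Regions around an edge or a crossing off the boundary of `R` -/

section Local

variable {D : Type*} [Fintype D] {M : DoodleDiagram D} {R : M.Region}

/-- An edge off the boundary of a region lies on a region without contact to it. -/
theorem IsSuperPrime.not_touches_of_edge (hM : M.IsSuperPrime) {d : D}
    (hd : ¬ M.IsOn R (M.vertexOf d)) (hd' : ¬ M.IsOn R (M.target d)) :
    ¬ M.Touches R (M.regionOf d) ∨ ¬ M.Touches R (M.regionOf (M.rev d)) := by
  classical
  by_contra! h
  obtain ⟨⟨f, hf, r, hr, hrf⟩, ⟨f', hf', r', hr', hrf'⟩⟩ := h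
  have hf1 : M.IsOn R (M.vertexOf f) := ⟨r, hr, hrf⟩
  have hf1' : M.IsOn R (M.vertexOf f') := ⟨r', hr', hrf'⟩
  -- If both sides of `d` touch `R`, a curve through `R` separates `d` from the other three darts at
  -- its start. The side of `d` is excluded because its end is off the boundary of `R`.
  obtain ⟨a, ha⟩ := hM.exists_arc (g := d) (h := M.rot d) (M.vertexOf_rot d).symm hf.symm
    ((M.regionOf_rot d).trans hf'.symm) hrf.symm hrf'.symm (hr.trans hr'.symm)
    (fun h => hd (h ▸ hf1)) (fun h => hd (h ▸ hf1'))
  have a0 := ha d rfl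
  have a1 := ha (M.rot d) (M.vertexOf_rot d)
  have a2 := ha (M.rot (M.rot d)) (by simp only [vertexOf_rot])
  have a3 := ha (M.rot (M.rot (M.rot d))) (by simp only [vertexOf_rot])
  have h0 : a d = 0 := by
    by_contra h
    rcases a0.1 h with h | h
    · exact hd' (h ▸ hf1)
    · exact hd' (h ▸ hf1')
  have e0 := a0.2
  have e1 := a1.2
  have e2 := a2.2
  have n1 : M.rot (M.rot d) ≠ M.rot d := M.rot_ne _
  have n2 : M.rot (M.rot (M.rot d)) ≠ M.rot d := M.rot_two_ne _
  rw [if_neg (M.rot_ne d), if_pos rfl, h0, add_zero, zero_add] at e0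
  rw [if_neg (M.rot_two_ne d), if_neg n1, add_zero] at e1
  rw [if_neg (M.rot_three_ne d), if_neg n2, add_zero] at e2
  have e1' := CharTwo.add_eq_zero.1 e1
  have e2' := CharTwo.add_eq_zero.1 e2
  -- The other three darts would have to lead to only two vertices, although their ends are
  -- distinct.
  have t1 := a1.1 (by rw [e0]; exact one_ne_zero)
  have t2 := a2.1 (by rw [e1', e0]; exact one_ne_zero)
  have t3 := a3.1 (by rw [e2', e1', e0]; exact one_ne_zero)
  have inj : ∀ x y, M.vertexOf x = M.vertexOf y → x ≠ y → M.target x ≠ M.target y :=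
    fun x y h h' h2 => h' (hM.eq_of_target_eq h h2)
  have i1 := inj (M.rot d) (M.rot (M.rot d)) (by simp only [vertexOf_rot]) n1.symm
  have i2 := inj (M.rot d) (M.rot (M.rot (M.rot d))) (by simp only [vertexOf_rot]) n2.symm
  have i3 := inj (M.rot (M.rot d)) (M.rot (M.rot (M.rot d))) (by simp only [vertexOf_rot])
    (M.rot_ne _).symm
  rcases t1 with t1 | t1 <;> rcases t2 with t2 | t2 <;> rcases t3 with t3 | t3 <;>
    simp_all

/-- The curve passes through two opposite corners and leaves two darts on each side. The pair on one
of the sides joins the vertex to the other vertices of the curve. -/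
theorem IsSuperPrime.exists_arc_opposite (hM : M.IsSuperPrime) {d f f' r r' : D}
    (hg : M.regionOf d = M.regionOf f)
    (hh : M.regionOf (M.rot (M.rot d)) = M.regionOf f') (hu : M.vertexOf f = M.vertexOf r)
    (hv : M.vertexOf f' = M.vertexOf r') (hr : M.regionOf r = M.regionOf r')
    (hu' : M.vertexOf f ≠ M.vertexOf d) (hv' : M.vertexOf f' ≠ M.vertexOf d) :
    ((M.target d = M.vertexOf f ∨ M.target d = M.vertexOf f') ∧
      (M.target (M.rot d) = M.vertexOf f ∨ M.target (M.rot d) = M.vertexOf f')) ∨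
    ((M.target (M.rot (M.rot d)) = M.vertexOf f ∨ M.target (M.rot (M.rot d)) = M.vertexOf f') ∧
      (M.target (M.rot (M.rot (M.rot d))) = M.vertexOf f ∨
        M.target (M.rot (M.rot (M.rot d))) = M.vertexOf f')) := by
  classical
  obtain ⟨a, ha⟩ := hM.exists_arc (g := d) (h := M.rot (M.rot d)) (by simp only [vertexOf_rot])
    hg hh hu hv hr hu' hv'
  have a0 := ha d rfl
  have a1 := ha (M.rot d) (M.vertexOf_rot d)
  have a2 := ha (M.rot (M.rot d)) (by simp only [vertexOf_rot])
  have a3 := ha (M.rot (M.rot (M.rot d))) (by simp only [vertexOf_rot])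
  have e0 := a0.2
  have e1 := a1.2
  have e2 := a2.2
  have n1 : M.rot d ≠ M.rot (M.rot d) := (M.rot_ne _).symm
  have n2 : M.rot (M.rot (M.rot d)) ≠ M.rot (M.rot d) := M.rot_ne _
  rw [if_neg (M.rot_ne d), if_neg n1, add_zero] at e0
  rw [if_neg (M.rot_two_ne d), if_pos rfl, zero_add] at e1
  rw [if_neg (M.rot_three_ne d), if_neg n2, add_zero] at e2
  have e0' := CharTwo.add_eq_zero.1 e0
  have e2' := CharTwo.add_eq_zero.1 e2
  by_cases h : a d = 0
  · right
    rw [e0', h, add_zero] at e1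
    exact ⟨a2.1 (by rw [e1]; exact one_ne_zero), a3.1 (by rw [e2', e1]; exact one_ne_zero)⟩
  · left
    exact ⟨a0.1 h, a1.1 (by rw [e0']; exact h)⟩

theorem IsSuperPrime.isOn_of_touches (hM : M.IsSuperPrime) {d : D}
    (hd : ¬ M.IsOn R (M.vertexOf d)) (h : M.Touches R (M.regionOf d))
    (h' : M.Touches R (M.regionOf (M.rot (M.rot d)))) :
    (M.IsOn R (M.target d) ∧ M.IsOn R (M.target (M.rot d))) ∨
      (M.IsOn R (M.target (M.rot (M.rot d))) ∧ M.IsOn R (M.target (M.rot (M.rot (M.rot d))))) := by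
  obtain ⟨f, hf, r, hr, hrf⟩ := h
  obtain ⟨f', hf', r', hr', hrf'⟩ := h'
  have hf1 : M.IsOn R (M.vertexOf f) := ⟨r, hr, hrf⟩
  have hf1' : M.IsOn R (M.vertexOf f') := ⟨r', hr', hrf'⟩
  have key : ∀ v, v = M.vertexOf f ∨ v = M.vertexOf f' → M.IsOn R v := by
    rintro v (rfl | rfl) <;> assumption
  have := hM.exists_arc_opposite hf.symm hf'.symm hrf.symm hrf'.symm (hr.trans hr'.symm)
    (fun h => hd (h ▸ hf1)) (fun h => hd (h ▸ hf1'))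
  exact this.imp (And.imp (key _) (key _)) (And.imp (key _) (key _))

/-- Take the curve through the ends of the opposite darts `d` and `rot (rot d)`. Whichever pair of
darts it singles out, one of `rot d` and its opposite would share its end with `d` or `rot (rot d)`.
-/
theorem IsSuperPrime.not_isOn_opposite (hM : M.IsSuperPrime) {d : D}
    (h : M.IsOn R (M.target d)) : ¬ M.IsOn R (M.target (M.rot (M.rot d))) := by
  intro h'
  obtain ⟨r, hr, hrv⟩ := h
  obtain ⟨r', hr', hrv'⟩ := h'
  have v1 : M.vertexOf (M.rot (M.rev d)) = M.target d := M.vertexOf_rot _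
  have v2 : M.vertexOf (M.rot (M.rev (M.rot (M.rot d)))) = M.target (M.rot (M.rot d)) :=
    M.vertexOf_rot _
  have inj : ∀ x y, M.vertexOf x = M.vertexOf y → x ≠ y → M.target x ≠ M.target y :=
    fun x y h h' h2 => h' (hM.eq_of_target_eq h h2)
  have := hM.exists_arc_opposite (d := d) (f := M.rot (M.rev d))
    (f' := M.rot (M.rev (M.rot (M.rot d)))) (r := r) (r' := r') (M.regionOf_rot_rev _).symm
    (M.regionOf_rot_rev _).symm (v1.trans hrv.symm) (v2.trans hrv'.symm) (hr.trans hr'.symm)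
    (by rw [v1]; exact hM.target_ne d)
    (by
      rw [v2]
      have := hM.target_ne (M.rot (M.rot d))
      simpa only [vertexOf_rot] using this)
  rw [v1, v2] at this
  rcases this with ⟨-, h | h⟩ | ⟨-, h | h⟩
  · exact inj _ _ (M.vertexOf_rot d) (M.rot_ne d) h
  · exact inj _ _ (M.vertexOf_rot _).symm (M.rot_ne _).symm h
  · exact inj _ _ (by simp only [vertexOf_rot]) (M.rot_three_ne d) h
  · exact inj _ _ (by simp only [vertexOf_rot]) (M.rot_ne _) h

/-- A vertex off the boundary of a region lies on a region without contact to it. -/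
theorem IsSuperPrime.exists_not_touches (hM : M.IsSuperPrime) {v : M.Vertex}
    (hv : ¬ M.IsOn R v) : ∃ d, M.vertexOf d = v ∧ ¬ M.Touches R (M.regionOf d) := by
  obtain ⟨d, rfl⟩ := M.vertexOf_surjective v
  by_contra! h
  have h0 := hM.isOn_of_touches hv (h d rfl) (h _ (by simp only [vertexOf_rot]))
  have h1 := hM.isOn_of_touches (d := M.rot d) (by rwa [vertexOf_rot]) (h _ (M.vertexOf_rot d))
    (h _ (by simp only [vertexOf_rot]))
  rw [M.rot_four] at h1
  -- Two consecutive neighbours from `h0` together with two from `h1`, shifted by one, always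
  -- include a pair of opposite neighbours.
  have n0 := hM.not_isOn_opposite (R := R) (d := d)
  have n1 := hM.not_isOn_opposite (R := R) (d := M.rot d)
  tauto

/-- The regions at a vertex off the boundary of `R` which have no contact with `R` are
consecutive. -/
theorem IsSuperPrime.iff_of_vertexOf_eq (hM : M.IsSuperPrime) {Q : M.Region → Prop}
    (hQ : ∀ d, ¬ M.Touches R (M.regionOf d) → ¬ M.Touches R (M.regionOf (M.rev d)) →
      Q (M.regionOf d) → Q (M.regionOf (M.rev d)))
    {x y : D} (hxy : M.vertexOf x = M.vertexOf y) (hv : ¬ M.IsOn R (M.vertexOf x))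
    (hx : ¬ M.Touches R (M.regionOf x)) (hy : ¬ M.Touches R (M.regionOf y))
    (h : Q (M.regionOf x)) : Q (M.regionOf y) := by
  have h1 : ∀ z, ¬ M.Touches R (M.regionOf z) → ¬ M.Touches R (M.regionOf (M.rot z)) →
      Q (M.regionOf z) → Q (M.regionOf (M.rot z)) := by
    intro z
    rw [regionOf_rot]
    exact hQ z
  have h2 : ∀ z, ¬ M.Touches R (M.regionOf z) → ¬ M.Touches R (M.regionOf (M.rot z)) →
      Q (M.regionOf (M.rot z)) → Q (M.regionOf z) := by
    intro z h h'
    rw [regionOf_rot] at h' ⊢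
    have := hQ (M.rev z)
    rw [M.rev_rev] at this
    exact this h' h
  have hf := M.rot_four x
  rcases M.eq_rot_of_vertexOf_eq hxy with rfl | rfl | rfl | rfl
  · exact h
  · exact h1 _ hx hy h
  · by_cases hr : M.Touches R (M.regionOf (M.rot x))
    · by_cases hr3 : M.Touches R (M.regionOf (M.rot (M.rot (M.rot x))))
      -- If both regions between two opposite corners touched `R`, one of the darts `x` and `rot
      -- (rot x)` would end on the boundary of `R`, and the region named by that dart would touch
      -- `R` too.
      · exfalso
        rcases hM.isOn_of_touches (d := M.rot x) (by rwa [vertexOf_rot]) hr hr3 with h3 | h3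
        · exact hy (touches_of_target h3.2)
        · rw [hf] at h3
          exact hx (touches_of_target h3.2)
      · exact h2 _ hy hr3 (h2 _ hr3 (by rwa [hf]) (by rwa [hf]))
    · exact h1 _ hr hy (h1 _ hx hr h)
  · exact h2 _ hy (by rwa [hf]) (by rwa [hf])

end Local

/-! ### Connectedness of the regions with and without contact to `R` -/

section Global

variable {D : Type*} [Fintype D] {M : DoodleDiagram D} {R : M.Region}

theorem isOn_target {r : D} (h : M.regionOf r = R) : M.IsOn R (M.target r) :=
  ⟨M.rot (M.rev r), by rw [regionOf_rot_rev, h], M.vertexOf_rot _⟩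

theorem regionOf_rev_of_rot {c r : D} (h : M.regionOf r = R) (hc : M.rot c = r) :
    M.regionOf (M.rev c) = R := by
  rw [← regionOf_rot, hc, h]

/-- The vertices other than `vertexOf r` in which the region of `f` meets that of `r`. -/
theorem IsSuperPrime.common_vertex (hM : M.IsSuperPrime) {r f g : D} (hr : M.regionOf r = R)
    (hrf : r ≠ f) (hv : M.vertexOf r = M.vertexOf f) (hg : M.regionOf g = M.regionOf f)
    (hgR : M.IsOn R (M.vertexOf g)) :
    g = f ∨ (M.rot r = f ∧ M.target r = M.vertexOf g) ∨
      (M.rot f = r ∧ M.target f = M.vertexOf g) := by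
  classical
  obtain ⟨r', hr', hrv'⟩ := hgR
  by_cases h : M.vertexOf g = M.vertexOf r
  · left
    exact hM.eq_of_vertexOf_regionOf (h.trans hv) hg
  · right
    obtain ⟨d, hd, ⟨rfl, h2⟩ | ⟨rfl, h2⟩⟩ := hM.exists_common_edge (r := r) (r' := r') (f := f) (f' := g)
      (hr.trans hr'.symm) hg.symm hv hrv' (fun h' => h (hrv'.symm.trans h'.symm)) hrf
    · exact Or.inl ⟨h2, hd.trans hrv'⟩
    · exact Or.inr ⟨h2, hd.trans hrv'⟩

/-- Not all vertices lie on the boundary of a region. -/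
theorem IsSuperPrime.exists_not_isOn (hM : M.IsSuperPrime) (R : M.Region) :
    ∃ v, ¬ M.IsOn R v := by
  obtain ⟨r, hr⟩ := M.regionOf_surjective R
  refine ⟨M.target (M.rot r), fun h => ?_⟩
  rcases hM.common_vertex (f := M.rot r) (g := M.rot (M.rev (M.rot r))) hr (M.rot_ne r).symm
    (M.vertexOf_rot r).symm (M.regionOf_rot_rev _) (by rwa [vertexOf_rot]) with h1 | ⟨-, h1⟩ | ⟨h1, -⟩
  · refine hM.target_ne (M.rot r) ?_
    rw [target, ← vertexOf_rot, h1]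
  · rw [vertexOf_rot] at h1
    exact M.rot_ne r (hM.eq_of_target_eq (M.vertexOf_rot r).symm h1).symm
  · exact M.rot_two_ne r h1

/-- The boundary of a region does not separate the other vertices. -/
theorem IsSuperPrime.eq_off_boundary (hM : M.IsSuperPrime) {f : M.Vertex → ZMod 2}
    (hf : ∀ d, ¬ M.IsOn R (M.vertexOf d) → ¬ M.IsOn R (M.target d) →
      f (M.vertexOf d) = f (M.target d))
    {v w : M.Vertex} (hv : ¬ M.IsOn R v) (hw : ¬ M.IsOn R w) : f v = f w := by
  classical
  -- Each edge receives the value of `f` at an end off the boundary of `R`, where two such ends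
  -- agree, and `0` if both ends are on it. The jumps of `a` then occur only at vertices of `R`, and
  -- their sum over each region vanishes.
  set a : D → ZMod 2 := fun d => if ¬ M.IsOn R (M.vertexOf d) then f (M.vertexOf d) else
    if ¬ M.IsOn R (M.target d) then f (M.target d) else 0 with ha
  have ha_rev : ∀ d, a (M.rev d) = a d := by
    intro d
    simp only [ha, target_rev]
    change (if ¬ M.IsOn R (M.target d) then f (M.target d) else _) = _
    by_cases h1 : M.IsOn R (M.vertexOf d) <;> by_cases h2 : M.IsOn R (M.target d)
    · simp [h1, h2]
    · simp [h1, h2]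
    · simp [h1, h2]
    · simp [h1, h2, hf d h1 h2]
  have ha_off : ∀ d, ¬ M.IsOn R (M.vertexOf d) → a d = f (M.vertexOf d) := fun d h => by
    simp [ha, h]
  have ha_on : ∀ d, M.IsOn R (M.vertexOf d) → M.IsOn R (M.target d) → a d = 0 := fun d h h' => by
    simp [ha, h, h']
  have hrot_off : ∀ x d, M.vertexOf x = M.vertexOf d → ¬ M.IsOn R (M.vertexOf d) → a x = a d := by
    intro x d h hd
    rw [ha_off d hd, ha_off x (h ▸ hd), h]
  set k : D → ZMod 2 := fun d => a d + a (M.rot.symm d) with hk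
  have hk_off : ∀ d, ¬ M.IsOn R (M.vertexOf d) → k d = 0 := by
    intro d hd
    have : M.vertexOf (M.rot.symm d) = M.vertexOf d := by
      rw [← vertexOf_rot, Equiv.apply_symm_apply]
    simp only [hk]
    rw [hrot_off _ d this hd]
    exact CharTwo.add_self_eq_zero _
  have hk_rot : ∀ d, k (M.rot d) = a (M.rot d) + a d := by
    intro d; simp only [hk, Equiv.symm_apply_apply]
  have hsum := M.sum_corners_region ha_rev
  have edge0 : ∀ r, M.regionOf r = R → a r = 0 ∧ a (M.rot (M.rot (M.rot r))) = 0 := by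
    intro r hr
    have h1 : M.IsOn R (M.vertexOf r) := ⟨r, hr, rfl⟩
    refine ⟨ha_on r h1 (isOn_target hr), ha_on _ (by simpa only [vertexOf_rot] using h1) ?_⟩
    exact ⟨_, regionOf_rev_of_rot hr (M.rot_four r), rfl⟩
  -- The region opposite to `R` at a vertex meets `R` in no other vertex, so its only possible jump
  -- is zero.
  have middle : ∀ r, M.regionOf r = R → a (M.rot r) = a (M.rot (M.rot r)) := by
    intro r hr
    have h1 := hsum (M.regionOf (M.rot (M.rot r)))
    rw [Finset.sum_eq_single_of_mem (M.rot (M.rot r)) (by simp)] at h1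
    · change k _ = 0 at h1
      rw [hk_rot] at h1
      exact (CharTwo.add_eq_zero.1 h1).symm
    · intro g hg hne
      apply hk_off
      intro hgR
      rcases hM.common_vertex hr (M.rot_two_ne r).symm (by simp only [vertexOf_rot])
        (Finset.mem_filter.1 hg).2 hgR with h | ⟨h, -⟩ | ⟨h, -⟩
      · exact hne h
      · exact M.rot_ne _ h.symm
      · exact M.rot_three_ne _ h
  -- The region across the edge `d` of `R` meets `R` only in the two ends of `d`, so its jumps there
  -- cancel. As `a` is zero on edges of `R`, these jumps are the values on the adjacent outer darts.
  have side : ∀ d, M.regionOf d = R → a (M.rot (M.rot (M.rot (M.rev d)))) = a (M.rot d) := by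
    intro d hd
    have hr : M.regionOf (M.rot (M.rev d)) = R := by rw [regionOf_rot_rev, hd]
    have hv4 := M.rot_four (M.rev d)
    have hne : M.rev d ≠ M.rot d := fun h => by
      have := M.vertexOf_rot d
      rw [← h] at this
      exact hM.target_ne d this
    have h1 := hsum (M.regionOf (M.rev d))
    have h2 : ∑ x ∈ {M.rev d, M.rot d}, k x = 0 := by
      rw [← h1]
      apply Finset.sum_subset
      · intro x hx
        rw [Finset.mem_insert, Finset.mem_singleton] at hx
        rcases hx with rfl | rfl <;> simp [regionOf_rot]
      · intro g hg hne
        apply hk_off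
        intro hgR
        rw [Finset.mem_insert, Finset.mem_singleton, not_or] at hne
        rcases hM.common_vertex (f := M.rev d) hr (M.rot_ne _) (M.vertexOf_rot _)
          (Finset.mem_filter.1 hg).2 hgR with h | ⟨h, -⟩ | ⟨-, h⟩
        · exact hne.1 h
        · exact M.rot_two_ne _ h
        · refine hne.2 (hM.eq_of_vertexOf_regionOf ?_ ?_)
          · rw [vertexOf_rot, ← h, target_rev]
          · rw [regionOf_rot, (Finset.mem_filter.1 hg).2]
    rw [Finset.sum_pair hne, hk_rot, (edge0 d hd).1, add_zero] at h2
    have h3 : k (M.rev d) = a (M.rot (M.rot (M.rot (M.rev d)))) := by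
      have h4 := hk_rot (M.rot (M.rot (M.rot (M.rev d))))
      have h5 := (edge0 _ hr).2
      rw [hv4] at h4 h5
      rw [h4, h5, zero_add]
    rw [h3] at h2
    exact CharTwo.add_eq_zero.1 h2
  -- Going once around `R`, `middle` passes each vertex and `side` passes each edge.
  have hconst : ∀ d d', M.regionOf d = R → M.regionOf d' = R → a (M.rot d) = a (M.rot d') := by
    intro d d' hd hd'
    have h1 := eq_of_sameCycle (b := fun x => if M.regionOf x = R then a (M.rot x) else 0)
      (fun x => by
        simp only [Equiv.Perm.mul_apply, regionOf_rot_rev]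
        by_cases hx : M.regionOf x = R
        · rw [if_pos hx, if_pos hx, middle _ (by rw [regionOf_rot_rev, hx]), side x hx]
        · rw [if_neg hx, if_neg hx]) (M.regionOf_eq.1 (hd.trans hd'.symm))
    simpa only [if_pos hd, if_pos hd'] using h1
  obtain ⟨r₀, hr₀⟩ := M.regionOf_surjective R
  have hadj : ∀ d, M.IsOn R (M.vertexOf d) → ¬ M.IsOn R (M.target d) →
      f (M.target d) = a (M.rot r₀) := by
    intro d hd hd'
    obtain ⟨r, hr, hrv⟩ := hd
    have h1 : a d = f (M.target d) := by
      rw [← ha_rev d, ha_off _ hd']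
      rfl
    have h2 := (edge0 r hr)
    rw [← h1, ← hconst r r₀ hr hr₀]
    rcases M.eq_rot_of_vertexOf_eq hrv with rfl | rfl | rfl | rfl
    · exact absurd (isOn_target hr) hd'
    · rfl
    · exact (middle r hr).symm
    · exact absurd ⟨_, regionOf_rev_of_rot hr (M.rot_four r), rfl⟩ hd'
  have hall : ∀ v, ¬ M.IsOn R v → f v = a (M.rot r₀) := by
    intro v hv
    by_contra hne
    -- All neighbours of the boundary have the same value, so the set of outer vertices with another
    -- value is closed under adjacency in the whole graph and must be empty.
    have h1 := hM.eq_of_invariant (S := ∅) (by simp)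
      (f := fun v => ¬ M.IsOn R v ∧ f v ≠ a (M.rot r₀)) (by
        intro d _ _
        apply propext
        by_cases h1 : M.IsOn R (M.vertexOf d) <;> by_cases h2 : M.IsOn R (M.target d)
        · simp [h1, h2]
        · simp [h1, h2, hadj d h1 h2]
        · have := hadj (M.rev d) h2 (by rwa [target_rev])
          rw [target_rev] at this
          simp [h1, h2, this]
        · simp [h1, h2, hf d h1 h2]) (v := v) (w := M.vertexOf r₀) (by simp) (by simp)
    exact (Eq.mp h1 ⟨hv, hne⟩).1 ⟨r₀, hr₀, rfl⟩
  rw [hall v hv, hall w hw]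

/-- The regions without contact to `R` are strongly connected. -/
theorem IsSuperPrime.iff_of_not_touches (hM : M.IsSuperPrime) {Q : M.Region → Prop}
    (hQ : ∀ d, ¬ M.Touches R (M.regionOf d) → ¬ M.Touches R (M.regionOf (M.rev d)) →
      Q (M.regionOf d) → Q (M.regionOf (M.rev d)))
    {F F' : M.Region} (hF : ¬ M.Touches R F) (hF' : ¬ M.Touches R F') (h : Q F) : Q F' := by
  classical
  set P : M.Vertex → Prop := fun v =>
    ∃ d, M.vertexOf d = v ∧ ¬ M.Touches R (M.regionOf d) ∧ Q (M.regionOf d) with hP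
  have hPQ : ∀ d, ¬ M.IsOn R (M.vertexOf d) → ¬ M.Touches R (M.regionOf d) →
      (P (M.vertexOf d) ↔ Q (M.regionOf d)) := by
    intro d hd hd'
    constructor
    · rintro ⟨x, hx, hx1, hx2⟩
      exact hM.iff_of_vertexOf_eq hQ hx (hx ▸ hd) hx1 hd' hx2
    · intro h
      exact ⟨d, rfl, hd', h⟩
  have hedge : ∀ d, ¬ M.IsOn R (M.vertexOf d) → ¬ M.IsOn R (M.target d) →
      ¬ M.Touches R (M.regionOf d) → (P (M.vertexOf d) ↔ P (M.target d)) := by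
    intro d hd hd' hdR
    have h1 := hPQ (M.rot (M.rev d)) (by rwa [vertexOf_rot]) (by rwa [regionOf_rot_rev])
    rw [vertexOf_rot, regionOf_rot_rev] at h1
    exact (hPQ d hd hdR).trans h1.symm
  obtain ⟨d, rfl⟩ := M.regionOf_surjective F
  obtain ⟨d', rfl⟩ := M.regionOf_surjective F'
  have hd : ¬ M.IsOn R (M.vertexOf d) := fun h => hF (Touches.of_isOn h)
  have hd' : ¬ M.IsOn R (M.vertexOf d') := fun h => hF' (Touches.of_isOn h)
  -- At a vertex off the boundary, `P` is equivalent to `Q` for any one of its regions without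
  -- contact. An edge off the boundary has such a region on one side, which carries `P` from one end
  -- to the other.
  have h1 := hM.eq_off_boundary (R := R) (f := fun v => if P v then 1 else 0) (by
    intro x hx hx'
    have : P (M.vertexOf x) ↔ P (M.target x) := by
      rcases hM.not_touches_of_edge hx hx' with h | h
      · exact hedge x hx hx' h
      · have := hedge (M.rev x) hx' (by rwa [target_rev]) h
        rw [target_rev] at this
        exact this.symm
    simp only [this]) hd hd'
  rw [if_pos ((hPQ d hd hF).2 h)] at h1
  by_contra h2
  rw [if_neg (fun h3 => h2 ((hPQ d' hd' hF').1 h3))] at h1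
  exact one_ne_zero h1

/-- The regions with contact to `R` are strongly connected. -/
theorem iff_of_touches {D : Type*} [Finite D] {M : DoodleDiagram D} {R : M.Region}
    {Q : M.Region → Prop}
    (hQ : ∀ d, M.Touches R (M.regionOf d) → M.Touches R (M.regionOf (M.rev d)) →
      (Q (M.regionOf d) ↔ Q (M.regionOf (M.rev d))))
    {F : M.Region} (hF : M.Touches R F) : Q F ↔ Q R := by
  obtain ⟨d, rfl, r, rfl, hv⟩ := hF
  have hstep : ∀ x, M.vertexOf x = M.vertexOf r →
      (Q (M.regionOf x) ↔ Q (M.regionOf (M.rot x))) := by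
    intro x hx
    have h1 : M.Touches (M.regionOf r) (M.regionOf x) := Touches.of_isOn ⟨r, rfl, hx.symm⟩
    have h2 : M.Touches (M.regionOf r) (M.regionOf (M.rot x)) :=
      Touches.of_isOn ⟨r, rfl, by rw [vertexOf_rot, hx]⟩
    rw [regionOf_rot] at h2 ⊢
    exact hQ x h1 h2
  have h1 := hstep r rfl
  have h2 := hstep (M.rot r) (M.vertexOf_rot r)
  have h3 := hstep (M.rot (M.rot r)) (by simp only [vertexOf_rot])
  rcases M.eq_rot_of_vertexOf_eq hv with rfl | rfl | rfl | rfl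
  · exact Iff.rfl
  · exact h1.symm
  · exact (h1.trans h2).symm
  · exact (h1.trans (h2.trans h3)).symm

end Global

/-! ### First homology of the barycentric subdivision in terms of darts -/

section Potential

variable {D : Type*} [Fintype D] (M : DoodleDiagram D)

theorem sum_vertex_symm [DecidableEq M.Vertex] (g : D → ZMod 2) (v : M.Vertex) :
    ∑ d with M.vertexOf d = v, g (M.rot.symm d) = ∑ d with M.vertexOf d = v, g d := by
  rw [Finset.sum_filter, Finset.sum_filter, ← Equiv.sum_comp M.rot]
  simp only [vertexOf_rot, Equiv.symm_apply_apply]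

theorem sum_region_symm [DecidableEq M.Region] (g : D → ZMod 2) (F : M.Region) :
    ∑ d with M.regionOf d = F, g (M.rot.symm d) = ∑ d with M.regionOf d = F, g (M.rev d) := by
  rw [Finset.sum_filter, Finset.sum_filter, ← Equiv.sum_comp (M.rot * M.rev)]
  simp only [Equiv.Perm.mul_apply, regionOf_rot_rev, Equiv.symm_apply_apply]

/-- The whole value is put on one chosen dart of each edge. -/
theorem exists_sum_rev {m : D → ZMod 2} (hm : ∀ d, m (M.rev d) = m d) :
    ∃ p : D → ZMod 2, ∀ d, p d + p (M.rev d) = m d := by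
  classical
  choose s hs using M.edgeOf_surjective
  refine ⟨fun d => if d = s (M.edgeOf d) then m d else 0, fun d => ?_⟩
  simp only [edgeOf_rev, hm]
  have h : s (M.edgeOf d) = d ∨ s (M.edgeOf d) = M.rev d := (M.edgeOf_eq_iff).1 (hs _).symm
  rcases h with h | h
  · rw [h, if_pos rfl, if_neg (M.rev_ne d), add_zero]
  · rw [h, if_pos rfl, if_neg (M.rev_ne d).symm, zero_add]

/-- The vanishing of the first homology of the barycentric subdivision, in terms of darts: `p`
and `q` are a set of triangles, and `kve`, `ker`, `kvr` a cycle. -/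
theorem exists_potential [DecidableEq M.Vertex] [DecidableEq M.Region] {kve ker kvr : D → ZMod 2}
    (hv : ∀ v, ∑ d with M.vertexOf d = v, (kve d + kvr d) = 0)
    (he : ∀ d, kve d + ker d + (kve (M.rev d) + ker (M.rev d)) = 0)
    (hr : ∀ F, ∑ d with M.regionOf d = F, (kvr d + ker d) = 0) :
    ∃ p q : D → ZMod 2, (∀ d, p d + q d = kve d) ∧ (∀ d, p d + q (M.rev d) = ker d) ∧
      ∀ d, p d + q (M.rot.symm d) = kvr d := by
  -- The first equation gives `q = p + kve`. The second then prescribes `p d + p (rev d)`, and `he`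
  -- makes the prescribed value symmetric; `p₀` is a particular solution.
  obtain ⟨p₀, hp₀⟩ := M.exists_sum_rev (m := fun d => ker d + kve (M.rev d)) (fun d => by
    have h := he d
    simp only [M.rev_rev]
    have h2 : ∀ a b c e : ZMod 2, a + b + (c + e) = 0 → e + a = b + c := by decide
    exact h2 _ _ _ _ h)
  -- The remaining freedom in `p` is a function `a` on edges, whose jumps at corners are prescribed
  -- by the third equation.
  obtain ⟨a, ha, haK⟩ := M.exists_edges_of_corners
    (K := fun d => kvr d + kve (M.rot.symm d) + (p₀ d + p₀ (M.rot.symm d)))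
    (fun v => by
      have h := hv v
      simp only [Finset.sum_add_distrib] at h ⊢
      rw [M.sum_vertex_symm kve, M.sum_vertex_symm p₀, CharTwo.add_self_eq_zero, add_zero,
        add_comm, h])
    (fun F => by
      have h := hr F
      rw [Finset.sum_add_distrib, Finset.sum_add_distrib, Finset.sum_add_distrib,
        M.sum_region_symm kve, M.sum_region_symm p₀, ← Finset.sum_add_distrib,
        ← Finset.sum_add_distrib, ← Finset.sum_add_distrib, ← h]
      refine Finset.sum_congr rfl fun d _ => ?_
      rw [hp₀ d]
      have h2 : ∀ a b c : ZMod 2, a + b + (c + b) = a + c := by decide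
      exact h2 _ _ _)
  refine ⟨fun d => p₀ d + a d, fun d => p₀ d + a d + kve d, fun d => ?_, fun d => ?_, fun d => ?_⟩
  · have h2 : ∀ a b : ZMod 2, a + (a + b) = b := by decide
    exact h2 _ _
  · have h1 := hp₀ d
    simp only [ha]
    have h2 : ∀ p p' a k e : ZMod 2, p + p' = e + k → p + a + (p' + a + k) = e := by decide
    exact h2 _ _ _ _ _ h1
  · have h1 := haK (M.rot.symm d)
    rw [Equiv.apply_symm_apply] at h1
    have h2 : ∀ p p' a a' k e : ZMod 2, a + a' = e + k + (p + p') → p + a + (p' + a' + k) = e := by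
      decide
    exact h2 _ _ _ _ _ _ h1

end Potential

/-! ### Triangles of the barycentric subdivision -/

section Flags

variable {D : Type*} [Fintype D] (M : DoodleDiagram D) [DecidableEq M.Cell]

/-- The region of a flag: a dart with a choice of one of its sides. -/
def flagRegion {D : Type*} [Finite D] (M : DoodleDiagram D) (y : D × Bool) : M.Region :=
  M.regionOf (if y.2 then y.1 else M.rev y.1)

/-- The triangle of the barycentric subdivision given by a flag. -/
def flag (y : D × Bool) : Finset M.Cell :=
  {Cell.vertex (M.vertexOf y.1), Cell.edge (M.edgeOf y.1), Cell.region (M.flagRegion y)}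

/-- The edge of the barycentric subdivision from the start of a dart to its midpoint. -/
def vertexEdge (d : D) : Finset M.Cell := {Cell.vertex (M.vertexOf d), Cell.edge (M.edgeOf d)}

/-- The edge of the barycentric subdivision from the midpoint of a dart to its region. -/
def edgeRegion (d : D) : Finset M.Cell := {Cell.edge (M.edgeOf d), Cell.region (M.regionOf d)}

/-- The edge of the barycentric subdivision from the start of a dart to its region. -/
def vertexRegion (d : D) : Finset M.Cell :=
  {Cell.vertex (M.vertexOf d), Cell.region (M.regionOf d)}

theorem flagRegion_true {D : Type*} [Finite D] (M : DoodleDiagram D) (d : D) :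
    M.flagRegion (d, true) = M.regionOf d := rfl

theorem flagRegion_false {D : Type*} [Finite D] (M : DoodleDiagram D) (d : D) :
    M.flagRegion (d, false) = M.regionOf (M.rev d) := rfl

theorem vertex_mem_flag {v : M.Vertex} {y : D × Bool} :
    Cell.vertex v ∈ M.flag y ↔ v = M.vertexOf y.1 := by simp [flag]

theorem edge_mem_flag {e : M.Edge} {y : D × Bool} :
    Cell.edge e ∈ M.flag y ↔ e = M.edgeOf y.1 := by simp [flag]

theorem region_mem_flag {F : M.Region} {y : D × Bool} :
    Cell.region F ∈ M.flag y ↔ F = M.flagRegion y := by simp [flag]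

variable {M}

theorem IsSuperPrime.eq_of_vertexOf_edgeOf {D : Type*} [Finite D] {M : DoodleDiagram D}
    (hM : M.IsSuperPrime) {d d' : D} (h : M.vertexOf d = M.vertexOf d')
    (h' : M.edgeOf d = M.edgeOf d') : d = d' := by
  rcases (M.edgeOf_eq_iff).1 h' with rfl | rfl
  · rfl
  · exact absurd h.symm (hM.target_ne d)

theorem IsSuperPrime.eq_of_edgeOf_regionOf {D : Type*} [Fintype D] {M : DoodleDiagram D}
    (hM : M.IsSuperPrime) {d d' : D} (h : M.edgeOf d = M.edgeOf d')
    (h' : M.regionOf d = M.regionOf d') : d = d' := by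
  classical
  rcases (M.edgeOf_eq_iff).1 h with rfl | rfl
  · rfl
  · exact absurd h'.symm (hM.regionOf_rev_ne d)

/-- Vertex and edge determine the dart, as there are no loops; the region determines the side, as
the two sides of an edge are different regions. -/
theorem IsSuperPrime.flag_injective (hM : M.IsSuperPrime) : Injective M.flag := by
  classical
  rintro ⟨d, b⟩ ⟨d', b'⟩ h
  have h1 : M.vertexOf d = M.vertexOf d' := (M.vertex_mem_flag (y := (d', b'))).1 (h ▸ by simp [flag])
  have h2 : M.edgeOf d = M.edgeOf d' := (M.edge_mem_flag (y := (d', b'))).1 (h ▸ by simp [flag])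
  have h3 : M.flagRegion (d, b) = M.flagRegion (d', b') :=
    (M.region_mem_flag (y := (d', b'))).1 (h ▸ by simp [flag])
  obtain rfl := hM.eq_of_vertexOf_edgeOf h1 h2
  cases b <;> cases b'
  · rfl
  · exact absurd h3 (hM.regionOf_rev_ne d)
  · exact absurd h3.symm (hM.regionOf_rev_ne d)
  · rfl

theorem IsSuperPrime.vertexEdge_subset_flag (hM : M.IsSuperPrime) {d : D} {y : D × Bool} :
    M.vertexEdge d ⊆ M.flag y ↔ y = (d, true) ∨ y = (d, false) := by
  rw [vertexEdge, Finset.insert_subset_iff, Finset.singleton_subset_iff, vertex_mem_flag,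
    edge_mem_flag]
  obtain ⟨d', b⟩ := y
  constructor
  · rintro ⟨h1, h2⟩
    obtain rfl := hM.eq_of_vertexOf_edgeOf h1 h2
    cases b <;> simp
  · rintro (h | h) <;> cases h <;> exact ⟨rfl, rfl⟩

theorem IsSuperPrime.edgeRegion_subset_flag (hM : M.IsSuperPrime) {d : D} {y : D × Bool} :
    M.edgeRegion d ⊆ M.flag y ↔ y = (d, true) ∨ y = (M.rev d, false) := by
  rw [edgeRegion, Finset.insert_subset_iff, Finset.singleton_subset_iff, edge_mem_flag,
    region_mem_flag]
  obtain ⟨d', b⟩ := y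
  constructor
  · rintro ⟨h1, h2⟩
    cases b
    · right
      rw [flagRegion_false] at h2
      have := hM.eq_of_edgeOf_regionOf (h1.trans (M.edgeOf_rev d').symm) h2
      rw [this, M.rev_rev]
    · left
      rw [hM.eq_of_edgeOf_regionOf h1 h2]
  · rintro (h | h) <;> cases h
    · exact ⟨rfl, rfl⟩
    · exact ⟨(M.edgeOf_rev d).symm, by rw [flagRegion_false, M.rev_rev]⟩

/-- The corner named by `d` lies between `rot.symm d` and `d`; the two flags are its halves. -/
theorem IsSuperPrime.vertexRegion_subset_flag (hM : M.IsSuperPrime) {d : D} {y : D × Bool} :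
    M.vertexRegion d ⊆ M.flag y ↔ y = (d, true) ∨ y = (M.rot.symm d, false) := by
  classical
  rw [vertexRegion, Finset.insert_subset_iff, Finset.singleton_subset_iff, vertex_mem_flag,
    region_mem_flag]
  obtain ⟨d', b⟩ := y
  constructor
  · rintro ⟨h1, h2⟩
    cases b
    · right
      rw [flagRegion_false, ← regionOf_rot] at h2
      have := hM.eq_of_vertexOf_regionOf (h1.trans (M.vertexOf_rot d').symm) h2
      rw [this, Equiv.symm_apply_apply]
    · left
      rw [hM.eq_of_vertexOf_regionOf h1 h2]
  · rintro (h | h) <;> cases h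
    · exact ⟨rfl, rfl⟩
    · refine ⟨?_, ?_⟩
      · simp only
        rw [← M.vertexOf_rot (M.rot.symm d), Equiv.apply_symm_apply]
      · rw [flagRegion_false, ← regionOf_rot, Equiv.apply_symm_apply]

theorem card_flag (y : D × Bool) : (M.flag y).card = 3 :=
  Finset.card_eq_three.2 ⟨_, _, _, by simp, by simp, by simp, rfl⟩

theorem edge_cases {e : Finset M.Cell} (he : e.card = 2) {y : D × Bool} (hy : e ⊆ M.flag y) :
    ∃ d, e = M.vertexEdge d ∨ e = M.edgeRegion d ∨ e = M.vertexRegion d := by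
  obtain ⟨c, hc, hce⟩ : ∃ c ∈ M.flag y, c ∉ e := by
    by_contra! h5
    have := Finset.card_le_card h5
    rw [he, card_flag] at this
    omega
  have key : ∀ a b : M.Cell, a ≠ b → (∀ u ∈ M.flag y, u ≠ c → u = a ∨ u = b) → e = {a, b} := by
    intro a b hab h6
    refine Finset.eq_of_subset_of_card_le ?_ (by rw [Finset.card_pair hab, he])
    intro u hu
    rw [Finset.mem_insert, Finset.mem_singleton]
    exact h6 u (hy hu) fun h => hce (h ▸ hu)
  obtain ⟨d, b⟩ := y
  simp only [flag, Finset.mem_insert, Finset.mem_singleton] at hc key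
  rcases hc with rfl | rfl | rfl
  · have h1 := key (Cell.edge (M.edgeOf d)) (Cell.region (M.flagRegion (d, b))) (by simp) (by
      rintro u (rfl | rfl | rfl) hu
      · exact absurd rfl hu
      · exact Or.inl rfl
      · exact Or.inr rfl)
    cases b
    · exact ⟨M.rev d, Or.inr (Or.inl (by rw [h1, edgeRegion, edgeOf_rev]; rfl))⟩
    · exact ⟨d, Or.inr (Or.inl h1)⟩
  · have h1 := key (Cell.vertex (M.vertexOf d)) (Cell.region (M.flagRegion (d, b))) (by simp) (by
      rintro u (rfl | rfl | rfl) hu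
      · exact Or.inl rfl
      · exact absurd rfl hu
      · exact Or.inr rfl)
    cases b
    · refine ⟨M.rot d, Or.inr (Or.inr ?_)⟩
      rw [h1, vertexRegion, vertexOf_rot, regionOf_rot]; rfl
    · exact ⟨d, Or.inr (Or.inr h1)⟩
  · exact ⟨d, Or.inl (key (Cell.vertex (M.vertexOf d)) (Cell.edge (M.edgeOf d)) (by simp) (by
      rintro u (rfl | rfl | rfl) hu
      · exact Or.inl rfl
      · exact Or.inr rfl
      · exact absurd rfl hu))⟩

/-- Every edge of the barycentric subdivision belongs to two flags. -/
theorem IsSuperPrime.exists_pair (hM : M.IsSuperPrime) {e : Finset M.Cell} (he : e.card = 2)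
    {y : D × Bool} (hy : e ⊆ M.flag y) :
    ∃ p q : D × Bool, p ≠ q ∧ ∀ z, e ⊆ M.flag z ↔ z = p ∨ z = q := by
  obtain ⟨d, rfl | rfl | rfl⟩ := edge_cases he hy
  · exact ⟨_, _, by simp, fun z => hM.vertexEdge_subset_flag⟩
  · exact ⟨_, _, by simp, fun z => hM.edgeRegion_subset_flag⟩
  · exact ⟨_, _, by simp, fun z => hM.vertexRegion_subset_flag⟩

variable (M) in
/-- The triangles of the barycentric subdivision whose region has a given property. -/
def flagsOf (N : M.Region → Prop) [DecidablePred N] : Finset (Finset M.Cell) :=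
  (Finset.univ.filter fun y : D × Bool => N (M.flagRegion y)).image M.flag

variable (M) in
/-- The triangles of the barycentric subdivision. -/
def flags : Finset (Finset M.Cell) := Finset.univ.image M.flag

theorem flag_mem_flags (y : D × Bool) : M.flag y ∈ M.flags :=
  Finset.mem_image_of_mem _ (Finset.mem_univ y)

theorem IsSuperPrime.flag_mem_flagsOf (hM : M.IsSuperPrime) {N : M.Region → Prop}
    [DecidablePred N] {y : D × Bool} : M.flag y ∈ M.flagsOf N ↔ N (M.flagRegion y) := by
  rw [flagsOf, hM.flag_injective.mem_finset_image]
  simp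

theorem IsSuperPrime.bdry_eq (hM : M.IsSuperPrime) {A : Finset (Finset M.Cell)}
    (hA : A ⊆ M.flags) {e : Finset M.Cell} {p q : D × Bool} (hpq : p ≠ q)
    (h : ∀ z, e ⊆ M.flag z ↔ z = p ∨ z = q) :
    bdry A e = (if M.flag p ∈ A then 1 else 0) + if M.flag q ∈ A then 1 else 0 := by
  classical
  have hpq' : M.flag p ≠ M.flag q := hM.flag_injective.ne hpq
  rw [← Finset.sum_ite_eq' A (M.flag p) (fun _ => (1 : ZMod 2)),
    ← Finset.sum_ite_eq' A (M.flag q) (fun _ => (1 : ZMod 2)), ← Finset.sum_add_distrib, bdry]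
  refine Finset.sum_congr rfl fun t ht => ?_
  obtain ⟨z, -, rfl⟩ := Finset.mem_image.1 (hA ht)
  simp only [h, hM.flag_injective.eq_iff]
  by_cases h1 : z = p
  · subst h1; simp [hpq]
  · simp [h1]

theorem IsSuperPrime.mem_iff_of_bdry_eq_zero (hM : M.IsSuperPrime) {A : Finset (Finset M.Cell)}
    (hA : A ⊆ M.flags) {e : Finset M.Cell} {p q : D × Bool} (hpq : p ≠ q)
    (h : ∀ z, e ⊆ M.flag z ↔ z = p ∨ z = q) (h0 : bdry A e = 0) :
    M.flag p ∈ A ↔ M.flag q ∈ A := by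
  rw [hM.bdry_eq hA hpq h] at h0
  by_cases h1 : M.flag p ∈ A <;> by_cases h2 : M.flag q ∈ A <;> simp [h1, h2] at h0 ⊢

end Flags

end DoodleDiagram

/-! ### The barycentric subdivision is a triangulated sphere -/

/-- The barycentre of a cell has neighbours of two kinds, each indexed by the darts of the cell.
This turns the sum over neighbours into a sum over darts. -/
theorem vertexSum_eq_sum {V ι : Type*} [DecidableEq V] [Fintype V] {k : Finset V → ZMod 2} {w : V}
    {s : Finset ι} {g₁ g₂ : ι → V} (h₁ : InjOn g₁ s) (h₂ : InjOn g₂ s)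
    (h₁₂ : ∀ i j, g₁ i ≠ g₂ j) (hw : ∀ i, g₁ i ≠ w ∧ g₂ i ≠ w)
    (hk : ∀ u, u ≠ w → k {w, u} ≠ 0 → ∃ i ∈ s, g₁ i = u ∨ g₂ i = u) :
    vertexSum k w = ∑ i ∈ s, (k {w, g₁ i} + k {w, g₂ i}) := by
  have hd : Disjoint (s.image g₁) (s.image g₂) := by
    rw [Finset.disjoint_left]
    intro u hu hu'
    obtain ⟨i, -, rfl⟩ := Finset.mem_image.1 hu
    obtain ⟨j, -, hj⟩ := Finset.mem_image.1 hu'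
    exact h₁₂ i j hj.symm
  rw [Finset.sum_add_distrib, ← Finset.sum_image (f := fun u => k {w, u}) h₁,
    ← Finset.sum_image (f := fun u => k {w, u}) h₂, ← Finset.sum_union hd, vertexSum]
  symm
  refine Finset.sum_subset ?_ ?_
  · intro u hu
    rw [Finset.mem_erase]
    refine ⟨?_, Finset.mem_univ u⟩
    rcases Finset.mem_union.1 hu with h | h <;> obtain ⟨i, -, rfl⟩ := Finset.mem_image.1 h
    · exact (hw i).1
    · exact (hw i).2
  · intro u hu hu'
    by_contra h
    obtain ⟨i, hi, rfl | rfl⟩ := hk u (Finset.ne_of_mem_erase hu) h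
    · exact hu' (Finset.mem_union_left _ (Finset.mem_image_of_mem _ hi))
    · exact hu' (Finset.mem_union_right _ (Finset.mem_image_of_mem _ hi))

namespace DoodleDiagram

variable {D : Type*} [Fintype D] {M : DoodleDiagram D} [DecidableEq M.Cell]

theorem bdry_eq_zero {V : Type*} [DecidableEq V] {A : Finset (Finset V)} {e : Finset V}
    (h : ∀ t ∈ A, ¬e ⊆ t) : bdry A e = 0 :=
  Finset.sum_eq_zero fun t ht => if_neg (h t ht)

theorem IsSuperPrime.edge_flags (hM : M.IsSuperPrime) {e : Finset M.Cell} (he : e.card = 2) :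
    ∀ t ∈ M.flags, e ⊆ t → ∃ t' ∈ M.flags, t' ≠ t ∧ e ⊆ t' ∧
      ∀ s ∈ M.flags, e ⊆ s → s = t ∨ s = t' := by
  intro t ht het
  obtain ⟨y, -, rfl⟩ := Finset.mem_image.1 ht
  have key : ∀ p q : D × Bool, p ≠ q → (∀ z, e ⊆ M.flag z ↔ z = p ∨ z = q) → y = p →
      ∃ t' ∈ M.flags, t' ≠ M.flag y ∧ e ⊆ t' ∧ ∀ s ∈ M.flags, e ⊆ s → s = M.flag y ∨ s = t' := by
    rintro p q hpq h rfl
    refine ⟨M.flag q, flag_mem_flags q, hM.flag_injective.ne hpq.symm, (h q).2 (Or.inr rfl), ?_⟩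
    intro s hs hes
    obtain ⟨z, -, rfl⟩ := Finset.mem_image.1 hs
    rcases (h z).1 hes with rfl | rfl
    · exact Or.inl rfl
    · exact Or.inr rfl
  obtain ⟨p, q, hpq, h⟩ := hM.exists_pair he het
  rcases (h y).1 het with h1 | h1
  · exact key p q hpq h h1
  · exact key q p hpq.symm (fun z => (h z).trans or_comm) h1

/-! ### Cycle conditions at vertices, edges and regions -/

section Cycles

variable {k : Finset M.Cell → ZMod 2}

theorem exists_flag_of_cycle (hk : ∀ e, k e ≠ 0 → e.card = 2 ∧ ∃ t ∈ M.flags, e ⊆ t)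
    {w u : M.Cell} (h : k {w, u} ≠ 0) : ∃ y, w ∈ M.flag y ∧ u ∈ M.flag y := by
  obtain ⟨-, t, ht, h1⟩ := hk _ h
  obtain ⟨y, -, rfl⟩ := Finset.mem_image.1 ht
  exact ⟨y, h1 (by simp), h1 (by simp)⟩

theorem IsSuperPrime.sum_vertex [DecidableEq M.Vertex] (hM : M.IsSuperPrime)
    (hk : ∀ e, k e ≠ 0 → e.card = 2 ∧ ∃ t ∈ M.flags, e ⊆ t) (v : M.Vertex) :
    ∑ d with M.vertexOf d = v, (k (M.vertexEdge d) + k (M.vertexRegion d)) =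
      vertexSum k (Cell.vertex v) := by
  have iD : DecidableEq D := Classical.decEq _
  rw [vertexSum_eq_sum (s := Finset.univ.filter fun d => M.vertexOf d = v)
    (g₁ := fun d => Cell.edge (M.edgeOf d)) (g₂ := fun d => Cell.region (M.regionOf d))]
  · refine Finset.sum_congr rfl fun d hd => ?_
    rw [← (Finset.mem_filter.1 hd).2]
    rfl
  · intro d hd d' hd' h
    simp only [Finset.coe_filter, Finset.mem_univ, true_and, mem_ofPred_eq] at hd hd'
    exact hM.eq_of_vertexOf_edgeOf (hd.trans hd'.symm) (Cell.edge.inj h)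
  · intro d hd d' hd' h
    simp only [Finset.coe_filter, Finset.mem_univ, true_and, mem_ofPred_eq] at hd hd'
    exact hM.eq_of_vertexOf_regionOf (hd.trans hd'.symm) (Cell.region.inj h)
  · simp
  · simp
  · intro u hu h
    obtain ⟨⟨d, b⟩, h1, h2⟩ := exists_flag_of_cycle hk h
    rw [vertex_mem_flag] at h1
    simp only [flag, Finset.mem_insert, Finset.mem_singleton] at h2
    rcases h2 with rfl | rfl | rfl
    · exact absurd (by rw [h1]) hu
    · exact ⟨d, by simp [h1], Or.inl rfl⟩
    · cases b
      · exact ⟨M.rot d, by simp [h1, M.vertexOf_rot],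
          Or.inr (by rw [flagRegion_false, M.regionOf_rot])⟩
      · exact ⟨d, by simp [h1], Or.inr rfl⟩

theorem IsSuperPrime.sum_edge (hM : M.IsSuperPrime)
    (hk : ∀ e, k e ≠ 0 → e.card = 2 ∧ ∃ t ∈ M.flags, e ⊆ t) (d : D) :
    k (M.vertexEdge d) + k (M.edgeRegion d) +
      (k (M.vertexEdge (M.rev d)) + k (M.edgeRegion (M.rev d))) =
      vertexSum k (Cell.edge (M.edgeOf d)) := by
  have iD : DecidableEq D := Classical.decEq _
  have hs : ∀ x ∈ ({d, M.rev d} : Finset D), M.edgeOf x = M.edgeOf d := by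
    simp [M.edgeOf_rev]
  rw [vertexSum_eq_sum (s := {d, M.rev d})
    (g₁ := fun d => Cell.vertex (M.vertexOf d)) (g₂ := fun d => Cell.region (M.regionOf d)),
    Finset.sum_pair (M.rev_ne d).symm]
  · simp only [vertexEdge, edgeRegion, M.edgeOf_rev, Finset.pair_comm (Cell.edge _) (Cell.vertex _)]
  · intro x hx x' hx' h
    exact hM.eq_of_vertexOf_edgeOf (Cell.vertex.inj h) ((hs x hx).trans (hs x' hx').symm)
  · intro x hx x' hx' h
    exact hM.eq_of_edgeOf_regionOf ((hs x hx).trans (hs x' hx').symm) (Cell.region.inj h)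
  · simp
  · simp
  · intro u hu h
    obtain ⟨⟨x, b⟩, h1, h2⟩ := exists_flag_of_cycle hk h
    rw [edge_mem_flag] at h1
    have hx : x = d ∨ x = M.rev d := (M.edgeOf_eq_iff).1 h1
    have hx' : M.rev x = d ∨ M.rev x = M.rev d :=
      (M.edgeOf_eq_iff).1 (h1.trans (M.edgeOf_rev x).symm)
    simp only [flag, Finset.mem_insert, Finset.mem_singleton] at h2
    rcases h2 with rfl | rfl | rfl
    · exact ⟨x, by simpa using hx, Or.inl rfl⟩
    · exact absurd (by rw [h1]) hu
    · cases b
      · exact ⟨M.rev x, by simpa using hx', Or.inr rfl⟩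
      · exact ⟨x, by simpa using hx, Or.inr rfl⟩

theorem IsSuperPrime.sum_region [DecidableEq M.Region] (hM : M.IsSuperPrime)
    (hk : ∀ e, k e ≠ 0 → e.card = 2 ∧ ∃ t ∈ M.flags, e ⊆ t) (F : M.Region) :
    ∑ d with M.regionOf d = F, (k (M.vertexRegion d) + k (M.edgeRegion d)) =
      vertexSum k (Cell.region F) := by
  have iD : DecidableEq D := Classical.decEq _
  rw [vertexSum_eq_sum (s := Finset.univ.filter fun d => M.regionOf d = F)
    (g₁ := fun d => Cell.vertex (M.vertexOf d)) (g₂ := fun d => Cell.edge (M.edgeOf d))]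
  · refine Finset.sum_congr rfl fun d hd => ?_
    rw [← (Finset.mem_filter.1 hd).2, Finset.pair_comm, Finset.pair_comm (Cell.region _)]
    rfl
  · intro d hd d' hd' h
    simp only [Finset.coe_filter, Finset.mem_univ, true_and, mem_ofPred_eq] at hd hd'
    exact hM.eq_of_vertexOf_regionOf (Cell.vertex.inj h) (hd.trans hd'.symm)
  · intro d hd d' hd' h
    simp only [Finset.coe_filter, Finset.mem_univ, true_and, mem_ofPred_eq] at hd hd'
    exact hM.eq_of_edgeOf_regionOf (Cell.edge.inj h) (hd.trans hd'.symm)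
  · simp
  · simp
  · intro u hu h
    obtain ⟨⟨d, b⟩, h1, h2⟩ := exists_flag_of_cycle hk h
    rw [region_mem_flag] at h1
    simp only [flag, Finset.mem_insert, Finset.mem_singleton] at h2
    cases b
    · rw [flagRegion_false] at h1 h2
      rcases h2 with rfl | rfl | rfl
      · exact ⟨M.rot d, by simp [h1, M.regionOf_rot], Or.inl (by rw [M.vertexOf_rot])⟩
      · exact ⟨M.rev d, by simp [h1], Or.inr (by rw [M.edgeOf_rev])⟩
      · exact absurd (by rw [h1]) hu
    · rw [flagRegion_true] at h1 h2
      rcases h2 with rfl | rfl | rfl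
      · exact ⟨d, by simp [h1], Or.inl rfl⟩
      · exact ⟨d, by simp [h1], Or.inr rfl⟩
      · exact absurd (by rw [h1]) hu

end Cycles

theorem IsSuperPrime.homology_flags (hM : M.IsSuperPrime) {k : Finset M.Cell → ZMod 2}
    (hk : ∀ e, k e ≠ 0 → e.card = 2 ∧ ∃ t ∈ M.flags, e ⊆ t) (h0 : ∀ w, vertexSum k w = 0) :
    ∃ B ⊆ M.flags, ∀ e, e.card = 2 → bdry B e = k e := by
  have iV : DecidableEq M.Vertex := Classical.decEq _
  have iR : DecidableEq M.Region := Classical.decEq _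
  obtain ⟨p, q, h1, h2, h3⟩ := M.exists_potential (kve := fun d => k (M.vertexEdge d))
    (ker := fun d => k (M.edgeRegion d)) (kvr := fun d => k (M.vertexRegion d))
    (fun v => (hM.sum_vertex hk v).trans (h0 _)) (fun d => (hM.sum_edge hk d).trans (h0 _))
    (fun F => (hM.sum_region hk F).trans (h0 _))
  have key : ∀ a : ZMod 2, (if a = 1 then (1 : ZMod 2) else 0) = a := by decide
  -- The solution `p`, `q` gives the coefficients of the flags on the two sides of each dart; `B`
  -- consists of the flags with coefficient one.
  let f : D × Bool → ZMod 2 := fun y => if y.2 then p y.1 else q y.1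
  let B : Finset (Finset M.Cell) := (Finset.univ.filter fun y => f y = 1).image M.flag
  have hB : B ⊆ M.flags := Finset.image_subset_image (Finset.filter_subset _ _)
  have hmem : ∀ y, M.flag y ∈ B ↔ f y = 1 := fun y => by
    rw [hM.flag_injective.mem_finset_image]; simp
  refine ⟨B, hB, fun e he => ?_⟩
  by_cases hy : ∃ y, e ⊆ M.flag y
  · obtain ⟨y, hy⟩ := hy
    obtain ⟨d, rfl | rfl | rfl⟩ := edge_cases he hy
    · rw [hM.bdry_eq hB (by simp) (fun z => hM.vertexEdge_subset_flag)]
      simp only [hmem, key]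
      exact h1 d
    · rw [hM.bdry_eq hB (by simp) (fun z => hM.edgeRegion_subset_flag)]
      simp only [hmem, key]
      exact h2 d
    · rw [hM.bdry_eq hB (by simp) (fun z => hM.vertexRegion_subset_flag)]
      simp only [hmem, key]
      exact h3 d
  · rw [bdry_eq_zero]
    · by_contra h
      obtain ⟨-, t, ht, het⟩ := hk e (Ne.symm h)
      obtain ⟨y, -, rfl⟩ := Finset.mem_image.1 ht
      exact hy ⟨y, het⟩
    · intro t ht het
      obtain ⟨y, -, rfl⟩ := Finset.mem_image.1 (hB ht)
      exact hy ⟨y, het⟩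

/-- For `star`, the flags at a cell are run through by turning around it: the orbit of `rot`, `rev`
or `rot * rev` according to its dimension, with two edges of the subdivision crossed at each turn.
For `connected`, the same moves generate all darts. -/
theorem IsSuperPrime.isSphereTriangulation (hM : M.IsSuperPrime) :
    IsSphereTriangulation M.flags where
  card_eq := by
    intro t ht
    obtain ⟨y, -, rfl⟩ := Finset.mem_image.1 ht
    exact card_flag y
  edge := fun e he => hM.edge_flags he
  homology := fun k hk h0 => hM.homology_flags hk h0
  star := by
    intro A hA w h t ht hwt t' ht' hwt'
    obtain ⟨⟨d, b⟩, -, rfl⟩ := Finset.mem_image.1 (hA ht)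
    obtain ⟨⟨d', b'⟩, -, rfl⟩ := Finset.mem_image.1 ht'
    have hve : ∀ d, w ∈ M.vertexEdge d → (M.flag (d, true) ∈ A ↔ M.flag (d, false) ∈ A) :=
      fun d hd => hM.mem_iff_of_bdry_eq_zero hA (by simp) (fun z => hM.vertexEdge_subset_flag)
        (h _ (Finset.card_pair (by simp)) hd)
    have her : ∀ d, w ∈ M.edgeRegion d → (M.flag (d, true) ∈ A ↔ M.flag (M.rev d, false) ∈ A) :=
      fun d hd => hM.mem_iff_of_bdry_eq_zero hA (by simp) (fun z => hM.edgeRegion_subset_flag)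
        (h _ (Finset.card_pair (by simp)) hd)
    have hvr : ∀ d, w ∈ M.vertexRegion d →
        (M.flag (d, true) ∈ A ↔ M.flag (M.rot.symm d, false) ∈ A) :=
      fun d hd => hM.mem_iff_of_bdry_eq_zero hA (by simp) (fun z => hM.vertexRegion_subset_flag)
        (h _ (Finset.card_pair (by simp)) hd)
    cases w with
    | vertex v =>
      rw [vertex_mem_flag] at hwt hwt'
      have h1 : ∀ x, v = M.vertexOf x → (M.flag (x, true) ∈ A ↔ M.flag (x, false) ∈ A) :=
        fun x hx => hve x (by simp [vertexEdge, hx])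
      have h2 : ∀ x, v = M.vertexOf x → (M.flag (M.rot x, true) ∈ A ↔ M.flag (x, true) ∈ A) :=
        fun x hx => by
          rw [hvr (M.rot x) (by simp [vertexRegion, hx, M.vertexOf_rot]), h1 x hx,
            Equiv.symm_apply_apply]
      have h3 := eq_of_sameCycle (b := fun x => v = M.vertexOf x ∧ M.flag (x, true) ∈ A)
        (fun x => propext (by rw [M.vertexOf_rot]; exact and_congr_right (h2 x)))
        (M.vertexOf_eq.1 (hwt.symm.trans hwt'))
      have h4 : M.flag (d, true) ∈ A := by
        cases b
        · exact (h1 d hwt).2 ht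
        · exact ht
      have h5 : v = M.vertexOf d' ∧ M.flag (d', true) ∈ A := h3 ▸ ⟨hwt, h4⟩
      cases b'
      · exact (h1 d' hwt').1 h5.2
      · exact h5.2
    | edge e =>
      rw [edge_mem_flag] at hwt hwt'
      have h1 : ∀ x, e = M.edgeOf x → (M.flag (x, true) ∈ A ↔ M.flag (x, false) ∈ A) :=
        fun x hx => hve x (by simp [vertexEdge, hx])
      have h2 : ∀ x, e = M.edgeOf x → (M.flag (M.rev x, true) ∈ A ↔ M.flag (x, true) ∈ A) :=
        fun x hx => by
          rw [her x (by simp [edgeRegion, hx]), h1 (M.rev x) (by rw [hx, M.edgeOf_rev])]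
      have h3 := eq_of_sameCycle (b := fun x => e = M.edgeOf x ∧ M.flag (x, true) ∈ A)
        (fun x => propext (by rw [M.edgeOf_rev]; exact and_congr_right (h2 x)))
        (M.edgeOf_eq.1 (hwt.symm.trans hwt'))
      have h4 : M.flag (d, true) ∈ A := by
        cases b
        · exact (h1 d hwt).2 ht
        · exact ht
      have h5 : e = M.edgeOf d' ∧ M.flag (d', true) ∈ A := h3 ▸ ⟨hwt, h4⟩
      cases b'
      · exact (h1 d' hwt').1 h5.2
      · exact h5.2
    | region F =>
      rw [region_mem_flag] at hwt hwt'
      have h1 : ∀ x, F = M.regionOf x → (M.flag (x, true) ∈ A ↔ M.flag (M.rev x, false) ∈ A) :=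
        fun x hx => her x (by simp [edgeRegion, hx])
      have h2 : ∀ x, F = M.regionOf x →
          (M.flag (M.rot (M.rev x), true) ∈ A ↔ M.flag (x, true) ∈ A) := fun x hx => by
        rw [hvr _ (by simp [vertexRegion, hx, M.regionOf_rot_rev]), Equiv.symm_apply_apply, h1 x hx]
      have h3 : ∀ x y, F = M.regionOf x → F = M.regionOf y → M.flag (x, true) ∈ A →
          M.flag (y, true) ∈ A := fun x y hx hy hxA => by
        have := eq_of_sameCycle (b := fun x => F = M.regionOf x ∧ M.flag (x, true) ∈ A)
          (fun x => propext (by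
            rw [Equiv.Perm.mul_apply, M.regionOf_rot_rev]; exact and_congr_right (h2 x)))
          (M.regionOf_eq.1 (hx.symm.trans hy))
        have h5 : F = M.regionOf y ∧ M.flag (y, true) ∈ A := this ▸ ⟨hx, hxA⟩
        exact h5.2
      have h4 : ∀ x, F = M.regionOf (M.rev x) →
          (M.flag (x, false) ∈ A ↔ M.flag (M.rev x, true) ∈ A) := fun x hx => by
        rw [h1 _ hx, M.rev_rev]
      cases b <;> cases b'
      · rw [h4 d' hwt']
        exact h3 _ _ hwt hwt' ((h4 d hwt).1 ht)
      · exact h3 _ _ hwt hwt' ((h4 d hwt).1 ht)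
      · rw [h4 d' hwt']
        exact h3 _ _ hwt hwt' ht
      · exact h3 _ _ hwt hwt' ht
  connected := by
    intro A hA h
    have hve : ∀ d, M.flag (d, true) ∈ A ↔ M.flag (d, false) ∈ A :=
      fun d => hM.mem_iff_of_bdry_eq_zero hA (by simp) (fun z => hM.vertexEdge_subset_flag)
        (h _ (Finset.card_pair (by simp)))
    have her : ∀ d, M.flag (d, true) ∈ A ↔ M.flag (M.rev d, false) ∈ A :=
      fun d => hM.mem_iff_of_bdry_eq_zero hA (by simp) (fun z => hM.edgeRegion_subset_flag)
        (h _ (Finset.card_pair (by simp)))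
    have hvr : ∀ d, M.flag (d, true) ∈ A ↔ M.flag (M.rot.symm d, false) ∈ A :=
      fun d => hM.mem_iff_of_bdry_eq_zero hA (by simp) (fun z => hM.vertexRegion_subset_flag)
        (h _ (Finset.card_pair (by simp)))
    have key : ∀ d d', (M.flag (d, true) ∈ A) = (M.flag (d', true) ∈ A) :=
      M.eq_of_invariant (b := fun d => M.flag (d, true) ∈ A)
        (fun d => propext (by rw [hvr, Equiv.symm_apply_apply, hve]))
        (fun d => propext (by rw [her, M.rev_rev, hve]))
    rcases A.eq_empty_or_nonempty with h1 | ⟨t, ht⟩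
    · exact Or.inl h1
    · right
      refine Finset.Subset.antisymm hA fun t' ht' => ?_
      obtain ⟨⟨d, b⟩, -, rfl⟩ := Finset.mem_image.1 (hA ht)
      obtain ⟨⟨d', b'⟩, -, rfl⟩ := Finset.mem_image.1 ht'
      have h4 : M.flag (d, true) ∈ A := by
        cases b
        · exact (hve d).2 ht
        · exact ht
      have h5 : M.flag (d', true) ∈ A := key d d' ▸ h4
      cases b'
      · exact (hve d').1 h5
      · exact h5

/-! ### The face relation and its transitivity -/

section Faces

variable {D : Type*} [Finite D] {M : DoodleDiagram D}

namespace Cell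

theorem IsFaceOf.refl (c : M.Cell) : c.IsFaceOf c := by
  refine ⟨le_rfl, ?_⟩
  cases c with
  | vertex v => obtain ⟨d, rfl⟩ := M.vertexOf_surjective v; exact ⟨d, rfl, rfl⟩
  | edge e => obtain ⟨d, rfl⟩ := M.edgeOf_surjective e; exact ⟨d, rfl, rfl⟩
  | region F => obtain ⟨d, rfl⟩ := M.regionOf_surjective F; exact ⟨d, rfl, rfl⟩

theorem IsFaceOf.eq_of_dim_eq {c c' : M.Cell} (h : c.IsFaceOf c') (hd : c.dim = c'.dim) :
    c = c' := by
  obtain ⟨-, d, h1, h2⟩ := h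
  cases c <;> cases c' <;> simp only [dim, zero_ne_one, one_ne_zero,
    OfNat.zero_ne_ofNat, OfNat.ofNat_ne_zero, OfNat.one_ne_ofNat, OfNat.ofNat_ne_one] at hd
  · exact congrArg vertex (Eq.trans (Eq.symm h1) h2)
  · exact congrArg edge (Eq.trans (Eq.symm h1) h2)
  · exact congrArg region (Eq.trans (Eq.symm h1) h2)

theorem IsFaceOf.trans {c c' c'' : M.Cell} (h : c.IsFaceOf c') (h' : c'.IsFaceOf c'') :
    c.IsFaceOf c'' := by
  by_cases e1 : c.dim = c'.dim
  · exact h.eq_of_dim_eq e1 ▸ h'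
  by_cases e2 : c'.dim = c''.dim
  · exact h'.eq_of_dim_eq e2 ▸ h
  refine ⟨h.1.trans h'.1, ?_⟩
  have h3 := h.1
  have h4 := h'.1
  obtain ⟨-, d, h1, h2⟩ := h
  obtain ⟨-, d', h1', h2'⟩ := h'
  cases c <;> cases c' <;> cases c'' <;> simp [dim] at e1 e2 h3 h4
  -- Only a vertex in an edge in a region remains. If the incidences are witnessed by opposite
  -- darts, `rot d` starts where `d` does and belongs to the region of `rev d`.
  have h5 : d' = d ∨ d' = M.rev d := (M.edgeOf_eq_iff).1 (Eq.trans h2 (Eq.symm h1'))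
  rcases h5 with rfl | rfl
  · exact ⟨d', h1, h2'⟩
  · exact ⟨M.rot d, Eq.trans (M.vertexOf_rot d) h1, Eq.trans (M.regionOf_rot d) h2'⟩

end Cell

theorem isOn_flagRegion (y : D × Bool) : M.IsOn (M.flagRegion y) (M.vertexOf y.1) := by
  obtain ⟨d, b⟩ := y
  cases b
  · exact ⟨M.rot d, M.regionOf_rot d, M.vertexOf_rot d⟩
  · exact ⟨d, rfl, rfl⟩

theorem isOn_flagRegion_rev (y : D × Bool) :
    M.IsOn (M.flagRegion y) (M.vertexOf (M.rev y.1)) := by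
  obtain ⟨d, b⟩ := y
  cases b
  · exact ⟨M.rev d, rfl, rfl⟩
  · exact ⟨M.rot (M.rev d), M.regionOf_rot_rev d, M.vertexOf_rot _⟩

theorem vertex_isFaceOf_region_iff {v : M.Vertex} {F : M.Region} :
    (Cell.vertex v).IsFaceOf (Cell.region F) ↔ M.IsOn F v :=
  ⟨fun ⟨_, d, h1, h2⟩ => ⟨d, h2, h1⟩, fun ⟨d, h1, h2⟩ => ⟨Nat.zero_le _, d, h2, h1⟩⟩

theorem Touches.of_isOn_of_isOn {R F : M.Region} {v : M.Vertex} (h : M.IsOn R v)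
    (h' : M.IsOn F v) : M.Touches R F := by
  obtain ⟨f, hf, rfl⟩ := h'
  exact ⟨f, hf, h⟩

theorem touches_of_edgeOf_eq {y z : D × Bool} (h : M.edgeOf y.1 = M.edgeOf z.1) :
    M.Touches (M.flagRegion y) (M.flagRegion z) := by
  rcases (M.edgeOf_eq_iff).1 h with h1 | h1
  · exact .of_isOn_of_isOn (isOn_flagRegion y) (h1 ▸ isOn_flagRegion z)
  · exact .of_isOn_of_isOn (isOn_flagRegion_rev y) (h1 ▸ isOn_flagRegion z)

end Faces

/-! ### Points of closed cells -/

section ClosedCells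

variable {D : Type*} [Fintype D] {M : DoodleDiagram D} [DecidableEq M.Cell]

theorem isFaceOf_of_mem_flag {c : M.Cell} {y : D × Bool} (h : c ∈ M.flag y) :
    c.IsFaceOf (Cell.region (M.flagRegion y)) := by
  simp only [flag, Finset.mem_insert, Finset.mem_singleton] at h
  rcases h with rfl | rfl | rfl
  · exact vertex_isFaceOf_region_iff.2 (isOn_flagRegion y)
  · obtain ⟨d, b⟩ := y
    cases b
    · exact ⟨by simp [Cell.dim], M.rev d, M.edgeOf_rev d, rfl⟩
    · exact ⟨by simp [Cell.dim], d, rfl, rfl⟩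
  · exact .refl _

theorem isFaceOf_or_of_mem_flag {c c' : M.Cell} {y : D × Bool} (h : c ∈ M.flag y)
    (h' : c' ∈ M.flag y) : c.IsFaceOf c' ∨ c'.IsFaceOf c := by
  have hve : (Cell.vertex (M.vertexOf y.1)).IsFaceOf (Cell.edge (M.edgeOf y.1)) :=
    ⟨Nat.zero_le _, y.1, rfl, rfl⟩
  have h1 := isFaceOf_of_mem_flag h
  have h2 := isFaceOf_of_mem_flag h'
  simp only [flag, Finset.mem_insert, Finset.mem_singleton] at h h'
  rcases h with rfl | rfl | rfl
  · rcases h' with rfl | rfl | rfl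
    · exact Or.inl (.refl _)
    · exact Or.inl hve
    · exact Or.inl h1
  · rcases h' with rfl | rfl | rfl
    · exact Or.inr hve
    · exact Or.inl (.refl _)
    · exact Or.inl h1
  · exact Or.inr h2

/-- The support of `x` is a chain, so it has at most one vertex and one edge; these extend to a flag
on the side of `F`. -/
theorem exists_flag_of_mem_closedCell {F : M.Region} {x : M.Cell → ℝ}
    (hx : x ∈ M.closedCell (Cell.region F)) :
    ∃ y, M.flagRegion y = F ∧ ∀ c, x c ≠ 0 → c ∈ M.flag y := by
  obtain ⟨⟨-, hc⟩, hF⟩ := hx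
  suffices h : ∃ y, M.flagRegion y = F ∧
      (∀ v, x (Cell.vertex v) ≠ 0 → v = M.vertexOf y.1) ∧
      ∀ e, x (Cell.edge e) ≠ 0 → e = M.edgeOf y.1 by
    obtain ⟨y, hy, hv, he⟩ := h
    refine ⟨y, hy, fun c hxc => ?_⟩
    cases c with
    | vertex v => exact M.vertex_mem_flag.2 (hv v hxc)
    | edge e => exact M.edge_mem_flag.2 (he e hxc)
    | region G =>
      rw [region_mem_flag, hy]
      exact Cell.region.inj ((hF _ hxc).eq_of_dim_eq rfl)
  have hvv : ∀ v w, x (Cell.vertex v) ≠ 0 → x (Cell.vertex w) ≠ 0 → w = v := fun v w hv hw =>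
    (hc _ _ hv hw).elim (fun h => (Cell.vertex.inj (h.eq_of_dim_eq rfl)).symm)
      fun h => Cell.vertex.inj (h.eq_of_dim_eq rfl)
  have hee : ∀ v w, x (Cell.edge v) ≠ 0 → x (Cell.edge w) ≠ 0 → w = v := fun v w hv hw =>
    (hc _ _ hv hw).elim (fun h => (Cell.edge.inj (h.eq_of_dim_eq rfl)).symm)
      fun h => Cell.edge.inj (h.eq_of_dim_eq rfl)
  by_cases hv : ∃ v, x (Cell.vertex v) ≠ 0
  · obtain ⟨v, hv⟩ := hv
    by_cases he : ∃ e, x (Cell.edge e) ≠ 0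
    · obtain ⟨e, he⟩ := he
      have h1 : (Cell.vertex v).IsFaceOf (Cell.edge e) := by
        rcases hc _ _ hv he with h | h
        · exact h
        · exact absurd h.1 (by simp [Cell.dim])
      obtain ⟨-, d, rfl, rfl⟩ := h1
      obtain ⟨-, d', h2, h3⟩ := hF _ he
      rcases (M.edgeOf_eq_iff).1 (Eq.symm h2) with rfl | rfl
      · exact ⟨(d', true), h3, fun w hw => hvv _ w hv hw, fun w hw => hee _ w he hw⟩
      · exact ⟨(d, false), h3, fun w hw => hvv _ w hv hw, fun w hw => hee _ w he hw⟩
    · obtain ⟨-, d, rfl, h3⟩ := hF _ hv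
      exact ⟨(d, true), h3, fun w hw => hvv _ w hv hw, fun w hw => absurd ⟨w, hw⟩ he⟩
  · by_cases he : ∃ e, x (Cell.edge e) ≠ 0
    · obtain ⟨e, he⟩ := he
      obtain ⟨-, d, rfl, h3⟩ := hF _ he
      exact ⟨(d, true), h3, fun w hw => absurd ⟨w, hw⟩ hv, fun w hw => hee _ w he hw⟩
    · obtain ⟨d, hd⟩ := M.regionOf_surjective F
      exact ⟨(d, true), hd, fun w hw => absurd ⟨w, hw⟩ hv, fun w hw => absurd ⟨w, hw⟩ he⟩

theorem mem_closedCell_of_flag {y : D × Bool} {x : M.Cell → ℝ} (hx : x ∈ stdSimplex ℝ M.Cell)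
    (h : ∀ c, x c ≠ 0 → c ∈ M.flag y) : x ∈ M.closedCell (Cell.region (M.flagRegion y)) :=
  ⟨⟨hx, fun c c' hc hc' => isFaceOf_or_of_mem_flag (h c hc) (h c' hc')⟩,
    fun c hc => isFaceOf_of_mem_flag (h c hc)⟩

theorem disjoint_closedCell_boundary {R F : M.Region} (h : ¬ M.Touches R F) :
    Disjoint (M.closedCell (Cell.region F)) (M.boundary R) := by
  rw [Set.disjoint_left]
  rintro x hxF ⟨hxR, hx0⟩
  obtain ⟨c, hc⟩ := exists_ne_zero_of_mem_stdSimplex hxF.1.1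
  obtain ⟨z, rfl, hz⟩ := exists_flag_of_mem_closedCell hxF
  obtain ⟨y, rfl, hy⟩ := exists_flag_of_mem_closedCell hxR
  have h1 := hz c hc
  have h2 := hy c hc
  cases c with
  | vertex v =>
    rw [vertex_mem_flag] at h1 h2
    exact h (.of_isOn_of_isOn (isOn_flagRegion y) (h2 ▸ h1 ▸ isOn_flagRegion z))
  | edge e =>
    rw [edge_mem_flag] at h1 h2
    exact h (touches_of_edgeOf_eq (h2.symm.trans h1))
  | region G =>
    rw [region_mem_flag] at h2
    exact hc (h2 ▸ hx0)

/-- The point at `v` itself would lie in both sets. -/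
theorem not_isOn_of_disjoint {D : Type*} [Finite D] {M : DoodleDiagram D} {R : M.Region}
    {c : M.Cell} (h : Disjoint (M.closedCell c) (M.boundary R)) {v : M.Vertex}
    (hv : (Cell.vertex v).IsFaceOf c) : ¬ M.IsOn R v := by
  classical
  intro hR
  have hs : ∀ c', (Pi.single (Cell.vertex v) 1 : M.Cell → ℝ) c' ≠ 0 → c' = Cell.vertex v :=
    fun c' hc' => by_contra fun hne => hc' (by simp [hne])
  have hsph : (Pi.single (Cell.vertex v) 1 : M.Cell → ℝ) ∈ M.sphere := by
    refine ⟨single_mem_stdSimplex ℝ _, fun c₁ c₂ h1 h2 => ?_⟩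
    rw [hs _ h1, hs _ h2]
    exact Or.inl (.refl _)
  have h1 : (Pi.single (Cell.vertex v) 1 : M.Cell → ℝ) ∈ M.closedCell c :=
    ⟨hsph, fun c' hc' => hs _ hc' ▸ hv⟩
  exact Set.disjoint_left.1 h h1
    ⟨⟨hsph, fun c' hc' => hs _ hc' ▸ vertex_isFaceOf_region_iff.2 hR⟩, by simp⟩

end ClosedCells

/-! ### The inner complement as a strongly connected set of triangles -/

section InnerComplement

variable {D : Type*} [Fintype D] {M : DoodleDiagram D}

/-- The inner complement of a region is a union of closed regions. -/
theorem IsSuperPrime.exists_region_of_disjoint (hM : M.IsSuperPrime) {R : M.Region} {c : M.Cell}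
    (h : Disjoint (M.closedCell c) (M.boundary R)) :
    ∃ F, ¬ M.Touches R F ∧ c.IsFaceOf (Cell.region F) := by
  cases c with
  | vertex v =>
    obtain ⟨d, rfl, hd⟩ := hM.exists_not_touches (not_isOn_of_disjoint h (.refl _))
    exact ⟨_, hd, vertex_isFaceOf_region_iff.2 ⟨d, rfl, rfl⟩⟩
  | edge e =>
    obtain ⟨d, rfl⟩ := M.edgeOf_surjective e
    have h1 := not_isOn_of_disjoint h (v := M.vertexOf d) ⟨Nat.zero_le _, d, rfl, rfl⟩
    have h2 := not_isOn_of_disjoint h (v := M.target d)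
      ⟨Nat.zero_le _, M.rev d, rfl, M.edgeOf_rev d⟩
    rcases hM.not_touches_of_edge h1 h2 with h3 | h3
    · exact ⟨_, h3, by simp [Cell.dim], d, rfl, rfl⟩
    · exact ⟨_, h3, by simp [Cell.dim], M.rev d, M.edgeOf_rev d, rfl⟩
  | region F =>
    refine ⟨F, ?_, .refl _⟩
    rintro ⟨f, rfl, hf⟩
    exact not_isOn_of_disjoint h (vertex_isFaceOf_region_iff.2 ⟨f, rfl, rfl⟩) hf

variable [DecidableEq M.Cell]

theorem IsSuperPrime.innerComplement_eq (hM : M.IsSuperPrime) (R : M.Region)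
    [DecidablePred fun F => ¬ M.Touches R F] :
    M.innerComplement R =
      realization (M.flagsOf fun F => ¬ M.Touches R F : Set (Finset M.Cell)) := by
  ext x
  simp only [innerComplement, mem_iUnion, mem_ofPred_eq, exists_prop]
  constructor
  · rintro ⟨c, hc, hx⟩
    obtain ⟨F, hF, hcF⟩ := hM.exists_region_of_disjoint hc
    have hxF : x ∈ M.closedCell (Cell.region F) := ⟨hx.1, fun c' hc' => (hx.2 c' hc').trans hcF⟩
    obtain ⟨y, rfl, hy⟩ := exists_flag_of_mem_closedCell hxF
    exact ⟨hx.1.1, M.flag y, Finset.mem_coe.2 (hM.flag_mem_flagsOf.2 hF), hy⟩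
  · rintro ⟨hx, t, ht, hxt⟩
    obtain ⟨y, hy, rfl⟩ := Finset.mem_image.1 (Finset.mem_coe.1 ht)
    exact ⟨_, disjoint_closedCell_boundary (Finset.mem_filter.1 hy).2,
      mem_closedCell_of_flag hx hxt⟩

/-- The flags of a set of regions are strongly connected if these regions are connected through
their common edges. -/
theorem IsSuperPrime.stronglyConnected_flagsOf (hM : M.IsSuperPrime) {N : M.Region → Prop}
    [DecidablePred N]
    (hN : ∀ Q : M.Region → Prop, (∀ d, N (M.regionOf d) → N (M.regionOf (M.rev d)) →
      Q (M.regionOf d) → Q (M.regionOf (M.rev d))) → ∀ F F', N F → N F' → Q F → Q F') :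
    StronglyConnected (M.flagsOf N) := by
  intro B hB
  have step : ∀ {e : Finset M.Cell} {y z : D × Bool}, e.card = 2 → e ⊆ M.flag y → e ⊆ M.flag z →
      N (M.flagRegion y) → N (M.flagRegion z) → M.flag y ∈ B → M.flag z ∈ B :=
    fun he hy hz hNy hNz => hB _ (hM.flag_mem_flagsOf.2 hNy) _ (hM.flag_mem_flagsOf.2 hNz) _ he hy hz
  have iff : ∀ {e : Finset M.Cell} {y z : D × Bool}, e.card = 2 →
      (∀ x, e ⊆ M.flag x ↔ x = y ∨ x = z) →
      N (M.flagRegion y) → N (M.flagRegion z) → (M.flag y ∈ B ↔ M.flag z ∈ B) :=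
    fun he h hNy hNz => ⟨step he ((h _).2 (Or.inl rfl)) ((h _).2 (Or.inr rfl)) hNy hNz,
      step he ((h _).2 (Or.inr rfl)) ((h _).2 (Or.inl rfl)) hNz hNy⟩
  have her : ∀ d, N (M.regionOf d) → (M.flag (d, true) ∈ B ↔ M.flag (M.rev d, false) ∈ B) :=
    fun d hd => iff (Finset.card_pair (by simp)) (fun x => hM.edgeRegion_subset_flag) hd
      (by rwa [flagRegion_false, M.rev_rev])
  have hvr : ∀ d, N (M.regionOf d) →
      (M.flag (d, true) ∈ B ↔ M.flag (M.rot.symm d, false) ∈ B) :=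
    fun d hd => iff (Finset.card_pair (by simp)) (fun x => hM.vertexRegion_subset_flag) hd
      (by rwa [flagRegion_false, ← regionOf_rot, Equiv.apply_symm_apply])
  have h2 : ∀ x y, N (M.regionOf x) → M.regionOf x = M.regionOf y → M.flag (x, true) ∈ B →
      M.flag (y, true) ∈ B := fun x y hx hxy hxB => by
    have := eq_of_sameCycle (b := fun x => N (M.regionOf x) ∧ M.flag (x, true) ∈ B)
      (fun x => propext (by
        rw [Equiv.Perm.mul_apply, M.regionOf_rot_rev]
        refine and_congr_right fun h => ?_
        rw [hvr _ (by rwa [M.regionOf_rot_rev]), Equiv.symm_apply_apply, her x h]))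
      (M.regionOf_eq.1 hxy)
    have h5 : N (M.regionOf y) ∧ M.flag (y, true) ∈ B := this ▸ ⟨hx, hxB⟩
    exact h5.2
  have h3 : ∀ d, N (M.regionOf (M.rev d)) →
      (M.flag (d, false) ∈ B ↔ M.flag (M.rev d, true) ∈ B) := fun d hd => by
    rw [her _ hd, M.rev_rev]
  -- By `h2` and `h3`, the flags inside one region lie all in `B` or all outside it. Two regions
  -- sharing an edge are linked by the pair of flags on the two sides of a dart.
  have hQ := hN (fun F => ∃ d, M.regionOf d = F ∧ M.flag (d, true) ∈ B) (by
    rintro d hd hd' ⟨x, hx, hxB⟩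
    refine ⟨M.rev d, rfl, (h3 d hd').1 ?_⟩
    exact (iff (Finset.card_pair (by simp)) (fun x => hM.vertexEdge_subset_flag) hd hd').1
      (h2 x d (hx ▸ hd) hx hxB))
  rw [or_iff_not_imp_right, Finset.not_disjoint_iff]
  rintro ⟨t, ht, htB⟩ t' ht'
  obtain ⟨⟨d, b⟩, -, rfl⟩ := Finset.mem_image.1 ht
  obtain ⟨⟨d', b'⟩, -, rfl⟩ := Finset.mem_image.1 ht'
  rw [hM.flag_mem_flagsOf] at ht ht'
  have h4 : ∃ x, M.regionOf x = M.flagRegion (d, b) ∧ M.flag (x, true) ∈ B := by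
    cases b
    · exact ⟨M.rev d, rfl, (h3 d ht).1 htB⟩
    · exact ⟨d, rfl, htB⟩
  obtain ⟨x, hx, hxB⟩ := hQ _ _ ht ht' h4
  cases b'
  · exact (h3 d' ht').2 (h2 x _ (hx ▸ ht') hx hxB)
  · exact h2 x _ (hx ▸ ht') hx hxB

theorem IsSuperPrime.sdiff_flagsOf (hM : M.IsSuperPrime) (N : M.Region → Prop) [DecidablePred N]
    [DecidablePred fun F => ¬ N F] :
    M.flags \ M.flagsOf (fun F => ¬ N F) = M.flagsOf N := by
  ext t
  rw [Finset.mem_sdiff]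
  constructor
  · rintro ⟨h, h'⟩
    obtain ⟨y, -, rfl⟩ := Finset.mem_image.1 h
    rw [hM.flag_mem_flagsOf, not_not] at h'
    exact hM.flag_mem_flagsOf.2 h'
  · intro h
    obtain ⟨y, hy, rfl⟩ := Finset.mem_image.1 h
    rw [hM.flag_mem_flagsOf, not_not]
    exact ⟨flag_mem_flags y, (Finset.mem_filter.1 hy).2⟩

end InnerComplement

end DoodleDiagram

/-- The set of triangles is nonempty because some crossing is off the boundary of `R`, and proper
because `R` touches itself. Its complement consists of the flags of the regions with contact to `R`.
-/
theorem DoodleDiagram.IsSuperPrime.exists_isDisk_innerComplement {D : Type*} [Fintype D]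
    {M : DoodleDiagram D} (hM : M.IsSuperPrime) (R : M.Region) :
    IsCompact (M.innerComplement R) ∧ ∃ S, IsDisk (M.innerComplement R) S := by
  classical
  rw [hM.innerComplement_eq R]
  refine ⟨isCompact_realization _, hM.isSphereTriangulation.isDisk
    (Finset.image_subset_image (Finset.filter_subset _ _)) ?_ ?_ ?_ ?_⟩
  · obtain ⟨v, hv⟩ := hM.exists_not_isOn R
    obtain ⟨d, -, hd⟩ := hM.exists_not_touches hv
    exact ⟨M.flag (d, true), hM.flag_mem_flagsOf.2 hd⟩
  · intro h
    obtain ⟨d, rfl⟩ := M.regionOf_surjective R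
    have h1 : M.flag (d, true) ∈ M.flags := flag_mem_flags _
    rw [← h, hM.flag_mem_flagsOf] at h1
    exact h1 (touches_self _)
  · exact hM.stronglyConnected_flagsOf fun Q hQ F F' hF hF' h => hM.iff_of_not_touches hQ hF hF' h
  · rw [hM.sdiff_flagsOf]
    refine hM.stronglyConnected_flagsOf fun Q hQ F F' hF hF' h => ?_
    have hQ' : ∀ d, M.Touches R (M.regionOf d) → M.Touches R (M.regionOf (M.rev d)) →
        (Q (M.regionOf d) ↔ Q (M.regionOf (M.rev d))) := fun d hd hd' =>
      ⟨hQ d hd hd', fun h => by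
        have := hQ (M.rev d) hd' (by rwa [M.rev_rev]) h
        rwa [M.rev_rev] at this⟩
    exact (iff_of_touches hQ' hF').2 ((iff_of_touches hQ' hF).1 h)

theorem theorem4p4 {D : Type*} [Finite D] (M : DoodleDiagram D) (hM : M.IsSuperPrime)
    (R : M.Region) :
    Nonempty (M.innerComplement R ≃ₜ
      Metric.closedBall (0 : EuclideanSpace ℝ (Fin 2)) 1) := by
  cases nonempty_fintype D
  obtain ⟨hc, S, hS⟩ := hM.exists_isDisk_innerComplement R
  exact hS.nonempty_homeomorph hc
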